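/- Let $\Omega\subset\mathbb{R}^n$ be open and connected with $C^2$ boundary, and let $\nu$ be its outward unit normal on $\partial\Omega$. For $x\in\partial\Omega$ let $D\nu(x)$ be the $n\times n$ matrix which on tangent vectors is the derivative of $\nu$ along $\partial\Omega$ and which satisfies $D\nu(x)\nu(x)=0$ (equivalently, the Hessian at $x$ of the signed distance to $\partial\Omega$, negative inside $\Omega$). Assume: (A1) $H=H(x,p)\in C^2(\mathbb{R}^n\times\mathbb{R}^n)$; for each $R>0$ there is $C_R>0$ with $\|H\|_{C^2(\mathbb{R}^n\times B(0,R))}\le C_R$; there is $\alpha_0>0$ with $0<D^2_{pp}H(x,p)\le\alpha_0 I_n$ for all $(x,p)$; and $\lim_{|p|\to\infty}\inf_{x\in B(0,R)}H(x,p)/|p|=\infty$ for all $R>0$. (A2) $g,u_0\in C^1(\mathbb{R}^n)$ and $\|g\|_{C^1(\mathbb{R}^n)}+\|u_0\|_{C^1(\mathbb{R}^n)}<\infty$. Let $L(x,v)=\sup_{p\in\mathbb{R}^n}(v\cdot p-H(x,p))$. For $x\in\overline\Omega$ let $\mathrm{SP}(x)$ be the set of triples $(\eta,v,l)$ with $\eta:[0,\infty)\to\mathbb{R}^n$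 locally absolutely continuous, $v\in L^1_{\rm loc}([0,\infty),\mathbb{R}^n)$, $l\in L^1_{\rm loc}([0,\infty))$, such that $\eta(0)=x$, $\eta(s)\in\overline\Omega$ for all $s\ge0$ and, for a.e. $s>0$, $\dot\eta(s)+l(s)\nu(\eta(s))=v(s)$, $l(s)\ge0$, and $l(s)=0$ if $\eta(s)\in\Omega$. Let $x\in\overline\Omega$, $t\ge0$, and let $(\eta,v,l)\in\mathrm{SP}(x)$ minimize $$\int_0^t\big(L(\eta(s),-v(s))+g(\eta(s))l(s)\big)\,ds+u_0(\eta(t))$$ over $\mathrm{SP}(x)$ (the integral is $+\infty$ when its integrand is not integrable). Put $p(s):=D_vL(\eta(s),-v(s))$, $I_0^c:=\{s\in[0,t]\mid\eta(s)\notin\Omega\}=\{s\in[0,t]\mid\eta(s)\in\partial\Omega\}$ and $I_l:=\{s\in I_0^c\mid l(s)>0\}$. Then: (i) $l(s)=-D_pH(\eta(s),p(s))\cdot\nu(\eta(s))$ for a.e. $s\in I_0^c$; (ii) $p(s)\cdot\nu(\eta(s))=g(\eta(s))$ for a.e. $s\in I_l$; (iii) on $\operatorname{int}I_l$ the function $p$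 coincides a.e. with a locally Lipschitz function, again denoted by $p$, and for a.e. $s\in\operatorname{int}I_l$, with $H$, $D_xH$, $D_pH$ evaluated at $(\eta(s),p(s))$ and $\nu$, $D\nu$, $Dg$ at $\eta(s)$, $$\dot\eta(s)=-D_pH+(D_pH\cdot\nu)\,\nu,$$ $$\dot p(s)=D_xH-(D_pH\cdot\nu)\,D\nu\,p(s)+(D_pH\cdot\nu)\,Dg-\big(D_xH\cdot\nu-(D\nu\,D_pH)\cdot p(s)+Dg\cdot D_pH\big)\,\nu .$$ -/

import Mathlib

open Set Filter Topology MeasureTheory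

noncomputable section

namespace ReflectedHJ

/-! ### Domains with `C²` boundary, outward unit normal, Weingarten map -/

section Domain

variable {E : Type*} [NormedAddCommGroup E] [InnerProductSpace ℝ E] [CompleteSpace E]

/-- `φ` is a `C²` defining function of `Ω` near `x`: it is `C²` near `x`, has a nonzero gradient
at `x`, and near `x` the set `Ω` is `{φ < 0}`. -/
structure IsDefiningFunction (Ω : Set E) (x : E) (φ : E → ℝ) : Prop where
  contDiffAt : ContDiffAt ℝ 2 φ x
  gradient_ne : gradient φ x ≠ 0
  mem_iff : ∀ᶠ y in 𝓝 x, y ∈ Ω ↔ φ y < 0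

/-- An open connected set with `C²` boundary: near each boundary point it lies on one side of
a regular `C²` level hypersurface. -/
structure IsC2Domain (Ω : Set E) : Prop where
  isOpen : IsOpen Ω
  isConnected : IsConnected Ω
  boundary : ∀ x ∈ frontier Ω, ∃ φ : E → ℝ, IsDefiningFunction Ω x φ

/-- The normalized gradient `∇φ / |∇φ|`. -/
def unitGradient (φ : E → ℝ) (y : E) : E := ‖gradient φ y‖⁻¹ • gradient φ y

/-- Some local defining function of `Ω` at `x`. -/
def definingFunction (Ω : Set E) (x : E) : E → ℝ :=
  Classical.epsilon fun φ => IsDefiningFunction Ω x φ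

/-- The outward unit normal `ν(x)` at `x ∈ ∂Ω`, that is `∇φ(x) / |∇φ(x)|` for a local defining
function `φ`; independent of `φ` by `outwardNormal_eq`. -/
def outwardNormal (Ω : Set E) (x : E) : E := unitGradient (definingFunction Ω x) x

/-- The component of `h` orthogonal to the vector `w` (for a unit vector `w`). -/
def tangentialPart (w : E) : E →L[ℝ] E :=
  ContinuousLinearMap.id ℝ E - (innerSL ℝ w).smulRight w

/-- The derivative `Dν(x)` of the outward unit normal at `x ∈ ∂Ω`, extended by zero to the normal
direction: `Dν(x) h` is the derivative of `ν` in the direction of the tangential part of `h`, where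
`ν` is extended off `∂Ω` by `∇φ / |∇φ|` in order to be differentiated. The choice of the local
defining function `φ` is irrelevant by `normalDeriv_eq`; for the signed distance to `∂Ω` (negative
inside `Ω`) this is its Hessian at `x`. -/
def normalDeriv (Ω : Set E) (x : E) : E →L[ℝ] E :=
  (fderiv ℝ (unitGradient (definingFunction Ω x)) x).comp (tangentialPart (outwardNormal Ω x))

lemma IsDefiningFunction.eq_zero {Ω : Set E} {x : E} {φ : E → ℝ} (h : IsDefiningFunction Ω x φ)
    (hx : x ∈ frontier Ω) : φ x = 0 := by
  have hc : ContinuousAt φ x := h.contDiffAt.continuousAt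
  apply le_antisymm
  · by_contra hpos
    push Not at hpos
    have h1 : ∀ᶠ y in 𝓝 x, y ∉ Ω := by
      filter_upwards [h.mem_iff, hc.eventually (lt_mem_nhds hpos)] with y hy1 hy2
      rw [hy1]; exact not_lt.mpr hy2.le
    have h2 : ∃ᶠ y in 𝓝 x, y ∈ Ω := mem_closure_iff_frequently.mp hx.1
    exact h2 h1
  · by_contra hneg
    push Not at hneg
    apply hx.2
    rw [mem_interior_iff_mem_nhds]
    filter_upwards [h.mem_iff, hc.eventually (gt_mem_nhds hneg)] with y hy1 hy2
    exact hy1.mpr hy2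

/-- Directional sign of a function vanishing at `x`. -/
lemma eventually_neg_of_inner_neg {φ : E → ℝ} {x h : E} (hd : DifferentiableAt ℝ φ x)
    (h0 : φ x = 0) (hh : inner ℝ (gradient φ x) h < 0) :
    ∀ᶠ t in 𝓝[>] (0 : ℝ), φ (x + t • h) < 0 := by
  have hl : HasDerivAt (fun t : ℝ => x + t • h) h 0 := by
    simpa using ((hasDerivAt_id (0 : ℝ)).smul_const h).const_add x
  have hd' : HasDerivAt (fun t : ℝ => φ (x + t • h)) (inner ℝ (gradient φ x) h) 0 := by
    have := hd.hasGradientAt.hasFDerivAt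
    have h2 : HasFDerivAt φ (InnerProductSpace.toDual ℝ E (gradient φ x)) (x + (0 : ℝ) • h) := by
      simpa using this
    have h3 := h2.comp_hasDerivAt (0 : ℝ) hl
    rw [InnerProductSpace.toDual_apply_apply] at h3
    exact h3
  have hs := (hasDerivAt_iff_tendsto_slope.mp hd').eventually (gt_mem_nhds hh)
  have hs' : ∀ᶠ t in 𝓝[>] (0 : ℝ), slope (fun t : ℝ => φ (x + t • h)) 0 t < 0 :=
    hs.filter_mono (nhdsWithin_mono _ (fun t ht => ne_of_gt ht))
  filter_upwards [hs', self_mem_nhdsWithin] with t ht ht0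
  have ht0' : (0 : ℝ) < t := ht0
  simp only [slope_def_field, h0, zero_smul, add_zero, sub_zero] at ht
  by_contra hc
  push Not at hc
  exact absurd ht (not_lt.mpr (div_nonneg hc ht0'.le))

lemma eventually_pos_of_inner_pos {φ : E → ℝ} {x h : E} (hd : DifferentiableAt ℝ φ x)
    (h0 : φ x = 0) (hh : 0 < inner ℝ (gradient φ x) h) :
    ∀ᶠ t in 𝓝[>] (0 : ℝ), 0 < φ (x + t • h) := by
  have hg : gradient (fun y => -φ y) x = -gradient φ x := by
    simp [gradient, fderiv_fun_neg]
  have := eventually_neg_of_inner_neg (φ := fun y => -φ y) (h := h) hd.neg (by simp [h0])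
    (by rw [hg, inner_neg_left]; linarith)
  filter_upwards [this] with t ht
  linarith

lemma tendsto_line {E : Type*} [NormedAddCommGroup E] [NormedSpace ℝ E] (x h : E) : Tendsto (fun t : ℝ => x + t • h) (𝓝[>] 0) (𝓝 x) := by
  have : ContinuousAt (fun t : ℝ => x + t • h) 0 := by fun_prop
  have h2 := this.tendsto
  simp only [zero_smul, add_zero] at h2
  exact h2.mono_left nhdsWithin_le_nhds

lemma norm_unitGradient {φ : E → ℝ} {x : E} (h : gradient φ x ≠ 0) : ‖unitGradient φ x‖ = 1 := by
  rw [unitGradient, norm_smul, norm_inv, norm_norm, inv_mul_cancel₀ (norm_ne_zero_iff.mpr h)]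

/-- Two local defining functions yield the same normal. -/
lemma unitGradient_eq {Ω : Set E} {x : E} {φ ψ : E → ℝ} (hφ : IsDefiningFunction Ω x φ)
    (hψ : IsDefiningFunction Ω x ψ) (hx : x ∈ frontier Ω) :
    unitGradient φ x = unitGradient ψ x := by
  have hdφ : DifferentiableAt ℝ φ x := hφ.contDiffAt.differentiableAt (by norm_num)
  have hdψ : DifferentiableAt ℝ ψ x := hψ.contDiffAt.differentiableAt (by norm_num)
  have key : ∀ h : E, inner ℝ (gradient φ x) h < 0 → inner ℝ (gradient ψ x) h ≤ 0 := by
    intro h hh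
    by_contra hc
    push Not at hc
    have e1 := eventually_neg_of_inner_neg hdφ (hφ.eq_zero hx) hh
    have e2 := eventually_pos_of_inner_pos hdψ (hψ.eq_zero hx) hc
    have e3 := (tendsto_line x h).eventually hφ.mem_iff
    have e4 := (tendsto_line x h).eventually hψ.mem_iff
    obtain ⟨t, h1, h2, h3, h4⟩ := (e1.and (e2.and (e3.and e4))).exists
    have := h4.mp (h3.mpr h1)
    linarith
  by_contra hne
  have n1 := norm_unitGradient hφ.gradient_ne
  have n2 := norm_unitGradient hψ.gradient_ne
  have p1 : 0 < ‖gradient φ x‖⁻¹ := inv_pos.mpr (norm_pos_iff.mpr hφ.gradient_ne)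
  have p2 : 0 < ‖gradient ψ x‖⁻¹ := inv_pos.mpr (norm_pos_iff.mpr hψ.gradient_ne)
  have hlt : inner ℝ (unitGradient φ x) (unitGradient ψ x) < (1 : ℝ) :=
    (inner_lt_one_iff_real_of_norm_eq_one n1 n2).mpr hne
  have i1 : inner ℝ (unitGradient φ x) (unitGradient ψ x - unitGradient φ x) < (0 : ℝ) := by
    rw [inner_sub_right, real_inner_self_eq_norm_sq, n1]; linarith
  have i2 : (0 : ℝ) < inner ℝ (unitGradient ψ x) (unitGradient ψ x - unitGradient φ x) := by
    rw [inner_sub_right, real_inner_self_eq_norm_sq, n2, real_inner_comm]; linarith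
  have j1 : inner ℝ (gradient φ x) (unitGradient ψ x - unitGradient φ x) < (0 : ℝ) := by
    rw [unitGradient, real_inner_smul_left] at i1
    exact (pos_iff_neg_of_mul_neg i1).mp p1
  have j2 := key _ j1
  rw [unitGradient, real_inner_smul_left] at i2
  exact absurd i2 (not_lt.mpr (mul_nonpos_of_nonneg_of_nonpos p2.le j2))

lemma definingFunction_spec {Ω : Set E} {x : E} {φ : E → ℝ} (hφ : IsDefiningFunction Ω x φ) :
    IsDefiningFunction Ω x (definingFunction Ω x) :=
  Classical.epsilon_spec (p := fun φ => IsDefiningFunction Ω x φ) ⟨φ, hφ⟩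

/-- The outward normal may be computed with any local defining function. -/
lemma outwardNormal_eq {Ω : Set E} {x : E} {φ : E → ℝ} (hφ : IsDefiningFunction Ω x φ)
    (hx : x ∈ frontier Ω) : outwardNormal Ω x = unitGradient φ x :=
  unitGradient_eq (definingFunction_spec hφ) hφ hx

lemma IsDefiningFunction.contDiffAt_gradient {Ω : Set E} {x : E} {φ : E → ℝ}
    (hφ : IsDefiningFunction Ω x φ) : ContDiffAt ℝ 1 (gradient φ) x := by
  have h1 : ContDiffAt ℝ 1 (fderiv ℝ φ) x := hφ.contDiffAt.fderiv_right (by norm_num)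
  exact (InnerProductSpace.toDual ℝ E).symm.toContinuousLinearEquiv.contDiff.contDiffAt.comp x h1

lemma IsDefiningFunction.differentiableAt_unitGradient {Ω : Set E} {x : E} {φ : E → ℝ}
    (hφ : IsDefiningFunction Ω x φ) : DifferentiableAt ℝ (unitGradient φ) x := by
  have h1 : DifferentiableAt ℝ (gradient φ) x :=
    hφ.contDiffAt_gradient.differentiableAt (by norm_num)
  exact ((h1.norm ℝ hφ.gradient_ne).inv (norm_ne_zero_iff.mpr hφ.gradient_ne)).smul h1

lemma IsDefiningFunction.eventually {Ω : Set E} {x : E} {φ : E → ℝ}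
    (hφ : IsDefiningFunction Ω x φ) : ∀ᶠ y in 𝓝 x, IsDefiningFunction Ω y φ := by
  filter_upwards [hφ.contDiffAt.eventually (by simp), hφ.mem_iff.eventually_nhds,
    hφ.contDiffAt_gradient.continuousAt.eventually_ne hφ.gradient_ne] with y h1 h2 h3
  exact ⟨h1, h3, h2⟩

/-- The tangential derivative of the normal may be computed with any local defining function. -/
lemma fderiv_unitGradient_eq {Ω : Set E} {x : E} {φ ψ : E → ℝ} (hφ : IsDefiningFunction Ω x φ)
    (hψ : IsDefiningFunction Ω x ψ) (hx : x ∈ frontier Ω) {τ : E}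
    (hτ : inner ℝ (gradient φ x) τ = 0) :
    fderiv ℝ (unitGradient φ) x τ = fderiv ℝ (unitGradient ψ) x τ := by
  have hdφ : DifferentiableAt ℝ φ x := hφ.contDiffAt.differentiableAt (by norm_num)
  set D : E →L[ℝ] E := fderiv ℝ (unitGradient φ) x - fderiv ℝ (unitGradient ψ) x with hD
  have hf : HasFDerivAt (fun y => unitGradient φ y - unitGradient ψ y) D x :=
    hφ.differentiableAt_unitGradient.hasFDerivAt.sub hψ.differentiableAt_unitGradient.hasFDerivAt
  set a := gradient φ x with ha
  have ha0 : 0 < ‖a‖ := norm_pos_iff.mpr hφ.gradient_ne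
  have hzero : ∀ᶠ y in 𝓝 x, y ∈ frontier Ω → unitGradient φ y - unitGradient ψ y = 0 := by
    filter_upwards [hφ.eventually, hψ.eventually] with y h1 h2 hy
    rw [unitGradient_eq h1 h2 hy, sub_self]
  suffices hmain : ∀ ε : ℝ, 0 < ε → ‖D τ‖ ≤ ‖D‖ * (ε * ‖a‖) + ε * (‖τ‖ + ε * ‖a‖) by
    have hlim : Tendsto (fun ε : ℝ => ‖D‖ * (ε * ‖a‖) + ε * (‖τ‖ + ε * ‖a‖)) (𝓝[>] 0) (𝓝 0) := by
      have hc : ContinuousAt (fun ε : ℝ => ‖D‖ * (ε * ‖a‖) + ε * (‖τ‖ + ε * ‖a‖)) 0 := by fun_prop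
      have := hc.tendsto
      simp only [zero_mul, mul_zero, add_zero] at this
      exact this.mono_left nhdsWithin_le_nhds
    have hle : ‖D τ‖ ≤ 0 := ge_of_tendsto hlim
      (by filter_upwards [self_mem_nhdsWithin] with ε hε using hmain ε hε)
    have h0 : D τ = 0 := norm_le_zero_iff.mp hle
    rw [hD] at h0
    simpa [sub_eq_zero] using h0
  intro ε hε
  have e0 : ∀ᶠ y in 𝓝 x, ‖(unitGradient φ y - unitGradient ψ y)
      - (unitGradient φ x - unitGradient ψ x) - D (y - x)‖ ≤ ε * ‖y - x‖ := hf.isLittleO.def hε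
  obtain ⟨r, hr, hball⟩ := Metric.eventually_nhds_iff.mp (e0.and hzero)
  have im : inner ℝ (gradient φ x) (τ - ε • a) < 0 := by
    rw [inner_sub_right, hτ, real_inner_smul_right, ← ha, real_inner_self_eq_norm_sq]
    have : 0 < ε * ‖a‖ ^ 2 := by positivity
    linarith
  have ip : 0 < inner ℝ (gradient φ x) (τ + ε • a) := by
    rw [inner_add_right, hτ, real_inner_smul_right, ← ha, real_inner_self_eq_norm_sq]
    have : 0 < ε * ‖a‖ ^ 2 := by positivity
    linarith
  have e1 := eventually_neg_of_inner_neg hdφ (hφ.eq_zero hx) im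
  have e2 := eventually_pos_of_inner_pos hdφ (hφ.eq_zero hx) ip
  have e3 := (tendsto_line x (τ - ε • a)).eventually hφ.mem_iff
  have e4 := (tendsto_line x (τ + ε • a)).eventually hφ.mem_iff
  have e5 : ∀ᶠ t in 𝓝[>] (0 : ℝ), t * (‖τ‖ + ε * ‖a‖) < r := by
    have hc : ContinuousAt (fun t : ℝ => t * (‖τ‖ + ε * ‖a‖)) 0 := by fun_prop
    have := hc.tendsto
    simp only [zero_mul] at this
    exact (this.mono_left nhdsWithin_le_nhds).eventually (gt_mem_nhds hr)
  obtain ⟨t, h1, h2, h3, h4, h5, ht⟩ :=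
    (e1.and (e2.and (e3.and (e4.and (e5.and self_mem_nhdsWithin))))).exists
  have ht : 0 < t := ht
  have hin : x + t • (τ - ε • a) ∈ Ω := h3.mpr h1
  have hout : x + t • (τ + ε • a) ∉ Ω := fun hm => by have := h4.mp hm; linarith
  have hseg : ∃ y ∈ segment ℝ (x + t • (τ - ε • a)) (x + t • (τ + ε • a)), y ∈ frontier Ω := by
    have hpc : IsPreconnected (segment ℝ (x + t • (τ - ε • a)) (x + t • (τ + ε • a))) :=
      (convex_segment _ _).isPreconnected
    by_contra hno
    push Not at hno
    have hsub : segment ℝ (x + t • (τ - ε • a)) (x + t • (τ + ε • a))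
        ⊆ interior Ω ∪ (closure Ω)ᶜ := by
      intro y hy
      by_cases hc : y ∈ closure Ω
      · left
        by_contra hi
        exact hno y hy ⟨hc, hi⟩
      · exact Or.inr hc
    have hdisj : Disjoint (interior Ω) (closure Ω)ᶜ :=
      disjoint_compl_right.mono_left (interior_subset.trans subset_closure)
    have hleft : x + t • (τ - ε • a) ∈ interior Ω := by
      rcases hsub (left_mem_segment ℝ _ _) with h | h
      · exact h
      · exact absurd (subset_closure hin) h
    have hall := hpc.subset_left_of_subset_union isOpen_interior isClosed_closure.isOpen_compl
      hdisj hsub ⟨_, left_mem_segment ℝ _ _, hleft⟩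
    exact hout (interior_subset (hall (right_mem_segment ℝ _ _)))
  obtain ⟨y, hy, hyf⟩ := hseg
  obtain ⟨α, β, hα, hβ, hαβ, rfl⟩ := hy
  have hyx : α • (x + t • (τ - ε • a)) + β • (x + t • (τ + ε • a)) - x
      = t • (τ + ((β - α) * ε) • a) := by
    have hα' : α = 1 - β := by linarith
    subst hα'
    module
  have hcoef : |β - α| ≤ 1 := by rw [abs_le]; constructor <;> linarith
  have hnw : ‖((β - α) * ε) • a‖ ≤ ε * ‖a‖ := by
    rw [norm_smul, Real.norm_eq_abs, abs_mul, abs_of_pos hε]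
    have : |β - α| * ε ≤ 1 * ε := by gcongr
    nlinarith
  have hnv : ‖τ + ((β - α) * ε) • a‖ ≤ ‖τ‖ + ε * ‖a‖ :=
    (norm_add_le _ _).trans (by linarith)
  have hdist : dist (α • (x + t • (τ - ε • a)) + β • (x + t • (τ + ε • a))) x < r := by
    rw [dist_eq_norm, hyx, norm_smul, Real.norm_eq_abs, abs_of_pos ht]
    exact lt_of_le_of_lt (by gcongr) h5
  obtain ⟨b1, b2⟩ := hball hdist
  have b2' := b2 hyf
  have b3 : unitGradient φ x - unitGradient ψ x = 0 := by rw [unitGradient_eq hφ hψ hx, sub_self]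
  rw [b2', b3, hyx, map_smul, sub_zero, zero_sub, norm_neg, norm_smul, norm_smul,
    Real.norm_eq_abs, abs_of_pos ht] at b1
  have b4 : ‖D (τ + ((β - α) * ε) • a)‖ ≤ ε * ‖τ + ((β - α) * ε) • a‖ := by
    have : t * ‖D (τ + ((β - α) * ε) • a)‖ ≤ t * (ε * ‖τ + ((β - α) * ε) • a‖) := by linarith
    exact le_of_mul_le_mul_left this ht
  have b5 : D τ = D (τ + ((β - α) * ε) • a) - D (((β - α) * ε) • a) := by
    rw [map_add]; abel
  calc ‖D τ‖ ≤ ‖D (τ + ((β - α) * ε) • a)‖ + ‖D (((β - α) * ε) • a)‖ := by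
        rw [b5]; exact norm_sub_le _ _
    _ ≤ ε * (‖τ‖ + ε * ‖a‖) + ‖D‖ * (ε * ‖a‖) := by
        have c1 : ‖D (((β - α) * ε) • a)‖ ≤ ‖D‖ * (ε * ‖a‖) :=
          (D.le_opNorm _).trans (by gcongr)
        have c2 : ε * ‖τ + ((β - α) * ε) • a‖ ≤ ε * (‖τ‖ + ε * ‖a‖) := by gcongr
        linarith
    _ = _ := by ring

/-- `Dν(x)` may be computed with any local defining function. -/
lemma normalDeriv_eq {Ω : Set E} {x : E} {φ : E → ℝ} (hφ : IsDefiningFunction Ω x φ)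
    (hx : x ∈ frontier Ω) :
    normalDeriv Ω x = (fderiv ℝ (unitGradient φ) x).comp (tangentialPart (unitGradient φ x)) := by
  ext1 h
  rw [normalDeriv, outwardNormal_eq hφ hx, ContinuousLinearMap.comp_apply,
    ContinuousLinearMap.comp_apply]
  refine (fderiv_unitGradient_eq hφ (definingFunction_spec hφ) hx ?_).symm
  have hn : gradient φ x = ‖gradient φ x‖ • unitGradient φ x := by
    rw [unitGradient, smul_smul, mul_inv_cancel₀ (norm_ne_zero_iff.mpr hφ.gradient_ne), one_smul]
  rw [hn, real_inner_smul_left]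
  simp [tangentialPart, inner_sub_right, real_inner_smul_right, norm_unitGradient hφ.gradient_ne]

end Domain

/-! ### Hamiltonian, Lagrangian, Skorokhod problem, minimizers -/

section Control

variable {n : ℕ}

/-- Assumption (A1) on the Hamiltonian `H = H(x, p)`. -/
structure AssumptionA1
    (H : EuclideanSpace ℝ (Fin n) → EuclideanSpace ℝ (Fin n) → ℝ) : Prop where
  contDiff : ContDiff ℝ 2
    (fun z : EuclideanSpace ℝ (Fin n) × EuclideanSpace ℝ (Fin n) => H z.1 z.2)
  /-- finite `C²` norm on `ℝⁿ × B(0, R)` -/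
  bounded : ∀ R > 0, ∃ C : ℝ, ∀ x, ∀ p ∈ Metric.ball (0 : EuclideanSpace ℝ (Fin n)) R, ∀ k ≤ 2,
    ‖iteratedFDeriv ℝ k
      (fun z : EuclideanSpace ℝ (Fin n) × EuclideanSpace ℝ (Fin n) => H z.1 z.2) (x, p)‖ ≤ C
  /-- `0 < D²ₚₚ H ≤ α₀ Iₙ` as quadratic forms -/
  hessian : ∃ α₀ > 0, ∀ x p ξ : EuclideanSpace ℝ (Fin n),
    (ξ ≠ 0 → 0 < iteratedFDeriv ℝ 2 (H x) p ![ξ, ξ]) ∧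
      iteratedFDeriv ℝ 2 (H x) p ![ξ, ξ] ≤ α₀ * ‖ξ‖ ^ 2
  /-- `inf {H(x, p) / |p| : x ∈ B(0, R)} → ∞` as `|p| → ∞` -/
  superlinear : ∀ R > 0, ∀ M : ℝ,
    ∀ᶠ p in Bornology.cobounded (EuclideanSpace ℝ (Fin n)),
      ∀ x ∈ Metric.ball (0 : EuclideanSpace ℝ (Fin n)) R, M ≤ H x p / ‖p‖

/-- A `C¹` function with finite `C¹` norm. -/
structure IsBoundedC1 (f : EuclideanSpace ℝ (Fin n) → ℝ) : Prop where
  contDiff : ContDiff ℝ 1 f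
  bounded : ∃ C : ℝ, ∀ x, |f x| ≤ C ∧ ‖fderiv ℝ f x‖ ≤ C

/-- `D_x H(x, p)`. -/
def gradX (H : EuclideanSpace ℝ (Fin n) → EuclideanSpace ℝ (Fin n) → ℝ)
    (x p : EuclideanSpace ℝ (Fin n)) : EuclideanSpace ℝ (Fin n) :=
  gradient (fun y => H y p) x

/-- `D_p H(x, p)`. -/
def gradP (H : EuclideanSpace ℝ (Fin n) → EuclideanSpace ℝ (Fin n) → ℝ)
    (x p : EuclideanSpace ℝ (Fin n)) : EuclideanSpace ℝ (Fin n) :=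
  gradient (H x) p

/-- The Lagrangian: the Legendre transform `L(x, v) = sup_p (v · p - H(x, p))`. -/
def lagrangian (H : EuclideanSpace ℝ (Fin n) → EuclideanSpace ℝ (Fin n) → ℝ)
    (x v : EuclideanSpace ℝ (Fin n)) : ℝ :=
  ⨆ p : EuclideanSpace ℝ (Fin n), (inner ℝ v p - H x p)

/-- `(η, v, l) ∈ SP(x)`: solutions of the Skorokhod problem on `[0, ∞)`. The values of the three
functions at negative times are irrelevant. -/
structure IsSkorokhod (Ω : Set (EuclideanSpace ℝ (Fin n))) (x : EuclideanSpace ℝ (Fin n))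
    (η v : ℝ → EuclideanSpace ℝ (Fin n)) (l : ℝ → ℝ) : Prop where
  absolutelyContinuous : ∀ T > 0, AbsolutelyContinuousOnInterval η 0 T
  locallyIntegrable_v : LocallyIntegrableOn v (Ici 0)
  locallyIntegrable_l : LocallyIntegrableOn l (Ici 0)
  initial : η 0 = x
  mem_closure : ∀ s ≥ 0, η s ∈ closure Ω
  /-- `η' + l ν(η) = v` a.e. -/
  equation : ∀ᵐ s, 0 < s → HasDerivAt η (v s - l s • outwardNormal Ω (η s)) s
  nonneg : ∀ᵐ s, 0 < s → 0 ≤ l s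
  eq_zero : ∀ᵐ s, 0 < s → η s ∈ Ω → l s = 0

/-- The running cost `L(η, -v) + g(η) l`. -/
def runningCost (H : EuclideanSpace ℝ (Fin n) → EuclideanSpace ℝ (Fin n) → ℝ)
    (g : EuclideanSpace ℝ (Fin n) → ℝ) (η v : ℝ → EuclideanSpace ℝ (Fin n)) (l : ℝ → ℝ)
    (s : ℝ) : ℝ :=
  lagrangian H (η s) (-v s) + g (η s) * l s

/-- The total cost `∫₀ᵗ (L(η, -v) + g(η) l) ds + u₀(η(t))`. -/
def totalCost (H : EuclideanSpace ℝ (Fin n) → EuclideanSpace ℝ (Fin n) → ℝ)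
    (g u₀ : EuclideanSpace ℝ (Fin n) → ℝ) (t : ℝ) (η v : ℝ → EuclideanSpace ℝ (Fin n))
    (l : ℝ → ℝ) : ℝ :=
  (∫ s in (0 : ℝ)..t, runningCost H g η v l s) + u₀ (η t)

/-- `(η, v, l) ∈ SP(x)` attains the infimum of the total cost over `SP(x)`. Since
`L(x, v) ≥ -H(x, 0)`, the negative part of the running cost is always integrable on `[0, t]`, so an
element of `SP(x)` whose running cost is not integrable has total cost `+∞`. -/
structure IsMinimizer (Ω : Set (EuclideanSpace ℝ (Fin n)))
    (H : EuclideanSpace ℝ (Fin n) → EuclideanSpace ℝ (Fin n) → ℝ)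
    (g u₀ : EuclideanSpace ℝ (Fin n) → ℝ) (x : EuclideanSpace ℝ (Fin n)) (t : ℝ)
    (η v : ℝ → EuclideanSpace ℝ (Fin n)) (l : ℝ → ℝ) : Prop where
  skorokhod : IsSkorokhod Ω x η v l
  integrable : IntervalIntegrable (runningCost H g η v l) volume 0 t
  le : ∀ (η' v' : ℝ → EuclideanSpace ℝ (Fin n)) (l' : ℝ → ℝ), IsSkorokhod Ω x η' v' l' →
    IntervalIntegrable (runningCost H g η' v' l') volume 0 t →
    totalCost H g u₀ t η v l ≤ totalCost H g u₀ t η' v' l'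

/-- The generalized momentum `p(s) = D_v L(η(s), -v(s))`. -/
def momentum (H : EuclideanSpace ℝ (Fin n) → EuclideanSpace ℝ (Fin n) → ℝ)
    (η v : ℝ → EuclideanSpace ℝ (Fin n)) (s : ℝ) : EuclideanSpace ℝ (Fin n) :=
  gradient (lagrangian H (η s)) (-v s)

/-- The times in `[0, t]` at which `η` is on the boundary, i.e. not in `Ω`. -/
def boundaryTimes (Ω : Set (EuclideanSpace ℝ (Fin n))) (t : ℝ)
    (η : ℝ → EuclideanSpace ℝ (Fin n)) : Set ℝ :=
  {s | s ∈ Icc 0 t ∧ η s ∉ Ω}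

/-- The boundary times at which `l > 0`. -/
def reflectionTimes (Ω : Set (EuclideanSpace ℝ (Fin n))) (t : ℝ)
    (η : ℝ → EuclideanSpace ℝ (Fin n)) (l : ℝ → ℝ) : Set ℝ :=
  {s | s ∈ boundaryTimes Ω t η ∧ 0 < l s}

/-- The right-hand side of the equation for `p'` in the reflected Hamiltonian system. -/
def reflectedForce (Ω : Set (EuclideanSpace ℝ (Fin n)))
    (H : EuclideanSpace ℝ (Fin n) → EuclideanSpace ℝ (Fin n) → ℝ)
    (g : EuclideanSpace ℝ (Fin n) → ℝ) (x p : EuclideanSpace ℝ (Fin n)) :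
    EuclideanSpace ℝ (Fin n) :=
  gradX H x p
    - inner ℝ (gradP H x p) (outwardNormal Ω x) • normalDeriv Ω x p
    + inner ℝ (gradP H x p) (outwardNormal Ω x) • gradient g x
    - (inner ℝ (gradX H x p) (outwardNormal Ω x)
        - inner ℝ (normalDeriv Ω x (gradP H x p)) p
        + inner ℝ (gradient g x) (gradP H x p)) • outwardNormal Ω x

end Control

end ReflectedHJ

end

/-! Each conclusion is the first-order condition for one family of competitors to the minimizer. By
Legendre duality `dualMomentum` inverts `gradP` in its second variable and equals the gradient of
the Lagrangian, so D_pH(η, p) = -v. Conclusion (i) needs no minimality. A curve in the closure of Ω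
that touches the boundary has tangential velocity there (`IsC2Domain.inner_outwardNormal_eq_zero`),
so pairing η' + lν = v with ν gives l = v·ν.

For (ii) the trajectory is kept and l is replaced by l + εk, v by v + εkν, with k supported where l
is bounded below. The cost varies by ∫ k (g - p·ν). Taking k = p·ν - g on sets that exhaust {l > 0}
yields the condition (`IsRegularMinimizer.ae_inner_momentum_eq`).

For (iii) the controls must first be shown to be bounded, which membership in L¹ does not give.
Reparametrizing time with density θ turns the cost into ∫ θ L(η, -v/θ) + g l, whose derivative at θ
= 1 is -H(η, p). Hence the energy is constant (`IsRegularMinimizer.exists_energy`), and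
superlinearity bounds p, then v, then l (`IsRegularMinimizer.exists_bound`).

On a boundary arc the competitors are Ψ(η + εψh), with Ψ a C² retraction onto ∂Ω and l kept. The
first variation and the du Bois-Reymond lemma show that the covector h ↦ p·DΨ(η)h is the primitive
of a bounded function (`IsRegularMinimizer.euler_lagrange`), which controls the tangential part of
p. Where l > 0 the normal part is g(η) by (ii). Thus p agrees a.e. with a C¹ function of Lipschitz
data. Differentiating the tangential identity and p·ν(η) = g(η) gives the two components of p'. The
second derivatives of Ψ cancel by symmetry, and self-adjointness of Dν puts the answer in the stated
form (`IsRegularMinimizer.exists_local_momentum`). -/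

noncomputable section
namespace ReflectedHJ

/-! ### Real analysis: absolutely continuous functions, first variations, du Bois-Reymond -/

section Analysis

open scoped NNReal

theorem lipschitzOnWith_integral {F : Type*} [NormedAddCommGroup F] [NormedSpace ℝ F]
    {w : ℝ → F} {a b C : ℝ} (hw : IntervalIntegrable w volume a b)
    (hC : ∀ᵐ s, s ∈ uIcc a b → ‖w s‖ ≤ C) :
    LipschitzOnWith (Real.toNNReal C) (fun x => ∫ s in a..x, w s) (uIcc a b) := by
  refine LipschitzOnWith.of_dist_le_mul fun x hx y hy => ?_
  have hs : ∀ z ∈ uIcc a b, IntervalIntegrable w volume a z := fun z hz =>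
    hw.mono_set (uIcc_subset_uIcc_left hz)
  rw [dist_eq_norm, intervalIntegral.integral_interval_sub_left (hs x hx) (hs y hy), Real.dist_eq]
  refine (intervalIntegral.norm_integral_le_of_norm_le_const_ae (C := Real.toNNReal C) ?_)
  filter_upwards [hC] with s h hs'
  exact (h (uIcc_subset_uIcc hy hx (uIoc_subset_uIcc hs'))).trans (Real.le_coe_toNNReal C)

/-- The fundamental theorem of calculus for an absolutely continuous function with a bounded
almost everywhere derivative. -/
theorem integral_eq_sub_of_absolutelyContinuous {F : Type*} [NormedAddCommGroup F]
    [NormedSpace ℝ F] [CompleteSpace F] {f w : ℝ → F} {a b C : ℝ}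
    (hf : AbsolutelyContinuousOnInterval f a b)
    (hd : ∀ᵐ s, s ∈ uIcc a b → HasDerivAt f (w s) s)
    (hw : IntervalIntegrable w volume a b)
    (hC : ∀ᵐ s, s ∈ uIcc a b → ‖w s‖ ≤ C) :
    ∫ s in a..b, w s = f b - f a := by
  -- Boundedness of `w` makes its primitive Lipschitz, hence absolutely continuous. The difference
  -- with `f` is then absolutely continuous with derivative zero a.e., so it is constant.
  have hW := (lipschitzOnWith_integral hw hC).absolutelyContinuousOnInterval
  obtain ⟨c, hc⟩ := (hf.sub hW).const_of_ae_hasDerivAt_zero (by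
    filter_upwards [hd, hw.ae_hasDerivAt_integral] with s h1 h2 hs
    simpa using (h1 hs).sub (h2 hs a left_mem_uIcc))
  have h1 := hc a left_mem_uIcc
  have h2 := hc b right_mem_uIcc
  simp only [Pi.sub_apply, intervalIntegral.integral_same, sub_zero] at h1 h2
  rw [← h1] at h2
  rw [← h2]; abel

theorem lipschitzOnWith_of_absolutelyContinuous {F : Type*} [NormedAddCommGroup F]
    [NormedSpace ℝ F] [CompleteSpace F] {f w : ℝ → F} {a b C : ℝ}
    (hf : AbsolutelyContinuousOnInterval f a b)
    (hd : ∀ᵐ s, s ∈ uIcc a b → HasDerivAt f (w s) s)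
    (hw : IntervalIntegrable w volume a b)
    (hC : ∀ᵐ s, s ∈ uIcc a b → ‖w s‖ ≤ C) :
    LipschitzOnWith (Real.toNNReal C) f (uIcc a b) := by
  have key : ∀ x ∈ uIcc a b, f x = f a + ∫ s in a..x, w s := fun x hx => by
    have hsub := uIcc_subset_uIcc_left hx
    rw [integral_eq_sub_of_absolutelyContinuous (hf.mono hsub)
      (by filter_upwards [hd] with s h hs using h (hsub hs)) (hw.mono_set hsub)
      (by filter_upwards [hC] with s h hs using h (hsub hs))]
    abel
  refine LipschitzOnWith.of_dist_le_mul fun x hx y hy => ?_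
  rw [key x hx, key y hy, dist_add_left]
  exact (lipschitzOnWith_integral hw hC).dist_le_mul x hx y hy

/-- Nothing is known about `f` off `K`. Replacing it by zero there makes it Borel and changes the
composition only on a null set. -/
theorem aestronglyMeasurable_comp_of_continuousOn {X F α : Type*} [TopologicalSpace X]
    [MeasurableSpace X] [BorelSpace X] [NormedAddCommGroup F]
    [MeasurableSpace F] [BorelSpace F] [SecondCountableTopology F]
    [MeasurableSpace α] {μ : Measure α} {f : X → F} {K : Set X} (hf : ContinuousOn f K)
    (hK : MeasurableSet K) {Y : α → X} (hY : Measurable Y) (hYK : ∀ᵐ s ∂μ, Y s ∈ K) :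
    AEStronglyMeasurable (fun s => f (Y s)) μ := by
  classical
  have h1 : Measurable (K.piecewise f fun _ => 0) := by
    refine measurable_of_restrict_of_restrict_compl hK ?_ ?_
    · rw [domRestrict_piecewise]; exact hf.domRestrict.measurable
    · rw [domRestrict_piecewise_compl]; exact measurable_const
  refine (h1.comp hY).aestronglyMeasurable.congr ?_
  filter_upwards [hYK] with s hs
  simp [hs]

theorem integrableOn_comp_of_continuousOn {X F : Type*} [TopologicalSpace X] [T2Space X]
    [MeasurableSpace X] [BorelSpace X] [NormedAddCommGroup F]
    [MeasurableSpace F] [BorelSpace F] [SecondCountableTopology F]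
    {f : X → F} {K : Set X} (hf : ContinuousOn f K)
    (hK : IsCompact K) {Y : ℝ → X} (hY : Measurable Y) {A : Set ℝ} (hA : volume A < ⊤)
    (hYK : ∀ᵐ s ∂(volume.restrict A), Y s ∈ K) :
    IntegrableOn (fun s => f (Y s)) A := by
  obtain ⟨C, hC⟩ := hK.exists_bound_of_continuousOn hf
  have : IsFiniteMeasure (volume.restrict A) := ⟨by simpa using hA⟩
  refine Integrable.of_bound
    (aestronglyMeasurable_comp_of_continuousOn hf hK.measurableSet hY hYK) C ?_
  filter_upwards [hYK] with s hs using hC _ hs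

/-- A C¹ function is Lipschitz near each point (0, y). A finite subcover allows the smallest radius
and the largest constant. The uniform constant is the dominating function when differentiating in ε
under the integral. -/
theorem exists_lipschitz_near_compact {X : Type*} [NormedAddCommGroup X] [NormedSpace ℝ X]
    {Γ : ℝ × X → ℝ} {K : Set X} (hK : IsCompact K) (h : ∀ y ∈ K, ContDiffAt ℝ 1 Γ (0, y)) :
    ∃ δ > 0, ∃ C : ℝ≥0, ∀ y ∈ K, LipschitzOnWith C (fun ε => Γ (ε, y)) (Metric.ball 0 δ) ∧
      ∀ ε ∈ Metric.ball (0 : ℝ) δ, ContinuousAt Γ (ε, y) := by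
  refine hK.induction_on (p := fun S => ∃ δ > 0, ∃ C : ℝ≥0, ∀ y ∈ S,
    LipschitzOnWith C (fun ε => Γ (ε, y)) (Metric.ball 0 δ) ∧
      ∀ ε ∈ Metric.ball (0 : ℝ) δ, ContinuousAt Γ (ε, y)) ?_ ?_ ?_ ?_
  · exact ⟨1, one_pos, 0, by simp⟩
  · rintro s t hst ⟨δ, hδ, C, hC⟩
    exact ⟨δ, hδ, C, fun y hy => hC y (hst hy)⟩
  · rintro s t ⟨δ, hδ, C, hC⟩ ⟨δ', hδ', C', hC'⟩
    refine ⟨min δ δ', lt_min hδ hδ', max C C', ?_⟩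
    rintro y (hy | hy)
    · have hb := Metric.ball_subset_ball (x := (0 : ℝ)) (min_le_left δ δ')
      exact ⟨((hC y hy).1.mono hb).weaken (le_max_left _ _), fun ε hε => (hC y hy).2 ε (hb hε)⟩
    · have hb := Metric.ball_subset_ball (x := (0 : ℝ)) (min_le_right δ δ')
      exact ⟨((hC' y hy).1.mono hb).weaken (le_max_right _ _), fun ε hε => (hC' y hy).2 ε (hb hε)⟩
  · intro y hy
    obtain ⟨C, t, ht, hC⟩ := (h y hy).exists_lipschitzOnWith
    have hc := (h y hy).eventually (by simp)
    obtain ⟨δ, hδ, hball⟩ := Metric.mem_nhds_iff.mp (inter_mem ht hc)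
    refine ⟨Metric.ball y δ, mem_nhdsWithin_of_mem_nhds (Metric.ball_mem_nhds y hδ), δ, hδ, C, ?_⟩
    intro z hz
    have hin : ∀ ε ∈ Metric.ball (0 : ℝ) δ, (ε, z) ∈ Metric.ball ((0 : ℝ), y) δ := fun ε hε => by
      rw [Metric.mem_ball, Prod.dist_eq]; exact max_lt hε hz
    refine ⟨LipschitzOnWith.of_dist_le_mul fun a ha b hb => ?_, fun ε hε => ?_⟩
    · refine (hC.dist_le_mul _ (hball (hin a ha)).1 _ (hball (hin b hb)).1).trans (le_of_eq ?_)
      simp [Prod.dist_eq]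
    · have h1 : ContDiffAt ℝ 1 Γ (ε, z) := (hball (hin ε hε)).2
      exact h1.continuousAt

/-- The first variation vanishes at a minimum. -/
theorem first_variation {X : Type*} [NormedAddCommGroup X] [NormedSpace ℝ X]
    [MeasurableSpace X] [BorelSpace X] {Γ : ℝ × X → ℝ} {K : Set X} (hK : IsCompact K)
    (h : ∀ y ∈ K, ContDiffAt ℝ 1 Γ (0, y)) {Y : ℝ → X} (hY : Measurable Y) {A : Set ℝ}
    (hA : volume A < ⊤) (hYK : ∀ᵐ s ∂(volume.restrict A), Y s ∈ K)
    (hmin : ∀ᶠ ε in 𝓝 (0 : ℝ), ∫ s in A, Γ (0, Y s) ≤ ∫ s in A, Γ (ε, Y s)) {D : ℝ → ℝ}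
    (hD : ∀ᵐ s ∂(volume.restrict A), HasDerivAt (fun ε => Γ (ε, Y s)) (D s) 0) :
    ∫ s in A, D s = 0 := by
  have hfin : IsFiniteMeasure (volume.restrict A) := ⟨by simpa using hA⟩
  obtain ⟨δ, hδ, C, hC⟩ := exists_lipschitz_near_compact hK h
  have hcont : ∀ ε ∈ Metric.ball (0 : ℝ) δ, ContinuousOn (fun y => Γ (ε, y)) K :=
    fun ε hε y hy => (((hC y hy).2 ε hε).comp (f := fun y => (ε, y))
      (by fun_prop)).continuousWithinAt
  -- No measurability of `D` is assumed. It is inherited from the ε-derivative of `Γ`, which is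
  -- continuous on `K` and is evaluated along the measurable map `Y`.
  have hDeq : ∀ᵐ s ∂(volume.restrict A), fderiv ℝ Γ (0, Y s) (1, 0) = D s := by
    filter_upwards [hD, hYK] with s h1 h2
    have h3 : HasDerivAt (fun ε : ℝ => (ε, Y s)) (1, 0) 0 :=
      (hasDerivAt_id (0 : ℝ)).prodMk (hasDerivAt_const _ _)
    exact ((((h _ h2).differentiableAt (by simp)).hasFDerivAt).comp_hasDerivAt
      (0 : ℝ) h3).unique h1
  have hDm : AEStronglyMeasurable D (volume.restrict A) := by
    refine (aestronglyMeasurable_comp_of_continuousOn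
      (f := fun y => fderiv ℝ Γ (0, y) (1, 0)) (fun y hy => ?_) hK.measurableSet hY hYK).congr hDeq
    have h1 : ContinuousAt (fderiv ℝ Γ) (0, y) :=
      ((h y hy).fderiv_right (m := 0) (by simp)).continuousAt
    have h2 : ContinuousAt (fun y => fderiv ℝ Γ (0, y)) y :=
      h1.comp (f := fun y => ((0 : ℝ), y)) (by fun_prop)
    exact (h2.clm_apply continuousAt_const).continuousWithinAt
  have key := hasDerivAt_integral_of_dominated_loc_of_lip (μ := volume.restrict A)
    (F := fun ε s => Γ (ε, Y s)) (F' := D) (bound := fun _ => (C : ℝ))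
    (Metric.ball_mem_nhds (0 : ℝ) hδ)
    (by
      filter_upwards [Metric.ball_mem_nhds (0 : ℝ) hδ] with ε hε
      exact aestronglyMeasurable_comp_of_continuousOn (f := fun y => Γ (ε, y))
        (hcont ε hε) hK.measurableSet hY hYK)
    (integrableOn_comp_of_continuousOn (hcont 0 (Metric.mem_ball_self hδ)) hK hY hA hYK)
    hDm
    (by
      filter_upwards [hYK] with s hs
      simpa using (hC _ hs).1)
    (integrable_const _) hD
  have hmin' : IsLocalMin (fun ε => ∫ s in A, Γ (ε, Y s)) 0 := hmin
  exact hmin'.hasDerivAt_eq_zero key.2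

/-- Integration by parts: the integrand is the derivative of the product of the primitives of `u`
and `R`. This product vanishes at `a`, and at `b` because `u` has mean zero. -/
theorem integral_smul_primitive {F : Type*} [NormedAddCommGroup F] [NormedSpace ℝ F]
    [CompleteSpace F] {u : ℝ → ℝ} {R : ℝ → F} {a b C : ℝ} (hu : IntervalIntegrable u volume a b)
    (hR : IntervalIntegrable R volume a b) (hub : ∀ s, |u s| ≤ 1)
    (hRb : ∀ᵐ s, s ∈ uIcc a b → ‖R s‖ ≤ C) (h0 : ∫ s in a..b, u s = 0) :
    ∫ s in a..b, ((∫ r in a..s, u r) • R s + u s • ∫ r in a..s, R r) = 0 := by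
  have hub' : ∀ᵐ s, s ∈ uIcc a b → ‖u s‖ ≤ 1 := ae_of_all _ fun s _ => hub s
  have h1 := (lipschitzOnWith_integral hu hub').absolutelyContinuousOnInterval
  have h2 := (lipschitzOnWith_integral hR hRb).absolutelyContinuousOnInterval
  obtain ⟨C1, hC1⟩ := h1.exists_bound
  obtain ⟨C2, hC2⟩ := h2.exists_bound
  have i1 := hR.continuousOn_smul h1.continuousOn
  have i2 := hu.smul_continuousOn h2.continuousOn
  have key := integral_eq_sub_of_absolutelyContinuous (h1.smul h2) (C := C1 * C + 1 * C2)
    (w := fun s => (∫ r in a..s, u r) • R s + u s • ∫ r in a..s, R r) (by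
      filter_upwards [hu.ae_hasDerivAt_integral, hR.ae_hasDerivAt_integral] with s h3 h4 hs
      exact (h3 hs a left_mem_uIcc).smul (h4 hs a left_mem_uIcc)) (i1.add i2) (by
      filter_upwards [hRb] with s h3 hs
      refine (norm_add_le _ _).trans (add_le_add ?_ ?_)
      · rw [norm_smul]
        exact mul_le_mul (hC1 s hs) (h3 hs) (norm_nonneg _) ((norm_nonneg _).trans (hC1 s hs))
      · rw [norm_smul]
        exact mul_le_mul (hub s) (hC2 s hs) (norm_nonneg _) zero_le_one)
  rw [key]
  simp [h0]

/-- The du Bois-Reymond lemma. -/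
theorem du_bois_reymond {F : Type*} [NormedAddCommGroup F] [NormedSpace ℝ F]
    [CompleteSpace F] {f R : ℝ → F} {a b C : ℝ} (hab : a < b)
    (hf : IntervalIntegrable f volume a b) (hR : IntervalIntegrable R volume a b)
    (hRb : ∀ᵐ s, s ∈ uIcc a b → ‖R s‖ ≤ C)
    (h : ∀ u : ℝ → ℝ, Measurable u → (∀ s, |u s| ≤ 1) → ∫ s in a..b, u s = 0 →
      ∫ s in a..b, (u s • f s + (∫ r in a..s, u r) • R s) = 0) :
    ∃ c, ∀ᵐ s, s ∈ Ioc a b → f s = c + ∫ r in a..s, R r := by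
  -- Integrating by parts turns the hypothesis into ∫ u G = 0 for every admissible `u`, so `G`
  -- should equal its mean `m`. This is checked through integrals over measurable sets `B`.
  set G : ℝ → F := fun s => f s - ∫ r in a..s, R r with hG
  have hRc := (lipschitzOnWith_integral hR hRb).continuousOn
  have hGi : IntervalIntegrable G volume a b := hf.sub hRc.intervalIntegrable
  set m : F := (b - a)⁻¹ • ∫ s in a..b, G s with hm
  have hba : 0 < b - a := sub_pos.mpr hab
  have key : G =ᵐ[volume.restrict (Ioc a b)] fun _ => m := by
    refine Integrable.ae_eq_of_forall_setIntegral_eq _ _ hGi.1 (integrable_const _) ?_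
    intro B hB _
    set β : ℝ := (volume.restrict (Ioc a b)).real B with hβ
    have hβ1 : 0 ≤ β := measureReal_nonneg
    have hβ2 : β ≤ b - a := by
      have := measureReal_mono (μ := volume.restrict (Ioc a b)) (subset_univ B)
      rwa [measureReal_restrict_apply MeasurableSet.univ, univ_inter, Real.volume_real_Ioc_of_le
        hab.le] at this
    -- The indicator of `B` minus its mean over the interval. It has mean zero, and |u| ≤ 1 because
    -- the subtracted constant lies in [0, 1].
    set u : ℝ → ℝ := fun s => B.indicator 1 s - β / (b - a) with hu
    have hum : Measurable u := (measurable_one.indicator hB).sub_const _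
    have hq1 : 0 ≤ β / (b - a) := by positivity
    have hq2 : β / (b - a) ≤ 1 := (div_le_one hba).mpr hβ2
    have hub : ∀ s, |u s| ≤ 1 := fun s => by
      rw [abs_le]
      by_cases hs : s ∈ B <;> simp only [hu, hs, indicator_of_mem, indicator_of_notMem,
        not_false_eq_true, Pi.one_apply] <;> constructor <;> linarith
    have hui : IntervalIntegrable u volume a b := by
      rw [intervalIntegrable_iff]
      exact Measure.integrableOn_of_bounded (M := 1) (by simp) hum.aestronglyMeasurable
        (ae_of_all _ hub)
    have hii : IntervalIntegrable (B.indicator (1 : ℝ → ℝ)) volume a b := by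
      have := hui.add (intervalIntegrable_const (c := β / (b - a)))
      simpa [hu] using this
    have hu0 : ∫ s in a..b, u s = 0 := by
      rw [hu, intervalIntegral.integral_sub hii intervalIntegrable_const,
        intervalIntegral.integral_of_le hab.le, integral_indicator_one hB,
        intervalIntegral.integral_const, smul_eq_mul, mul_div_cancel₀ _ hba.ne', sub_self]
    have e1 := h u hum hub hu0
    have e2 := integral_smul_primitive hui hR hub hRb hu0
    have hψc := (lipschitzOnWith_integral (C := 1) hui (ae_of_all _ fun s _ => hub s)).continuousOn
    have iψR := hR.continuousOn_smul hψc
    have iuR := hui.smul_continuousOn hRc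
    have bdd : ∀ {g : ℝ → F}, IntervalIntegrable g volume a b →
        IntervalIntegrable (fun s => u s • g s) volume a b := fun {g} hg => by
      rw [intervalIntegrable_iff] at hg ⊢
      exact hg.bdd_smul 1 hum.aestronglyMeasurable (ae_of_all _ hub)
    have e3 : ∫ s in a..b, u s • G s = 0 := by
      have : ∀ s, u s • G s = (u s • f s + (∫ r in a..s, u r) • R s)
          - ((∫ r in a..s, u r) • R s + u s • ∫ r in a..s, R r) := fun s => by
        simp only [hG, smul_sub]; abel
      simp_rw [this]
      rw [intervalIntegral.integral_sub ((bdd hf).add iψR) (iψR.add iuR), e1, e2, sub_self]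
    have iB : IntervalIntegrable (fun s => B.indicator (1 : ℝ → ℝ) s • G s) volume a b := by
      have := (bdd hGi).add (hGi.smul (β / (b - a)))
      refine this.congr fun s _ => ?_
      simp [hu, sub_smul]
    have e4 : ∫ s in a..b, B.indicator (1 : ℝ → ℝ) s • G s = β • m := by
      have e5 : ∫ s in a..b, u s • G s = (∫ s in a..b, B.indicator (1 : ℝ → ℝ) s • G s)
          - (β / (b - a)) • ∫ s in a..b, G s := by
        have iG : IntervalIntegrable (fun s => (β / (b - a)) • G s) volume a b := hGi.smul _
        rw [← intervalIntegral.integral_smul, ← intervalIntegral.integral_sub iB iG]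
        simp only [hu, sub_smul]
      rw [e3] at e5
      rw [sub_eq_zero.mp e5.symm, hm, smul_smul, div_eq_mul_inv]
    rw [setIntegral_const, ← hβ, ← e4, intervalIntegral.integral_of_le hab.le,
      ← integral_indicator hB]
    refine integral_congr_ae (ae_of_all _ fun s => ?_)
    by_cases hs : s ∈ B <;> simp [hs]
  refine ⟨m, ?_⟩
  rw [Filter.EventuallyEq, ae_restrict_iff' measurableSet_Ioc] at key
  filter_upwards [key] with s hs hs'
  rw [← hs hs', hG]; simp

end Analysis

/-! ### Legendre duality between H and L -/

section Legendre

/-- The inverse function theorem at a point where the derivative is injective. -/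
theorem exists_local_inverse {X : Type*} [NormedAddCommGroup X] [NormedSpace ℝ X]
    [FiniteDimensional ℝ X] {k : ℕ∞} (hk : (k : WithTop ℕ∞) ≠ 0) {Φ : X → X} {a : X}
    (hΦ : ContDiffAt ℝ k Φ a) (hinj : ∀ h, fderiv ℝ Φ a h = 0 → h = 0) :
    ∃ χ : X → X, ContDiffAt ℝ k χ (Φ a) ∧ χ (Φ a) = a ∧ (∀ᶠ y in 𝓝 (Φ a), Φ (χ y) = y) ∧
      ∀ᶠ x in 𝓝 a, χ (Φ x) = x := by
  have : CompleteSpace X := FiniteDimensional.complete ℝ X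
  have hker : Function.Injective (fderiv ℝ Φ a : X →ₗ[ℝ] X) :=
    (injective_iff_map_eq_zero _).mpr hinj
  -- In finite dimension an injective endomorphism is an isomorphism.
  set e : X ≃L[ℝ] X := (LinearEquiv.ofInjectiveEndo _ hker).toContinuousLinearEquiv with he
  have hd : HasFDerivAt Φ (e : X →L[ℝ] X) a := by
    have : (e : X →L[ℝ] X) = fderiv ℝ Φ a := by
      ext h; simp [he]
    rw [this]
    exact (hΦ.differentiableAt hk).hasFDerivAt
  have hs : HasStrictFDerivAt Φ (e : X →L[ℝ] X) a := hΦ.hasStrictFDerivAt' hd hk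
  refine ⟨hs.localInverse Φ e a, hΦ.to_localInverse hd hk, hs.localInverse_apply_image,
    hs.eventually_right_inverse, hs.eventually_left_inverse⟩

variable {n : ℕ} {H : EuclideanSpace ℝ (Fin n) → EuclideanSpace ℝ (Fin n) → ℝ}

local notation "E" => EuclideanSpace ℝ (Fin n)

theorem AssumptionA1.contDiff_right (hH : AssumptionA1 H) (x : E) : ContDiff ℝ 2 (H x) :=
  hH.contDiff.comp (contDiff_prodMk_right x)

theorem inner_gradient {f : E → ℝ} (x h : E) :
    inner ℝ (gradient f x) h = fderiv ℝ f x h := by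
  simp [gradient]

theorem AssumptionA1.fderiv_apply (hH : AssumptionA1 H) (x p h k : E) :
    fderiv ℝ (fun z : E × E => H z.1 z.2) (x, p) (h, k)
      = inner ℝ (gradX H x p) h + inner ℝ (gradP H x p) k := by
  have hd := (hH.contDiff.differentiable (by norm_num) (x, p)).hasFDerivAt
  have h1 : HasFDerivAt (fun y => H y p) _ x :=
    hd.comp (f := fun y => (y, p)) x (hasFDerivAt_prodMk_left x p)
  have h2 : HasFDerivAt (H x) _ p := hd.comp (f := fun q => (x, q)) p (hasFDerivAt_prodMk_right x p)
  rw [gradX, gradP, inner_gradient, inner_gradient, h1.fderiv, h2.fderiv]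
  simp [← map_add]

theorem AssumptionA1.gradP_eq (hH : AssumptionA1 H) (z : E × E) :
    gradP H z.1 z.2 = (InnerProductSpace.toDual ℝ E).symm
      ((fderiv ℝ (fun z : E × E => H z.1 z.2) z).comp (ContinuousLinearMap.inr ℝ E E)) := by
  refine ext_inner_right ℝ fun k => ?_
  rw [InnerProductSpace.toDual_symm_apply, ContinuousLinearMap.comp_apply,
    ContinuousLinearMap.inr_apply, hH.fderiv_apply]
  simp

theorem AssumptionA1.gradX_eq (hH : AssumptionA1 H) (z : E × E) :
    gradX H z.1 z.2 = (InnerProductSpace.toDual ℝ E).symm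
      ((fderiv ℝ (fun z : E × E => H z.1 z.2) z).comp (ContinuousLinearMap.inl ℝ E E)) := by
  refine ext_inner_right ℝ fun k => ?_
  rw [InnerProductSpace.toDual_symm_apply, ContinuousLinearMap.comp_apply,
    ContinuousLinearMap.inl_apply, hH.fderiv_apply]
  simp

theorem AssumptionA1.contDiff_gradP (hH : AssumptionA1 H) :
    ContDiff ℝ 1 (fun z : E × E => gradP H z.1 z.2) := by
  simp_rw [hH.gradP_eq]
  have h1 : ContDiff ℝ 1 (fderiv ℝ (fun z : E × E => H z.1 z.2)) :=
    hH.contDiff.fderiv_right (by norm_num)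
  exact (InnerProductSpace.toDual ℝ E).symm.toContinuousLinearEquiv.contDiff.comp
    (h1.clm_comp contDiff_const)

theorem AssumptionA1.continuous_gradX (hH : AssumptionA1 H) :
    Continuous (fun z : E × E => gradX H z.1 z.2) := by
  simp_rw [hH.gradX_eq]
  have h1 : Continuous (fderiv ℝ (fun z : E × E => H z.1 z.2)) :=
    hH.contDiff.continuous_fderiv (by norm_num)
  exact (InnerProductSpace.toDual ℝ E).symm.continuous.comp
    (h1.clm_comp continuous_const)

theorem AssumptionA1.differentiable_gradP (hH : AssumptionA1 H) (x : E) :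
    Differentiable ℝ (gradP H x) :=
  (hH.contDiff_gradP.comp (contDiff_prodMk_right x)).differentiable (by norm_num)

/-- The form is the second derivative of `H x` evaluated on (k, k), so positivity is the lower
Hessian bound in (A1). Only strict positivity is available, without a uniform constant. -/
theorem AssumptionA1.inner_fderiv_gradP_pos (hH : AssumptionA1 H) (x p : E) {k : E}
    (hk : k ≠ 0) : 0 < inner ℝ (fderiv ℝ (gradP H x) p k) k := by
  obtain ⟨_, _, h⟩ := hH.hessian
  have h1 := (h x p k).1 hk
  rw [iteratedFDeriv_two_apply] at h1
  have h2 : ContDiff ℝ 1 (fderiv ℝ (H x)) := (hH.contDiff_right x).fderiv_right (by norm_num)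
  have h3 : HasFDerivAt (fun q => inner ℝ (gradP H x q) k) _ p :=
    (hH.differentiable_gradP x p).hasFDerivAt.inner ℝ (hasFDerivAt_const k p)
  have h4 : HasFDerivAt (fun q => fderiv ℝ (H x) q k) _ p :=
    (h2.differentiable (by norm_num) p).hasFDerivAt.clm_apply (hasFDerivAt_const k p)
  have h5 : (fun q => inner ℝ (gradP H x q) k) = fun q => fderiv ℝ (H x) q k := by
    ext q; rw [gradP, inner_gradient]
  rw [h5] at h3
  have h6 := congrArg (fun f : E →L[ℝ] ℝ => f k) (h3.unique h4)
  simp only [ContinuousLinearMap.comp_apply, fderivInnerCLM_apply] at h6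
  simp at h6 h1
  rw [h6]
  exact h1

/-- Along the segment from q to p the component of D_pH in the direction p - q is strictly
increasing, so it cannot take the same value at both ends. -/
theorem AssumptionA1.gradP_injective (hH : AssumptionA1 H) (x : E) :
    Function.Injective (gradP H x) := by
  intro p q hpq
  by_contra hne
  have hk : p - q ≠ 0 := sub_ne_zero.mpr hne
  have hderiv : ∀ s : ℝ, HasDerivAt (fun s : ℝ => inner ℝ (gradP H x (q + s • (p - q))) (p - q))
      (inner ℝ (fderiv ℝ (gradP H x) (q + s • (p - q)) (p - q)) (p - q)) s := by
    intro s
    have hl : HasDerivAt (fun t : ℝ => q + t • (p - q)) (p - q) s := by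
      simpa using ((hasDerivAt_id s).smul_const (p - q)).const_add q
    have h1 := (hH.differentiable_gradP x (q + s • (p - q))).hasFDerivAt.comp_hasDerivAt s hl
    simpa using h1.inner ℝ (hasDerivAt_const s (p - q))
  have hmono := strictMono_of_deriv_pos (f := fun s : ℝ =>
    inner ℝ (gradP H x (q + s • (p - q))) (p - q)) fun s => by
      rw [(hderiv s).deriv]; exact hH.inner_fderiv_gradP_pos x _ hk
  have := hmono zero_lt_one
  simp [hpq] at this

theorem AssumptionA1.exists_max (hH : AssumptionA1 H) (x w : E) :
    ∃ p, ∀ q, inner ℝ w q - H x q ≤ inner ℝ w p - H x p := by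
  have hcont : Continuous fun p => H x p - inner ℝ w p :=
    (hH.contDiff_right x).continuous.sub (by fun_prop)
  -- Slope ‖w‖ + 1 beats the linear term by ‖p‖, which makes H(x, p) - w·p coercive. The radius only
  -- serves to include `x` in the ball.
  have hev := hH.superlinear (‖x‖ + 1) (by positivity) (‖w‖ + 1)
  have hlim : Tendsto (fun p => H x p - inner ℝ w p) (cocompact E) atTop := by
    rw [← Metric.cobounded_eq_cocompact]
    refine tendsto_atTop_mono' _ ?_ tendsto_norm_cobounded_atTop
    filter_upwards [hev, eventually_cobounded_le_norm (1 : ℝ)] with p h1 h2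
    have h3 := h1 x (by simp)
    have hp : 0 < ‖p‖ := by linarith
    rw [le_div_iff₀ hp] at h3
    have h4 := real_inner_le_norm w p
    nlinarith
  obtain ⟨p, hp⟩ := hcont.exists_forall_le hlim
  exact ⟨p, fun q => by have := hp q; linarith⟩

theorem AssumptionA1.exists_momentum (hH : AssumptionA1 H) (x w : E) :
    ∃ p, gradP H x p = w ∧ lagrangian H x w = inner ℝ w p - H x p := by
  obtain ⟨p, hp⟩ := hH.exists_max x w
  refine ⟨p, ?_, ?_⟩
  · have hd : HasFDerivAt (fun q => inner ℝ w q - H x q) (innerSL ℝ w - fderiv ℝ (H x) p) p :=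
      (innerSL ℝ w).hasFDerivAt.sub
        ((hH.contDiff_right x).differentiable (by norm_num) p).hasFDerivAt
    have hmax : IsLocalMax (fun q => inner ℝ w q - H x q) p := Eventually.of_forall hp
    have h0 := hmax.hasFDerivAt_eq_zero hd
    refine ext_inner_right ℝ fun k => ?_
    have := congrArg (fun f : E →L[ℝ] ℝ => f k) h0
    simp only [sub_apply, zero_apply, innerSL_apply_apply]
      at this
    rw [gradP, inner_gradient]
    linarith
  · exact le_antisymm (ciSup_le hp) (le_ciSup ⟨_, by rintro _ ⟨q, rfl⟩; exact hp q⟩ p)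

/-- The solution `p` of `w = D_p H(x, p)`. -/
def dualMomentum (H : E → E → ℝ) (x w : E) : E := Classical.epsilon fun p =>
  gradP H x p = w ∧ lagrangian H x w = inner ℝ w p - H x p

theorem AssumptionA1.gradP_dualMomentum (hH : AssumptionA1 H) (x w : E) :
    gradP H x (dualMomentum H x w) = w :=
  (Classical.epsilon_spec (hH.exists_momentum x w)).1

theorem AssumptionA1.lagrangian_eq (hH : AssumptionA1 H) (x w : E) :
    lagrangian H x w = inner ℝ w (dualMomentum H x w) - H x (dualMomentum H x w) :=
  (Classical.epsilon_spec (hH.exists_momentum x w)).2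

/-- Inverse function theorem for (x, p) ↦ (x, D_pH(x, p)). Its derivative is injective because D²_pp
H is positive. By injectivity of `gradP` the second component of the local inverse can only be
`dualMomentum`. -/
theorem AssumptionA1.contDiff_dualMomentum (hH : AssumptionA1 H) :
    ContDiff ℝ 1 (fun z : E × E => dualMomentum H z.1 z.2) := by
  rw [contDiff_iff_contDiffAt]
  rintro ⟨x, w⟩
  set Φ : E × E → E × E := fun z => (z.1, gradP H z.1 z.2) with hΦ
  have hΦc : ContDiff ℝ 1 Φ := contDiff_fst.prodMk hH.contDiff_gradP
  set a : E × E := (x, dualMomentum H x w) with ha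
  have hΦa : Φ a = (x, w) := by simp [hΦ, ha, hH.gradP_dualMomentum]
  have hinj : ∀ h, fderiv ℝ Φ a h = 0 → h = 0 := by
    rintro ⟨h, k⟩ h0
    have hG := (hH.contDiff_gradP.differentiable (by norm_num) a).hasFDerivAt
    have h1 : HasFDerivAt Φ _ a := hasFDerivAt_fst.prodMk hG
    rw [h1.fderiv] at h0
    simp only [ContinuousLinearMap.prod_apply, ContinuousLinearMap.coe_fst',
      Prod.mk_eq_zero] at h0
    obtain ⟨rfl, h2⟩ := h0
    have h3 : HasFDerivAt (gradP H x) _ (dualMomentum H x w) :=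
      hG.comp (f := fun q => (x, q)) _ (hasFDerivAt_prodMk_right x _)
    by_contra hne
    have hk : k ≠ 0 := fun hk => hne (by simp [hk])
    have h4 := hH.inner_fderiv_gradP_pos x (dualMomentum H x w) hk
    rw [h3.fderiv, ContinuousLinearMap.comp_apply, ContinuousLinearMap.inr_apply, h2,
      inner_zero_left] at h4
    exact lt_irrefl _ h4
  obtain ⟨χ, h1, -, h2, -⟩ := exists_local_inverse (k := 1) (by norm_num) hΦc.contDiffAt hinj
  rw [hΦa] at h1 h2
  refine (contDiffAt_snd.comp _ h1).congr_of_eventuallyEq ?_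
  filter_upwards [h2] with y hy'
  have hy : ((χ y).1, gradP H (χ y).1 (χ y).2) = y := hy'
  have e1 : (χ y).1 = y.1 := (Prod.ext_iff.mp hy).1
  have e2 : gradP H (χ y).1 (χ y).2 = y.2 := (Prod.ext_iff.mp hy).2
  apply hH.gradP_injective y.1
  rw [hH.gradP_dualMomentum, ← e2, e1, Function.comp_apply]

theorem AssumptionA1.continuous_dualMomentum (hH : AssumptionA1 H) :
    Continuous (fun z : E × E => dualMomentum H z.1 z.2) :=
  hH.contDiff_dualMomentum.continuous

theorem AssumptionA1.contDiff_lagrangian (hH : AssumptionA1 H) :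
    ContDiff ℝ 1 (fun z : E × E => lagrangian H z.1 z.2) := by
  simp_rw [hH.lagrangian_eq]
  exact (contDiff_snd.inner ℝ hH.contDiff_dualMomentum).sub
    ((hH.contDiff.of_le (by norm_num)).comp (contDiff_fst.prodMk hH.contDiff_dualMomentum))

/-- Envelope theorem: the terms containing the derivative of the maximizer cancel because D_pH at
the maximizer is w. What remains is D_xL = -D_xH and D_vL = p. -/
theorem AssumptionA1.fderiv_lagrangian (hH : AssumptionA1 H) (x w h k : E) :
    fderiv ℝ (fun z : E × E => lagrangian H z.1 z.2) (x, w) (h, k)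
      = inner ℝ (dualMomentum H x w) k - inner ℝ (gradX H x (dualMomentum H x w)) h := by
  simp_rw [hH.lagrangian_eq]
  have h1 := (hH.contDiff_dualMomentum.differentiable (by norm_num) (x, w)).hasFDerivAt
  have h2 := (hH.contDiff.differentiable (by norm_num) (x, dualMomentum H x w)).hasFDerivAt
  have h3 := h2.comp (f := fun z : E × E => (z.1, dualMomentum H z.1 z.2)) (x, w)
    (hasFDerivAt_fst.prodMk h1)
  have h4 := ((hasFDerivAt_snd (p := (x, w))).inner ℝ h1).sub h3
  have h5 := congrArg (fun f : E × E →L[ℝ] ℝ => f (h, k)) h4.fderiv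
  refine h5.trans ?_
  simp only [sub_apply, ContinuousLinearMap.comp_apply,
    ContinuousLinearMap.prod_apply, ContinuousLinearMap.coe_fst',
    ContinuousLinearMap.coe_snd', hH.fderiv_apply, fderivInnerCLM_apply, hH.gradP_dualMomentum]
  rw [real_inner_comm (dualMomentum H x w) k]; ring

theorem AssumptionA1.gradient_lagrangian (hH : AssumptionA1 H) (x w : E) :
    gradient (lagrangian H x) w = dualMomentum H x w := by
  refine ext_inner_right ℝ fun k => ?_
  have hd := (hH.contDiff_lagrangian.differentiable (by norm_num) (x, w)).hasFDerivAt
  have h2 : HasFDerivAt (lagrangian H x) _ w :=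
    hd.comp (f := fun q => (x, q)) w (hasFDerivAt_prodMk_right x w)
  rw [inner_gradient, h2.fderiv, ContinuousLinearMap.comp_apply, ContinuousLinearMap.inr_apply,
    hH.fderiv_lagrangian]
  simp

end Legendre

/-! ### The outward normal on the boundary and tangency of trajectories -/

section Boundary

variable {n : ℕ} {Ω : Set (EuclideanSpace ℝ (Fin n))}

local notation "E" => EuclideanSpace ℝ (Fin n)

theorem outwardNormal_eventuallyEq {x : E} {φ : E → ℝ} (hφ : IsDefiningFunction Ω x φ) :
    ∀ᶠ y in 𝓝 x, y ∈ frontier Ω → outwardNormal Ω y = unitGradient φ y := by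
  filter_upwards [hφ.eventually] with y h1 h2 using outwardNormal_eq h1 h2

theorem IsC2Domain.norm_outwardNormal (hΩ : IsC2Domain Ω) {x : E} (hx : x ∈ frontier Ω) :
    ‖outwardNormal Ω x‖ = 1 := by
  obtain ⟨φ, hφ⟩ := hΩ.boundary x hx
  rw [outwardNormal_eq hφ hx, norm_unitGradient hφ.gradient_ne]

theorem IsC2Domain.continuousOn_outwardNormal (hΩ : IsC2Domain Ω) :
    ContinuousOn (outwardNormal Ω) (frontier Ω) := by
  intro x hx
  obtain ⟨φ, hφ⟩ := hΩ.boundary x hx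
  refine hφ.differentiableAt_unitGradient.continuousAt.continuousWithinAt.congr_of_eventuallyEq
    ?_ (outwardNormal_eq hφ hx)
  rw [EventuallyEq, eventually_nhdsWithin_iff]
  exact outwardNormal_eventuallyEq hφ

theorem IsC2Domain.mem_frontier (hΩ : IsC2Domain Ω) {x : E} (hx : x ∈ closure Ω) (hx' : x ∉ Ω) :
    x ∈ frontier Ω := by
  rw [hΩ.isOpen.frontier_eq]; exact ⟨hx, hx'⟩

theorem IsC2Domain.notMem_of_mem_frontier (hΩ : IsC2Domain Ω) {x : E} (hx : x ∈ frontier Ω) :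
    x ∉ Ω := by
  rw [hΩ.isOpen.frontier_eq] at hx; exact hx.2

/-- The outward normal, extended by zero off the boundary. -/
def boundaryNormal (Ω : Set E) : E → E := (frontier Ω).indicator (outwardNormal Ω)

theorem boundaryNormal_of_mem {x : E} (hx : x ∈ frontier Ω) :
    boundaryNormal Ω x = outwardNormal Ω x := indicator_of_mem hx _

theorem IsC2Domain.norm_boundaryNormal_le (hΩ : IsC2Domain Ω) (x : E) :
    ‖boundaryNormal Ω x‖ ≤ 1 := by
  by_cases hx : x ∈ frontier Ω
  · rw [boundaryNormal_of_mem hx, hΩ.norm_outwardNormal hx]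
  · simp [boundaryNormal, hx]

theorem IsC2Domain.measurable_boundaryNormal (hΩ : IsC2Domain Ω) :
    Measurable (boundaryNormal Ω) := by
  classical
  refine measurable_of_restrict_of_restrict_compl (s := frontier Ω)
    isClosed_frontier.measurableSet ?_ ?_
  · rw [boundaryNormal, ← piecewise_eq_indicator, domRestrict_piecewise]
    exact hΩ.continuousOn_outwardNormal.domRestrict.measurable
  · rw [boundaryNormal, ← piecewise_eq_indicator, domRestrict_piecewise_compl]
    exact measurable_const

theorem IsDefiningFunction.gradient_eq_smul {x : E} {φ : E → ℝ} (hφ : IsDefiningFunction Ω x φ) :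
    gradient φ x = ‖gradient φ x‖ • unitGradient φ x := by
  rw [unitGradient, smul_smul, mul_inv_cancel₀ (norm_ne_zero_iff.mpr hφ.gradient_ne), one_smul]

/-- If φ were positive at y, it would stay positive near y, where Ω is {φ < 0}. Then y would have a
neighbourhood missing Ω. -/
theorem IsDefiningFunction.eventually_nonpos {x : E} {φ : E → ℝ} (hφ : IsDefiningFunction Ω x φ) :
    ∀ᶠ y in 𝓝 x, y ∈ closure Ω → φ y ≤ 0 := by
  filter_upwards [hφ.eventually] with y h1 h2
  by_contra h3
  push Not at h3
  have h4 : ∃ᶠ z in 𝓝 y, z ∈ Ω := mem_closure_iff_frequently.mp h2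
  refine h4 ?_
  filter_upwards [h1.mem_iff, h1.contDiffAt.continuousAt.eventually (lt_mem_nhds h3)]
    with z h5 h6 h7
  linarith [h5.mp h7]

/-- A curve in the closure of the domain that touches the boundary has tangential velocity. -/
theorem IsC2Domain.inner_outwardNormal_eq_zero (hΩ : IsC2Domain Ω) {η : ℝ → E} {w : E} {s : ℝ}
    (hd : HasDerivAt η w s) (hη : ∀ᶠ r in 𝓝 s, η r ∈ closure Ω) (hs : η s ∈ frontier Ω) :
    inner ℝ (outwardNormal Ω (η s)) w = 0 := by
  obtain ⟨φ, hφ⟩ := hΩ.boundary _ hs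
  have h1 : HasDerivAt (φ ∘ η) (fderiv ℝ φ (η s) w) s :=
    (hφ.contDiffAt.differentiableAt (by norm_num)).hasFDerivAt.comp_hasDerivAt s hd
  -- Along the curve φ is at most 0, and it equals 0 at the contact time, so its derivative vanishes
  -- there. This uses the curve on both sides of `s`.
  have hmax : IsLocalMax (φ ∘ η) s := by
    filter_upwards [hη, hd.continuousAt.eventually hφ.eventually_nonpos] with r h2 h3
    simp only [Function.comp_apply, hφ.eq_zero hs]
    exact h3 h2
  have h4 := hmax.hasDerivAt_eq_zero h1
  rw [← inner_gradient, hφ.gradient_eq_smul, real_inner_smul_left] at h4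
  rw [outwardNormal_eq hφ hs]
  exact (mul_eq_zero.mp h4).resolve_left (norm_ne_zero_iff.mpr hφ.gradient_ne)

/-- Pair the equation η' + lν = v with the unit vector ν; the term η'·ν drops out by tangency. -/
theorem IsSkorokhod.ae_tangential (hΩ : IsC2Domain Ω) {x : E} {η v : ℝ → E} {l : ℝ → ℝ}
    (h : IsSkorokhod Ω x η v l) :
    ∀ᵐ s, 0 < s → η s ∉ Ω → l s = inner ℝ (v s) (outwardNormal Ω (η s)) := by
  filter_upwards [h.equation] with s h1 hs h2
  have hfr := hΩ.mem_frontier (h.mem_closure s hs.le) h2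
  have h3 := hΩ.inner_outwardNormal_eq_zero (h1 hs) (by
    filter_upwards [lt_mem_nhds hs] with r hr using h.mem_closure r hr.le) hfr
  rw [inner_sub_right, real_inner_smul_right, real_inner_self_eq_norm_sq,
    hΩ.norm_outwardNormal hfr, real_inner_comm] at h3
  linarith

end Boundary

/-! ### Variation of the reflection term: p·ν = g where l > 0 -/

section Variation

variable {n : ℕ} {Ω : Set (EuclideanSpace ℝ (Fin n))}
  {H : EuclideanSpace ℝ (Fin n) → EuclideanSpace ℝ (Fin n) → ℝ}
  {g u₀ : EuclideanSpace ℝ (Fin n) → ℝ} {x : EuclideanSpace ℝ (Fin n)} {t : ℝ}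
  {η v : ℝ → EuclideanSpace ℝ (Fin n)} {l : ℝ → ℝ}

local notation "E" => EuclideanSpace ℝ (Fin n)

/-- A minimizer with measurable controls, continuous on all of `ℝ`, whose reflection term satisfies
the sign and support conditions everywhere. -/
structure IsRegularMinimizer (Ω : Set E) (H : E → E → ℝ) (g u₀ : E → ℝ) (x : E) (t : ℝ)
    (η v : ℝ → E) (l : ℝ → ℝ) : Prop where
  isMinimizer : IsMinimizer Ω H g u₀ x t η v l
  continuous : Continuous η
  measurable_v : Measurable v
  measurable_l : Measurable l
  nonneg : ∀ s, 0 ≤ l s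
  eq_zero : ∀ s, η s ∉ frontier Ω → l s = 0

/-- Localizes minimality: when two integrands agree off `A`, their common part can be cancelled.
Integrability of the competitor then needs checking only on `A`. -/
theorem setIntegral_le_of_eq_off {f G : ℝ → ℝ} {A S : Set ℝ} (hA : MeasurableSet A)
    (hS : MeasurableSet S) (hAS : A ⊆ S) (hf : IntegrableOn f S) (hG : IntegrableOn G A)
    (hoff : ∀ᵐ s, s ∈ S → s ∉ A → G s = f s) :
    IntegrableOn G S ∧ (∫ s in S, f s ≤ ∫ s in S, G s → ∫ s in A, f s ≤ ∫ s in A, G s) := by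
  have hB : MeasurableSet (S \ A) := hS.diff hA
  have hun : A ∪ (S \ A) = S := union_sdiff_cancel hAS
  have e1 : ∀ᵐ s, s ∈ S \ A → G s = f s := by
    filter_upwards [hoff] with s h hs using h hs.1 hs.2
  have i1 : IntegrableOn G (S \ A) := by
    refine (hf.mono_set sdiff_subset).congr_fun_ae ?_
    rw [EventuallyEq, ae_restrict_iff' hB]
    filter_upwards [e1] with s h hs using (h hs).symm
  refine ⟨by rw [← hun]; exact hG.union i1, fun hle => ?_⟩
  rwa [← hun, setIntegral_union disjoint_sdiff_right hB (hf.mono_set hAS)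
    (hf.mono_set sdiff_subset), setIntegral_union disjoint_sdiff_right hB hG i1,
    setIntegral_congr_ae hB e1, add_le_add_iff_right] at hle

/-- Minimality against a competitor whose running cost is changed on a set `A` only. -/
theorem IsMinimizer.setIntegral_le (hm : IsMinimizer Ω H g u₀ x t η v l) (ht : 0 ≤ t) {A : Set ℝ}
    (hA : MeasurableSet A) (hAt : A ⊆ Ioc 0 t) {η' v' : ℝ → E} {l' : ℝ → ℝ}
    (hs : IsSkorokhod Ω x η' v' l') (hend : η' t = η t)
    (hoff : ∀ᵐ s, s ∈ Ioc 0 t → s ∉ A → runningCost H g η' v' l' s = runningCost H g η v l s)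
    {c : ℝ → ℝ} (hc : IntegrableOn c A)
    (hon : ∀ᵐ s, s ∈ A → runningCost H g η' v' l' s = c s) :
    ∫ s in A, runningCost H g η v l s ≤ ∫ s in A, c s := by
  have hold : IntegrableOn (runningCost H g η v l) (Ioc 0 t) := by
    have := hm.integrable
    rwa [intervalIntegrable_iff_integrableOn_Ioc_of_le ht] at this
  have i2 : IntegrableOn (runningCost H g η' v' l') A := by
    refine hc.congr_fun_ae ?_
    rw [EventuallyEq, ae_restrict_iff' hA]
    filter_upwards [hon] with s h hs using (h hs).symm
  obtain ⟨i3, h3⟩ := setIntegral_le_of_eq_off hA measurableSet_Ioc hAt hold i2 hoff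
  have hle := hm.le η' v' l' hs
    (by rwa [intervalIntegrable_iff_integrableOn_Ioc_of_le ht])
  rw [totalCost, totalCost, hend, add_le_add_iff_right, intervalIntegral.integral_of_le ht,
    intervalIntegral.integral_of_le ht] at hle
  exact (h3 hle).trans_eq (setIntegral_congr_ae hA hon)

theorem IsRegularMinimizer.smul_boundaryNormal (hm : IsRegularMinimizer Ω H g u₀ x t η v l)
    (s : ℝ) : l s • outwardNormal Ω (η s) = l s • boundaryNormal Ω (η s) := by
  by_cases h : η s ∈ frontier Ω
  · rw [boundaryNormal_of_mem h]
  · rw [hm.eq_zero s h, zero_smul, zero_smul]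

/-- The reflection term may be changed at boundary times, keeping the trajectory. -/
theorem IsSkorokhod.perturb_reflection (hΩ : IsC2Domain Ω) (h : IsSkorokhod Ω x η v l)
    (hη : Continuous η) {κ : ℝ → ℝ} (hκ : Integrable κ)
    (hpos : ∀ᵐ s, 0 < s → 0 ≤ l s + κ s)
    (hzero : ∀ s, η s ∉ frontier Ω → κ s = 0) :
    IsSkorokhod Ω x η (fun s => v s + κ s • boundaryNormal Ω (η s)) (fun s => l s + κ s) where
  absolutelyContinuous := h.absolutelyContinuous
  locallyIntegrable_v := by
    refine h.locallyIntegrable_v.add ((Integrable.locallyIntegrable ?_).locallyIntegrableOn _)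
    refine hκ.mono (hκ.aestronglyMeasurable.smul
      (hΩ.measurable_boundaryNormal.comp hη.measurable).aestronglyMeasurable)
      (ae_of_all _ fun s => ?_)
    simp only [norm_smul]
    exact mul_le_of_le_one_right (norm_nonneg _) (hΩ.norm_boundaryNormal_le _)
  locallyIntegrable_l := h.locallyIntegrable_l.add (hκ.locallyIntegrable.locallyIntegrableOn _)
  initial := h.initial
  mem_closure := h.mem_closure
  equation := by
    filter_upwards [h.equation] with s h1 hs
    have h2 := h1 hs
    convert h2 using 1
    by_cases hfr : η s ∈ frontier Ω
    · rw [boundaryNormal_of_mem hfr, add_smul]; abel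
    · simp [hzero s hfr]
  nonneg := hpos
  eq_zero := by
    filter_upwards [h.eq_zero] with s h1 hs hsΩ
    have hfr : η s ∉ frontier Ω := fun hfr => hΩ.notMem_of_mem_frontier hfr hsΩ
    rw [h1 hs hsΩ, hzero s hfr, add_zero]

theorem contDiff_runningCost (hH : AssumptionA1 H) (hg : IsBoundedC1 g) {X : Type*}
    [NormedAddCommGroup X] [NormedSpace ℝ X] {y w : X → E} {a : X → ℝ} {z : X}
    (hy : ContDiffAt ℝ 1 y z) (hw : ContDiffAt ℝ 1 w z) (ha : ContDiffAt ℝ 1 a z) :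
    ContDiffAt ℝ 1 (fun z => lagrangian H (y z) (-w z) + g (y z) * a z) z :=
  (hH.contDiff_lagrangian.contDiffAt.comp z (hy.prodMk hw.neg)).add
    ((hg.contDiff.contDiffAt.comp z hy).mul ha)

/-- The chain rule with D_vL = p and D_xL = -D_xH. Each later stationarity condition for the
position or the reflection term is this formula for a particular curve (y, w, a). -/
theorem hasDerivAt_runningCost (hH : AssumptionA1 H) (hg : IsBoundedC1 g) {y w : ℝ → E}
    {a : ℝ → ℝ} {y' w' : E} {a' s : ℝ}
    (hy : HasDerivAt y y' s) (hw : HasDerivAt w w' s) (ha : HasDerivAt a a' s) :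
    HasDerivAt (fun z => lagrangian H (y z) (-w z) + g (y z) * a z)
      (-inner ℝ (dualMomentum H (y s) (-w s)) w'
        - inner ℝ (gradX H (y s) (dualMomentum H (y s) (-w s))) y'
        + (inner ℝ (gradient g (y s)) y' * a s + g (y s) * a')) s := by
  have h1 := (hH.contDiff_lagrangian.differentiable (by norm_num)
    (y s, -w s)).hasFDerivAt.comp_hasDerivAt s (hy.prodMk hw.neg)
  have h2 := (hg.contDiff.differentiable (by norm_num) (y s)).hasFDerivAt.comp_hasDerivAt s hy
  have h3 := h1.add (h2.mul ha)
  rw [hH.fderiv_lagrangian, inner_neg_right, ← inner_gradient] at h3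
  exact h3

/-- Stationarity with respect to the reflection term. -/
theorem IsRegularMinimizer.ae_eq_of_subset (hm : IsRegularMinimizer Ω H g u₀ x t η v l)
    (hΩ : IsC2Domain Ω) (hH : AssumptionA1 H) (hg : IsBoundedC1 g) (ht : 0 ≤ t) {A : Set ℝ}
    (hA : MeasurableSet A) (hAt : A ⊆ Ioc 0 t) {M δ : ℝ} (hδ : 0 < δ)
    (hAM : ∀ s ∈ A, ‖v s‖ ≤ M) (hAl : ∀ s ∈ A, δ ≤ l s) (hAlM : ∀ s ∈ A, l s ≤ M) :
    ∀ᵐ s, s ∈ A → inner ℝ (dualMomentum H (η s) (-v s)) (outwardNormal Ω (η s)) = g (η s) := by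
  have hAv : volume A < ⊤ := (measure_mono hAt).trans_lt measure_Ioc_lt_top
  obtain ⟨R, hR⟩ := (isCompact_Icc (a := (0 : ℝ)) (b := t)).exists_bound_of_continuousOn
    hm.continuous.continuousOn
  have hAfr : ∀ s ∈ A, η s ∈ frontier Ω := fun s hs => by
    by_contra h
    have := hAl s hs
    rw [hm.eq_zero s h] at this
    linarith
  have hνm : Measurable fun s => boundaryNormal Ω (η s) :=
    hΩ.measurable_boundaryNormal.comp hm.continuous.measurable
  -- The defect p·ν - g is itself used as the variation of l, cut off to `A`, so that the first
  -- variation becomes -∫ k².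
  set f : ℝ → ℝ := fun s => inner ℝ (dualMomentum H (η s) (-v s)) (boundaryNormal Ω (η s))
    - g (η s) with hf
  have hfm : Measurable f := by
    have h1 : Measurable fun s => dualMomentum H (η s) (-v s) :=
      hH.continuous_dualMomentum.measurable.comp
        (hm.continuous.measurable.prodMk hm.measurable_v.neg)
    exact (h1.inner hνm).sub (hg.contDiff.continuous.measurable.comp hm.continuous.measurable)
  obtain ⟨B, hB⟩ := (((isCompact_closedBall (0 : E) R).prod
    (isCompact_closedBall (0 : E) M)).prod (isCompact_closedBall (0 : E) 1)
    ).exists_bound_of_continuousOn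
    (f := fun z : (E × E) × E => inner ℝ (dualMomentum H z.1.1 (-z.1.2)) z.2 - g z.1.1) (by
      have h1 : Continuous fun z : (E × E) × E => dualMomentum H z.1.1 (-z.1.2) :=
        hH.continuous_dualMomentum.comp (f := fun z : (E × E) × E => (z.1.1, -z.1.2)) (by fun_prop)
      have h2 := hg.contDiff.continuous
      fun_prop)
  have hfB : ∀ s ∈ A, |f s| ≤ B := fun s hs => by
    refine hB ((η s, v s), boundaryNormal Ω (η s)) ⟨⟨?_, ?_⟩, ?_⟩
    · simpa using hR s ⟨(hAt hs).1.le, (hAt hs).2⟩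
    · simpa using hAM s hs
    · simpa using hΩ.norm_boundaryNormal_le (η s)
  set k : ℝ → ℝ := A.indicator f with hk
  have hkm : Measurable k := hfm.indicator hA
  have hkA : ∀ s ∈ A, k s = f s := fun s hs => indicator_of_mem hs f
  have hkB : ∀ s, |k s| ≤ max B 0 := fun s => by
    by_cases hs : s ∈ A
    · rw [hkA s hs]; exact (hfB s hs).trans (le_max_left _ _)
    · simp [hk, hs]
  have hki : Integrable k := by
    rw [hk, integrable_indicator_iff hA]
    have : IsFiniteMeasure (volume.restrict A) := ⟨by simpa using hAv⟩
    refine Integrable.of_bound hfm.aestronglyMeasurable B ?_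
    rw [ae_restrict_iff' hA]
    exact ae_of_all _ hfB
  -- The varied cost as a C¹ function of ε and the finite-dimensional data `Y s`. The bounds on `A`
  -- keep `Y s` in a compact ball, as `first_variation` requires.
  set Γ : ℝ × (E × E × E × ℝ × ℝ) → ℝ := fun z =>
    lagrangian H z.2.1 (-(z.2.2.1 + (z.1 * z.2.2.2.2.2) • z.2.2.2.1))
      + g z.2.1 * (z.2.2.2.2.1 + z.1 * z.2.2.2.2.2) with hΓ
  set Y : ℝ → E × E × E × ℝ × ℝ := fun s => (η s, v s, boundaryNormal Ω (η s), l s, k s) with hY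
  have hYm : Measurable Y := hm.continuous.measurable.prodMk
    (hm.measurable_v.prodMk (hνm.prodMk (hm.measurable_l.prodMk hkm)))
  set ρ := max (max R M) (max 1 (max B 0)) with hρ
  have hYK : ∀ᵐ s ∂(volume.restrict A), Y s ∈ Metric.closedBall 0 ρ := by
    rw [ae_restrict_iff' hA]
    refine ae_of_all _ fun s hs => ?_
    have b1 := hR s ⟨(hAt hs).1.le, (hAt hs).2⟩
    have b2 := hAM s hs
    have b3 := hΩ.norm_boundaryNormal_le (η s)
    have b4 := hkB s
    have b5 : ‖l s‖ ≤ M := by rw [Real.norm_of_nonneg (hm.nonneg s)]; exact hAlM s hs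
    rw [mem_closedBall_zero_iff]
    simp only [hY, Prod.norm_def, Real.norm_eq_abs] at b5 ⊢
    have c1 : R ≤ ρ := (le_max_left _ _).trans (le_max_left _ _)
    have c2 : M ≤ ρ := (le_max_right _ _).trans (le_max_left _ _)
    have c3 : 1 ≤ ρ := (le_max_left _ _).trans (le_max_right _ _)
    have c4 : max B 0 ≤ ρ := (le_max_right _ _).trans (le_max_right _ _)
    refine max_le (b1.trans c1) (max_le (b2.trans c2) (max_le (b3.trans c3)
      (max_le (b5.trans c2) (b4.trans c4))))
  have hΓc : ContDiff ℝ 1 Γ := by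
    rw [contDiff_iff_contDiffAt]
    intro z
    exact contDiff_runningCost hH hg (y := fun z : ℝ × (E × E × E × ℝ × ℝ) => z.2.1)
      (w := fun z => z.2.2.1 + (z.1 * z.2.2.2.2.2) • z.2.2.2.1)
      (a := fun z => z.2.2.2.2.1 + z.1 * z.2.2.2.2.2) (by fun_prop) (by fun_prop) (by fun_prop)
  have key := first_variation (isCompact_closedBall (0 : E × E × E × ℝ × ℝ) ρ)
    (fun y _ => hΓc.contDiffAt) hYm hAv hYK (D := fun s => -(k s * k s)) (by
      -- Here the lower bound l ≥ δ on `A` is used: both signs of ε are admissible since l + εk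
      -- stays nonnegative.
      have hev : ∀ᶠ ε in 𝓝 (0 : ℝ), |ε| * max B 0 < δ := by
        have hc : Continuous fun ε : ℝ => |ε| * max B 0 := by fun_prop
        exact hc.continuousAt.eventually (gt_mem_nhds (by simpa using hδ))
      filter_upwards [hev] with ε hε
      have hκ : ∀ s, |ε * k s| < δ := fun s => by
        rw [abs_mul]
        exact (mul_le_mul_of_nonneg_left (hkB s) (abs_nonneg ε)).trans_lt hε
      have hsk := hm.isMinimizer.skorokhod.perturb_reflection hΩ hm.continuous
        (hki.const_mul ε) (ae_of_all _ fun s _ => by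
          by_cases hs : s ∈ A
          · have := hAl s hs
            have := (abs_lt.mp (hκ s)).1
            linarith
          · simpa [hk, hs] using hm.nonneg s)
        (fun s hs => by
          have : s ∉ A := fun h => hs (hAfr s h)
          simp [hk, this])
      have h1 := hm.isMinimizer.setIntegral_le ht hA hAt hsk rfl (c := fun s => Γ (ε, Y s))
        (ae_of_all _ fun s _ hs => by simp [runningCost, hk, hs])
        (integrableOn_comp_of_continuousOn (f := fun y => Γ (ε, y))
          (hΓc.continuous.comp (by fun_prop)).continuousOn
          (isCompact_closedBall (0 : E × E × E × ℝ × ℝ) ρ) hYm hAv hYK)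
        (ae_of_all _ fun s _ => rfl)
      refine le_trans (le_of_eq ?_) h1
      refine integral_congr_ae (ae_of_all _ fun s => ?_)
      simp [hΓ, hY, runningCost])
    (by
      rw [ae_restrict_iff' hA]
      refine ae_of_all _ fun s hs => ?_
      have d1 : HasDerivAt (fun ε : ℝ => ε * k s) (k s) 0 := by
        simpa using (hasDerivAt_id (0 : ℝ)).mul_const (k s)
      have d2 := hasDerivAt_runningCost hH hg (hasDerivAt_const (0 : ℝ) (η s))
        ((d1.smul_const (boundaryNormal Ω (η s))).const_add (v s)) (d1.const_add (l s))
      convert d2 using 1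
      simp only [zero_mul, zero_smul, add_zero, inner_zero_right, real_inner_smul_right, hkA s hs,
        hf]
      ring)
  rw [integral_neg, neg_eq_zero] at key
  have hzero := (setIntegral_eq_zero_iff_of_nonneg_ae (μ := volume) (s := A)
    (f := fun s => k s * k s) (ae_of_all _ fun s => mul_self_nonneg (k s)) (by
      have : IsFiniteMeasure (volume.restrict A) := ⟨by simpa using hAv⟩
      refine Integrable.of_bound (hkm.mul hkm).aestronglyMeasurable (max B 0 * max B 0)
        (ae_of_all _ fun s => ?_)
      rw [norm_mul]
      exact mul_le_mul (hkB s) (hkB s) (abs_nonneg _) (le_max_right _ _))).mp key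
  rw [EventuallyEq, ae_restrict_iff' hA] at hzero
  filter_upwards [hzero] with s h1 hs
  have h2 : k s = 0 := mul_self_eq_zero.mp (h1 hs)
  rw [hkA s hs, hf] at h2
  simp only [boundaryNormal_of_mem (hAfr s hs)] at h2
  linarith

/-- The set {l > 0} is a countable union of sets on which v and l are bounded and l is bounded
below; the condition holds a.e. on each of them. -/
theorem IsRegularMinimizer.ae_inner_momentum_eq (hm : IsRegularMinimizer Ω H g u₀ x t η v l)
    (hΩ : IsC2Domain Ω) (hH : AssumptionA1 H) (hg : IsBoundedC1 g) (ht : 0 ≤ t) :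
    ∀ᵐ s, s ∈ Ioc 0 t → 0 < l s →
      inner ℝ (dualMomentum H (η s) (-v s)) (outwardNormal Ω (η s)) = g (η s) := by
  have h1 : ∀ N : ℕ, ∀ᵐ s, s ∈ {s | s ∈ Ioc 0 t ∧ ‖v s‖ ≤ N ∧ 1 / ((N : ℝ) + 1) ≤ l s ∧ l s ≤ N} →
      inner ℝ (dualMomentum H (η s) (-v s)) (outwardNormal Ω (η s)) = g (η s) := by
    intro N
    refine hm.ae_eq_of_subset hΩ hH hg ht ?_ (fun s hs => hs.1) (M := N)
      (δ := 1 / ((N : ℝ) + 1)) (by positivity) (fun s hs => hs.2.1) (fun s hs => hs.2.2.1)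
      (fun s hs => hs.2.2.2)
    exact measurableSet_Ioc.inter ((measurableSet_le hm.measurable_v.norm measurable_const).inter
      ((measurableSet_le measurable_const hm.measurable_l).inter
        (measurableSet_le hm.measurable_l measurable_const)))
  filter_upwards [ae_all_iff.mpr h1] with s h2 hs hl
  obtain ⟨N1, hN1⟩ := exists_nat_ge ‖v s‖
  obtain ⟨N2, hN2⟩ := exists_nat_ge (l s)
  obtain ⟨N3, hN3⟩ := exists_nat_one_div_lt hl
  refine h2 (max (max N1 N2) N3) ⟨hs, ?_, ?_, ?_⟩
  · exact hN1.trans (by exact_mod_cast (le_max_left N1 N2).trans (le_max_left _ _))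
  · refine le_trans ?_ hN3.le
    gcongr
    exact_mod_cast le_max_right _ _
  · exact hN2.trans (by exact_mod_cast (le_max_right N1 N2).trans (le_max_left _ _))

end Variation

/-! ### Bi-Lipschitz time changes and the Skorokhod problem -/

section TimeChange

open scoped NNReal

/-- `e` is the bi-Lipschitz time change with density `θ`. -/
structure IsTimeChange (θ : ℝ → ℝ) (e : ℝ ≃o ℝ) : Prop where
  measurable : Measurable θ
  lower : ∀ s, 1 / 2 ≤ θ s
  upper : ∀ s, θ s ≤ 2
  eq : ∀ s, e s = ∫ r in (0 : ℝ)..s, θ r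

variable {θ : ℝ → ℝ} {e : ℝ ≃o ℝ}

theorem locallyIntegrable_of_bounds (hm : Measurable θ) (h1 : ∀ s, 1 / 2 ≤ θ s)
    (h2 : ∀ s, θ s ≤ 2) : LocallyIntegrable θ := by
  refine (locallyIntegrable_const (2 : ℝ)).mono hm.aestronglyMeasurable (ae_of_all _ fun s => ?_)
  rw [Real.norm_of_nonneg (by linarith [h1 s])]
  simpa using h2 s

/-- The primitive of θ is continuous and has slope at least 1/2. It is therefore strictly increasing
and tends to ±∞ at ±∞, which makes it an order isomorphism of the line. -/
theorem exists_timeChange (hm : Measurable θ) (h1 : ∀ s, 1 / 2 ≤ θ s)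
    (h2 : ∀ s, θ s ≤ 2) : ∃ e : ℝ ≃o ℝ, IsTimeChange θ e := by
  have hi : ∀ a b, IntervalIntegrable θ volume a b := fun a b =>
    ((locallyIntegrable_of_bounds hm h1 h2).locallyIntegrableOn univ).integrableOn_compact_subset
      (subset_univ _) isCompact_uIcc |>.intervalIntegrable
  set τ : ℝ → ℝ := fun s => ∫ r in (0 : ℝ)..s, θ r with hτ
  have hlow : ∀ a b, a ≤ b → (b - a) / 2 ≤ τ b - τ a := fun a b hab => by
    rw [hτ, intervalIntegral.integral_interval_sub_left (hi 0 b) (hi 0 a)]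
    have := intervalIntegral.integral_mono_on hab intervalIntegrable_const (hi a b)
      (fun s _ => h1 s)
    rw [intervalIntegral.integral_const, smul_eq_mul] at this
    linarith
  have hmono : StrictMono τ := fun a b hab => by linarith [hlow a b hab.le]
  have hcont : Continuous τ := intervalIntegral.continuous_primitive hi 0
  have h0 : τ 0 = 0 := by simp [hτ]
  have hsurj : Function.Surjective τ := by
    refine hcont.surjective ?_ ?_
    · refine tendsto_atTop_mono' atTop ?_ (tendsto_id.atTop_div_const (r := 2) (by norm_num))
      filter_upwards [eventually_ge_atTop 0] with s hs
      have := hlow 0 s hs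
      simp only [id]; linarith
    · refine tendsto_atBot_mono' atBot ?_ (tendsto_id.atBot_div_const (r := 2) (by norm_num))
      filter_upwards [eventually_le_atBot 0] with s hs
      have := hlow s 0 hs
      simp only [id]; linarith
  exact ⟨hmono.orderIsoOfSurjective τ hsurj, hm, h1, h2, fun s => rfl⟩

namespace IsTimeChange

theorem locallyIntegrable (h : IsTimeChange θ e) : LocallyIntegrable θ :=
  locallyIntegrable_of_bounds h.measurable h.lower h.upper

theorem intervalIntegrable (h : IsTimeChange θ e) (a b : ℝ) : IntervalIntegrable θ volume a b :=
  ((h.locallyIntegrable.locallyIntegrableOn univ).integrableOn_compact_subset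
      (subset_univ _) isCompact_uIcc).intervalIntegrable

theorem map_zero (h : IsTimeChange θ e) : e 0 = 0 := by simp [h.eq]

theorem symm_zero (h : IsTimeChange θ e) : e.symm 0 = 0 := by
  rw [OrderIso.symm_apply_eq, h.map_zero]

theorem sub_eq (h : IsTimeChange θ e) (a b : ℝ) : e b - e a = ∫ r in a..b, θ r := by
  rw [h.eq, h.eq, intervalIntegral.integral_interval_sub_left] <;>
    exact h.intervalIntegrable _ _

theorem pos (h : IsTimeChange θ e) (s : ℝ) : 0 < θ s := by linarith [h.lower s]

theorem dist_symm_le (h : IsTimeChange θ e) (a b : ℝ) :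
    dist (e.symm a) (e.symm b) ≤ 2 * dist a b := by
  wlog hab : a ≤ b generalizing a b
  · rw [dist_comm, dist_comm a b]; exact this b a (by linarith)
  have hle : e.symm a ≤ e.symm b := e.symm.monotone hab
  have h1 := intervalIntegral.integral_mono_on hle intervalIntegrable_const
    (h.intervalIntegrable _ _) (fun s _ => h.lower s)
  rw [intervalIntegral.integral_const, smul_eq_mul, ← h.sub_eq, e.apply_symm_apply,
    e.apply_symm_apply] at h1
  rw [dist_comm, dist_comm a b, Real.dist_eq, Real.dist_eq, abs_of_nonneg (by linarith),
    abs_of_nonneg (by linarith)]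
  linarith

/-- The change of variables formula for a density that is only measurable. It suffices to test on
intervals with rational endpoints, where the mass of the preimage is ∫ θ = b - a. -/
theorem measurePreserving_symm (h : IsTimeChange θ e) :
    MeasurePreserving e.symm volume (volume.withDensity fun s => ENNReal.ofReal (θ s)) := by
  have key : MeasurePreserving e.toHomeomorph.toMeasurableEquiv
      (volume.withDensity fun s => ENNReal.ofReal (θ s)) volume := by
    refine ⟨e.toHomeomorph.toMeasurableEquiv.measurable, ?_⟩
    refine (Real.measure_ext_Ioo_rat fun a b => ?_).symm
    rw [MeasurableEquiv.map_apply]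
    have : (e.toHomeomorph.toMeasurableEquiv : ℝ → ℝ) ⁻¹' Ioo (a : ℝ) b
        = Ioo (e.symm a) (e.symm b) := e.preimage_Ioo _ _
    rw [this, withDensity_apply _ measurableSet_Ioo, Real.volume_Ioo]
    rcases le_or_gt (b : ℝ) a with hab | hab
    · rw [Ioo_eq_empty (not_lt.mpr (e.symm.monotone hab))]
      simp [hab]
    · have hle : e.symm a ≤ e.symm b := e.symm.monotone hab.le
      have hi : IntegrableOn θ (Ioc (e.symm a) (e.symm b)) := by
        rw [← intervalIntegrable_iff_integrableOn_Ioc_of_le hle]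
        exact h.intervalIntegrable _ _
      rw [restrict_Ioo_eq_restrict_Ioc, ← ofReal_integral_eq_lintegral_ofReal hi
        (ae_of_all _ fun s => (h.pos s).le), ← intervalIntegral.integral_of_le hle, ← h.sub_eq,
        e.apply_symm_apply, e.apply_symm_apply]
  exact key.symm

theorem ae_symm (h : IsTimeChange θ e) {P : ℝ → Prop} (hP : ∀ᵐ s, P s) : ∀ᵐ r, P (e.symm r) :=
  h.measurePreserving_symm.quasiMeasurePreserving.ae
    ((withDensity_absolutelyContinuous _ _).ae_le hP)

theorem measurable_ofReal (h : IsTimeChange θ e) : Measurable fun s => ENNReal.ofReal (θ s) :=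
  ENNReal.measurable_ofReal.comp h.measurable

theorem measurableEmbedding_symm : MeasurableEmbedding e.symm :=
  e.symm.toHomeomorph.measurableEmbedding

theorem integrableOn_comp_symm {F : Type*} [NormedAddCommGroup F] [NormedSpace ℝ F]
    (h : IsTimeChange θ e) {f : ℝ → F} {S : Set ℝ} (hS : MeasurableSet S) :
    IntegrableOn (fun r => f (e.symm r)) (e.symm ⁻¹' S) ↔ IntegrableOn (fun s => θ s • f s) S := by
  have h1 := h.measurePreserving_symm.integrableOn_comp_preimage measurableEmbedding_symm
    (f := f) (s := S)
  refine h1.trans ?_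
  rw [IntegrableOn, restrict_withDensity hS,
    integrable_withDensity_iff_integrable_smul' h.measurable_ofReal (by simp)]
  simp_rw [ENNReal.toReal_ofReal (h.pos _).le]
  rfl

theorem setIntegral_comp_symm {F : Type*} [NormedAddCommGroup F] [NormedSpace ℝ F]
    (h : IsTimeChange θ e) (f : ℝ → F) {S : Set ℝ} (hS : MeasurableSet S) :
    ∫ r in e.symm ⁻¹' S, f (e.symm r) = ∫ s in S, θ s • f s := by
  rw [h.measurePreserving_symm.setIntegral_preimage_emb measurableEmbedding_symm,
    setIntegral_withDensity_eq_setIntegral_toReal_smul h.measurable_ofReal (by simp) _ hS]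
  simp_rw [ENNReal.toReal_ofReal (h.pos _).le]

/-- The factor θ⁻¹ cancels the density of the change of variables, and the time change maps compact
sets to compact sets. -/
theorem locallyIntegrableOn_comp_symm {F : Type*} [NormedAddCommGroup F] [NormedSpace ℝ F]
    (h : IsTimeChange θ e) {f : ℝ → F} (hf : LocallyIntegrableOn f (Ici 0)) :
    LocallyIntegrableOn (fun r => (θ (e.symm r))⁻¹ • f (e.symm r)) (Ici 0) := by
  rw [locallyIntegrableOn_iff isClosed_Ici.isLocallyClosed] at hf ⊢
  intro k hk hkc
  have himg : IsCompact (e.symm '' k) := hkc.image e.symm.continuous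
  have hpre : k = e.symm ⁻¹' (e.symm '' k) := (preimage_image_eq k e.symm.injective).symm
  rw [hpre, h.integrableOn_comp_symm (f := fun s => (θ s)⁻¹ • f s) himg.measurableSet]
  simp_rw [smul_smul, mul_inv_cancel₀ (h.pos _).ne', one_smul]
  refine hf _ ?_ himg
  rintro _ ⟨r, hr, rfl⟩
  have : e.symm 0 ≤ e.symm r := e.symm.monotone (hk hr)
  rwa [h.symm_zero] at this

/-- Lebesgue differentiation gives e' = θ a.e. Null sets are preserved by the time change, so the
derivative of the inverse follows at almost every image time. -/
theorem ae_hasDerivAt_symm (h : IsTimeChange θ e) :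
    ∀ᵐ r, HasDerivAt e.symm (θ (e.symm r))⁻¹ r := by
  filter_upwards [h.ae_symm (LocallyIntegrable.ae_hasDerivAt_integral h.locallyIntegrable)] with r hr
  have h1 : HasDerivAt e (θ (e.symm r)) (e.symm r) := by
    have h2 := hr 0
    have h3 : (e : ℝ → ℝ) = fun s => ∫ r in (0 : ℝ)..s, θ r := funext h.eq
    rw [h3]
    exact h2
  exact h1.of_local_left_inverse e.symm.continuous.continuousAt (h.pos _).ne'
    (Eventually.of_forall e.apply_symm_apply)

/-- The inverse time change is monotone and 2-Lipschitz: disjoint intervals go to disjoint intervals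
and the total length at most doubles, whence the choice δ/2. -/
theorem absolutelyContinuousOnInterval_comp_symm {F : Type*} [PseudoMetricSpace F]
    (h : IsTimeChange θ e) {f : ℝ → F} {a b : ℝ}
    (hf : AbsolutelyContinuousOnInterval f (e.symm a) (e.symm b)) :
    AbsolutelyContinuousOnInterval (fun r => f (e.symm r)) a b := by
  rw [absolutelyContinuousOnInterval_iff] at hf ⊢
  intro ε hε
  obtain ⟨δ, hδ, hd⟩ := hf ε hε
  refine ⟨δ / 2, by positivity, fun E hE hlen => ?_⟩
  have hioc : ∀ c d : ℝ, uIoc (e.symm c) (e.symm d) = e ⁻¹' uIoc c d := fun c d => by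
    rw [uIoc, uIoc, e.preimage_Ioc, e.symm.map_inf, e.symm.map_sup]
  refine hd (E.1, fun i => (e.symm (E.2 i).1, e.symm (E.2 i).2)) ⟨fun i hi => ?_, ?_⟩ ?_
  · have hmem : ∀ c ∈ uIcc a b, e.symm c ∈ uIcc (e.symm a) (e.symm b) := fun c hc => by
      rw [uIcc, mem_Icc, ← e.symm.map_inf, ← e.symm.map_sup]
      exact ⟨e.symm.monotone hc.1, e.symm.monotone hc.2⟩
    exact ⟨hmem _ (hE.1 i hi).1, hmem _ (hE.1 i hi).2⟩
  · intro i hi j hj hij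
    simp only [Function.onFun, hioc]
    exact (hE.2 hi hj hij).preimage e
  · refine (Finset.sum_le_sum fun i _ => h.dist_symm_le (E.2 i).1 (E.2 i).2).trans_lt ?_
    rw [← Finset.mul_sum]
    linarith

end IsTimeChange

variable {n : ℕ} {Ω : Set (EuclideanSpace ℝ (Fin n))} {x : EuclideanSpace ℝ (Fin n)}
  {η v : ℝ → EuclideanSpace ℝ (Fin n)} {l : ℝ → ℝ}

/-- Solutions of the Skorokhod problem are stable under time changes. -/
theorem IsSkorokhod.comp_timeChange (hs : IsSkorokhod Ω x η v l) (h : IsTimeChange θ e) :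
    IsSkorokhod Ω x (fun r => η (e.symm r)) (fun r => (θ (e.symm r))⁻¹ • v (e.symm r))
      (fun r => (θ (e.symm r))⁻¹ • l (e.symm r)) where
  absolutelyContinuous T hT := by
    refine h.absolutelyContinuousOnInterval_comp_symm ?_
    rw [h.symm_zero]
    refine hs.absolutelyContinuous _ ?_
    rw [← h.symm_zero]; exact e.symm.strictMono hT
  locallyIntegrable_v := h.locallyIntegrableOn_comp_symm hs.locallyIntegrable_v
  locallyIntegrable_l := h.locallyIntegrableOn_comp_symm hs.locallyIntegrable_l
  initial := by rw [h.symm_zero, hs.initial]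
  mem_closure s h0 := by
    refine hs.mem_closure _ ?_
    rw [← h.symm_zero]; exact e.symm.monotone h0
  equation := by
    filter_upwards [h.ae_symm hs.equation, h.ae_hasDerivAt_symm] with r h1 h2 hr
    have h3 : 0 < e.symm r := by rw [← h.symm_zero]; exact e.symm.strictMono hr
    -- The equation is homogeneous in (η', v, l), so all three are divided by θ.
    have h4 := (h1 h3).scomp r h2
    rw [smul_sub, smul_smul] at h4
    exact h4
  nonneg := by
    filter_upwards [h.ae_symm hs.nonneg] with r h1 hr
    have h3 : 0 < e.symm r := by rw [← h.symm_zero]; exact e.symm.strictMono hr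
    exact smul_nonneg (inv_nonneg.mpr (h.pos _).le) (h1 h3)
  eq_zero := by
    filter_upwards [h.ae_symm hs.eq_zero] with r h1 hr hΩ
    have h3 : 0 < e.symm r := by rw [← h.symm_zero]; exact e.symm.strictMono hr
    rw [h1 h3 hΩ, smul_zero]

end TimeChange

/-! ### Conservation of energy and bounds on the controls -/

section Energy

variable {n : ℕ} {Ω : Set (EuclideanSpace ℝ (Fin n))}
  {H : EuclideanSpace ℝ (Fin n) → EuclideanSpace ℝ (Fin n) → ℝ}
  {g u₀ : EuclideanSpace ℝ (Fin n) → ℝ} {x : EuclideanSpace ℝ (Fin n)} {t : ℝ}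
  {η v : ℝ → EuclideanSpace ℝ (Fin n)} {l : ℝ → ℝ}

local notation "E" => EuclideanSpace ℝ (Fin n)

/-- Minimality against time changes that differ from the identity on a set `A` only. -/
theorem IsMinimizer.setIntegral_le_timeChange (hm : IsMinimizer Ω H g u₀ x t η v l)
    (ht : 0 ≤ t) {A : Set ℝ} (hA : MeasurableSet A) (hAt : A ⊆ Ioc 0 t) {θ : ℝ → ℝ} {e : ℝ ≃o ℝ}
    (h : IsTimeChange θ e) (het : e t = t) (hθ : ∀ s ∉ A, θ s = 1)
    (hG : IntegrableOn
      (fun s => θ s * lagrangian H (η s) (-((θ s)⁻¹ • v s)) + g (η s) * l s) A) :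
    ∫ s in A, runningCost H g η v l s
      ≤ ∫ s in A, (θ s * lagrangian H (η s) (-((θ s)⁻¹ • v s)) + g (η s) * l s) := by
  have hold : IntegrableOn (runningCost H g η v l) (Ioc 0 t) := by
    have := hm.integrable
    rwa [intervalIntegrable_iff_integrableOn_Ioc_of_le ht] at this
  obtain ⟨i1, h1⟩ := setIntegral_le_of_eq_off hA measurableSet_Ioc hAt hold hG
    (ae_of_all _ fun s _ hs => by simp [hθ s hs, runningCost])
  apply h1
  set F : ℝ → ℝ := runningCost H g η (fun s => (θ s)⁻¹ • v s) (fun s => (θ s)⁻¹ • l s) with hF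
  -- After the change of variables the factor θ cancels in the reflection cost g l. Only the
  -- Lagrangian term feels the reparametrization.
  have hFG : ∀ s, θ s • F s
      = θ s * lagrangian H (η s) (-((θ s)⁻¹ • v s)) + g (η s) * l s := fun s => by
    have := (h.pos s).ne'
    simp only [hF, runningCost, smul_eq_mul]
    field_simp
  have hpre : e.symm ⁻¹' Ioc 0 t = Ioc 0 t := by
    rw [e.symm.preimage_Ioc, OrderIso.symm_symm, h.map_zero, het]
  have i2 : IntegrableOn (fun r => F (e.symm r)) (Ioc 0 t) := by
    rw [← hpre, h.integrableOn_comp_symm measurableSet_Ioc]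
    simp_rw [hFG]
    exact i1
  have e2 : ∫ r in Ioc 0 t, F (e.symm r)
      = ∫ s in Ioc 0 t, (θ s * lagrangian H (η s) (-((θ s)⁻¹ • v s)) + g (η s) * l s) := by
    conv_lhs => rw [← hpre]
    rw [h.setIntegral_comp_symm F measurableSet_Ioc]
    simp_rw [hFG]
  have hst : e.symm t = t := by rw [OrderIso.symm_apply_eq, het]
  have hle := hm.le _ _ _ (hm.skorokhod.comp_timeChange h)
    (by rw [intervalIntegrable_iff_integrableOn_Ioc_of_le ht]; exact i2)
  rw [totalCost, totalCost, hst, add_le_add_iff_right, intervalIntegral.integral_of_le ht,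
    intervalIntegral.integral_of_le ht] at hle
  exact hle.trans_eq e2

theorem IsRegularMinimizer.measurable_momentum (hm : IsRegularMinimizer Ω H g u₀ x t η v l)
    (hH : AssumptionA1 H) : Measurable fun s => dualMomentum H (η s) (-v s) :=
  hH.continuous_dualMomentum.measurable.comp
    (hm.continuous.measurable.prodMk hm.measurable_v.neg)

/-- Conservation of energy, on a set where the controls are bounded. -/
theorem IsRegularMinimizer.exists_energy_of_subset (hm : IsRegularMinimizer Ω H g u₀ x t η v l)
    (hH : AssumptionA1 H) (hg : IsBoundedC1 g) (ht : 0 ≤ t) {A : Set ℝ}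
    (hA : MeasurableSet A) (hAt : A ⊆ Ioc 0 t) {M : ℝ}
    (hAM : ∀ s ∈ A, ‖v s‖ ≤ M) (hAl : ∀ s ∈ A, l s ≤ M) :
    ∃ c, ∀ᵐ s, s ∈ A → H (η s) (dualMomentum H (η s) (-v s)) = c := by
  have hAv : volume A < ⊤ := (measure_mono hAt).trans_lt measure_Ioc_lt_top
  have hfin : IsFiniteMeasure (volume.restrict A) := ⟨by simpa using hAv⟩
  obtain ⟨R, hR⟩ := (isCompact_Icc (a := (0 : ℝ)) (b := t)).exists_bound_of_continuousOn
    hm.continuous.continuousOn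
  set u : ℝ → ℝ := fun s => H (η s) (dualMomentum H (η s) (-v s)) with hu
  have hum : Measurable u := hH.contDiff.continuous.measurable.comp
    (hm.continuous.measurable.prodMk (hm.measurable_momentum hH))
  obtain ⟨B, hB⟩ := ((isCompact_closedBall (0 : E) R).prod
    (isCompact_closedBall (0 : E) M)).exists_bound_of_continuousOn
    (f := fun z : E × E => H z.1 (dualMomentum H z.1 (-z.2))) (by
      have h1 : Continuous fun z : E × E => dualMomentum H z.1 (-z.2) :=
        hH.continuous_dualMomentum.comp (f := fun z : E × E => (z.1, -z.2)) (by fun_prop)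
      exact (hH.contDiff.continuous.comp (continuous_fst.prodMk h1)).continuousOn)
  have huB : ∀ s ∈ A, |u s| ≤ B := fun s hs => by
    refine hB (η s, v s) ⟨?_, ?_⟩
    · simpa using hR s ⟨(hAt hs).1.le, (hAt hs).2⟩
    · simpa using hAM s hs
  have hui : IntegrableOn u A := by
    refine Integrable.of_bound hum.aestronglyMeasurable B ?_
    rw [ae_restrict_iff' hA]
    exact ae_of_all _ huB
  -- The mean of the energy over `A`. The variation of the time density is k = u - c on `A`, whose
  -- zero mean makes the time change fix `t`.
  set c : ℝ := (volume.real A)⁻¹ * ∫ s in A, u s with hc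
  refine ⟨c, ?_⟩
  have hmean : ∫ s in A, (u s - c) = 0 := by
    rw [integral_sub hui (integrable_const c), setIntegral_const, smul_eq_mul, hc]
    by_cases h0 : volume.real A = 0
    · have h1 : volume A = 0 := by
        rwa [measureReal_def, ENNReal.toReal_eq_zero_iff, or_iff_left hAv.ne] at h0
      rw [Measure.restrict_eq_zero.mpr h1]
      simp [h0]
    · rw [mul_inv_cancel_left₀ h0, sub_self]
  set k : ℝ → ℝ := A.indicator (fun s => u s - c) with hk
  have hkm : Measurable k := (hum.sub_const c).indicator hA
  have hkA : ∀ s ∈ A, k s = u s - c := fun s hs => indicator_of_mem hs _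
  set B' : ℝ := |B| + |c| with hB'
  have hkB : ∀ s, |k s| ≤ B' := fun s => by
    by_cases hs : s ∈ A
    · rw [hkA s hs]
      exact (abs_sub _ _).trans (add_le_add ((huB s hs).trans (le_abs_self B)) le_rfl)
    · simp only [hk, hs, not_false_eq_true, indicator_of_notMem, abs_zero]
      positivity
  have hkt : ∫ s in (0 : ℝ)..t, k s = 0 := by
    rw [intervalIntegral.integral_of_le ht, hk, setIntegral_indicator hA,
      inter_eq_self_of_subset_right hAt, hmean]
  have hkint : IntegrableOn k A := Integrable.of_bound hkm.aestronglyMeasurable B'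
    (ae_of_all _ hkB)
  set Γ : ℝ × (E × E × ℝ × ℝ) → ℝ := fun z =>
    (1 + z.1 * z.2.2.2.2) * lagrangian H z.2.1 (-((1 + z.1 * z.2.2.2.2)⁻¹ • z.2.2.1))
      + g z.2.1 * z.2.2.2.1 with hΓ
  set Y : ℝ → E × E × ℝ × ℝ := fun s => (η s, v s, l s, k s) with hY
  have hYm : Measurable Y := hm.continuous.measurable.prodMk
    (hm.measurable_v.prodMk (hm.measurable_l.prodMk hkm))
  set ρ := max (max R M) B' with hρ
  have hYK : ∀ᵐ s ∂(volume.restrict A), Y s ∈ Metric.closedBall 0 ρ := by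
    rw [ae_restrict_iff' hA]
    refine ae_of_all _ fun s hs => ?_
    have b1 := hR s ⟨(hAt hs).1.le, (hAt hs).2⟩
    have b5 : ‖l s‖ ≤ M := by rw [Real.norm_of_nonneg (hm.nonneg s)]; exact hAl s hs
    have c1 : R ≤ ρ := (le_max_left _ _).trans (le_max_left _ _)
    have c2 : M ≤ ρ := (le_max_right _ _).trans (le_max_left _ _)
    rw [mem_closedBall_zero_iff]
    simp only [hY, Prod.norm_def]
    exact max_le (b1.trans c1) (max_le ((hAM s hs).trans c2) (max_le (b5.trans c2)
      ((hkB s).trans (le_max_right _ _))))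
  have hΓc : ∀ z : ℝ × (E × E × ℝ × ℝ), 1 + z.1 * z.2.2.2.2 ≠ 0 → ContDiffAt ℝ 1 Γ z := by
    intro z hz
    have h1 : ContDiffAt ℝ 1 (fun z : ℝ × (E × E × ℝ × ℝ) => 1 + z.1 * z.2.2.2.2) z := by
      fun_prop
    have h2 := hH.contDiff_lagrangian.contDiffAt.comp z
      (f := fun z : ℝ × (E × E × ℝ × ℝ) => (z.2.1, -((1 + z.1 * z.2.2.2.2)⁻¹ • z.2.2.1)))
      (ContDiffAt.prodMk (by fun_prop) (((h1.inv hz).smul (by fun_prop)).neg))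
    exact (h1.mul h2).add ((hg.contDiff.contDiffAt.comp z
      (f := fun z : ℝ × (E × E × ℝ × ℝ) => z.2.1) (by fun_prop)).mul (by fun_prop))
  -- At θ = 1 the derivative of θ L(η, -v/θ) in θ is L(η, -v) + p·v, which is -H(η, p). Hence the
  -- integrand -k u.
  have key := first_variation (isCompact_closedBall (0 : E × E × ℝ × ℝ) ρ)
    (fun y _ => hΓc (0, y) (by simp)) hYm hAv hYK (D := fun s => -(k s * u s)) (by
      -- The first bound places the density 1 + εk in [1/2, 2]. The second keeps it away from zero
      -- on the whole compact ball, so that `Γ` is continuous there.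
      have hev : ∀ᶠ ε in 𝓝 (0 : ℝ), |ε| * B' < 1 / 2 ∧ |ε| * ρ < 1 / 2 := by
        have hc1 : Continuous fun ε : ℝ => |ε| * B' := by fun_prop
        have hc2 : Continuous fun ε : ℝ => |ε| * ρ := by fun_prop
        exact (hc1.continuousAt.eventually (gt_mem_nhds (by simp))).and
          (hc2.continuousAt.eventually (gt_mem_nhds (by simp)))
      filter_upwards [hev] with ε hε
      have hκ : ∀ s, |ε * k s| < 1 / 2 := fun s => by
        rw [abs_mul]
        exact (mul_le_mul_of_nonneg_left (hkB s) (abs_nonneg ε)).trans_lt hε.1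
      set θ : ℝ → ℝ := fun s => 1 + ε * k s with hθ
      obtain ⟨e, he⟩ := exists_timeChange (θ := θ) ((hkm.const_mul ε).const_add 1)
        (fun s => by have := (abs_lt.mp (hκ s)).1; simp only [hθ]; linarith)
        (fun s => by have := (abs_lt.mp (hκ s)).2; simp only [hθ]; linarith)
      have het : e t = t := by
        rw [he.eq, hθ, intervalIntegral.integral_add intervalIntegrable_const,
          intervalIntegral.integral_const_mul, hkt]
        · simp
        · rw [intervalIntegrable_iff_integrableOn_Ioc_of_le ht]
          exact (Integrable.of_bound hkm.aestronglyMeasurable B' (ae_of_all _ hkB)).const_mul ε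
      have h1 := hm.isMinimizer.setIntegral_le_timeChange ht hA hAt he het
        (fun s hs => by simp [hθ, hk, hs])
        (integrableOn_comp_of_continuousOn (f := fun y => Γ (ε, y)) (fun y hy => by
          refine ((hΓc (ε, y) ?_).continuousAt.comp (f := fun y => (ε, y))
            (by fun_prop)).continuousWithinAt
          have hy1 : |y.2.2.2| ≤ ρ := by
            rw [mem_closedBall_zero_iff] at hy
            exact ((norm_snd_le y.2.2).trans (norm_snd_le y.2)).trans ((norm_snd_le y).trans hy)
          have h2 : |ε * y.2.2.2| < 1 / 2 := by
            rw [abs_mul]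
            exact (mul_le_mul_of_nonneg_left hy1 (abs_nonneg ε)).trans_lt hε.2
          have := (abs_lt.mp h2).1
          simp only
          linarith)
          (isCompact_closedBall (0 : E × E × ℝ × ℝ) ρ) hYm hAv hYK)
      refine le_trans (le_of_eq ?_) h1
      refine integral_congr_ae (ae_of_all _ fun s => ?_)
      simp [hΓ, hY, runningCost])
    (by
      rw [ae_restrict_iff' hA]
      refine ae_of_all _ fun s hs => ?_
      have d1 : HasDerivAt (fun ε : ℝ => 1 + ε * k s) (k s) 0 := by
        simpa using ((hasDerivAt_id (0 : ℝ)).mul_const (k s)).const_add 1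
      have d2 : HasDerivAt (fun ε : ℝ => -((1 + ε * k s)⁻¹ • v s)) (k s • v s) 0 := by
        refine (((d1.fun_inv (by simp)).smul_const (v s)).fun_neg).congr_deriv ?_
        simp
      have d3 := (hH.contDiff_lagrangian.differentiable (by norm_num)
        (η s, -((1 + (0 : ℝ) * k s)⁻¹ • v s))).hasFDerivAt.comp_hasDerivAt (0 : ℝ)
          ((hasDerivAt_const (0 : ℝ) (η s)).prodMk d2)
      have d4 := (d1.mul d3).add_const (g (η s) * l s)
      refine d4.congr_deriv ?_
      rw [hH.fderiv_lagrangian]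
      simp only [zero_mul, add_zero, inv_one, one_smul, inner_zero_right, sub_zero, one_mul,
        Function.comp_apply, real_inner_smul_right, hH.lagrangian_eq, hu, inner_neg_left]
      rw [real_inner_comm (v s)]
      ring)
  -- Since `k` has mean zero, ∫ k u = 0 may be rewritten as ∫ k (u - c) = ∫ k² = 0.
  have hkk : ∫ s in A, k s * k s = 0 := by
    have h1 : ∫ s in A, k s * u s = 0 := by rw [← neg_eq_zero, ← integral_neg]; exact key
    have h2 : ∫ s in A, k s * c = 0 := by
      rw [integral_mul_const, setIntegral_congr_fun hA hkA, hmean, zero_mul]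
    have i1 : IntegrableOn (fun s => k s * u s) A :=
      hui.bdd_mul hkm.aestronglyMeasurable (ae_of_all _ hkB)
    have h3 := integral_sub i1 (hkint.mul_const c)
    rw [h1, h2, sub_zero] at h3
    rw [← h3]
    exact setIntegral_congr_fun hA fun s hs => by simp only [hkA s hs]; ring
  have hzero := (setIntegral_eq_zero_iff_of_nonneg_ae (μ := volume) (s := A)
    (f := fun s => k s * k s) (ae_of_all _ fun s => mul_self_nonneg (k s))
    (hkint.bdd_mul hkm.aestronglyMeasurable (ae_of_all _ hkB))).mp hkk
  rw [EventuallyEq, ae_restrict_iff' hA] at hzero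
  filter_upwards [hzero] with s h1 hs
  have h2 : k s = 0 := mul_self_eq_zero.mp (h1 hs)
  rw [hkA s hs] at h2
  linarith

/-- Conservation of energy along minimizers. -/
theorem IsRegularMinimizer.exists_energy (hm : IsRegularMinimizer Ω H g u₀ x t η v l)
    (hH : AssumptionA1 H) (hg : IsBoundedC1 g) (ht : 0 ≤ t) :
    ∃ c, ∀ᵐ s, s ∈ Ioc 0 t → H (η s) (dualMomentum H (η s) (-v s)) = c := by
  set A : ℕ → Set ℝ := fun N => {s | s ∈ Ioc 0 t ∧ ‖v s‖ ≤ N ∧ l s ≤ N} with hA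
  have hAm : ∀ N, MeasurableSet (A N) := fun N =>
    measurableSet_Ioc.inter ((measurableSet_le hm.measurable_v.norm measurable_const).inter
      (measurableSet_le hm.measurable_l measurable_const))
  have hmono : Monotone A := fun N M hNM s hs =>
    ⟨hs.1, hs.2.1.trans (by exact_mod_cast hNM), hs.2.2.trans (by exact_mod_cast hNM)⟩
  choose c hc using fun N => hm.exists_energy_of_subset hH hg ht (hAm N)
    (fun s hs => hs.1) (M := N) (fun s hs => hs.2.1) (fun s hs => hs.2.2)
  have hcover : ∀ s ∈ Ioc 0 t, ∃ N, s ∈ A N := fun s hs => by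
    obtain ⟨N, hN⟩ := exists_nat_ge (max ‖v s‖ (l s))
    exact ⟨N, hs, (le_max_left _ _).trans hN, (le_max_right _ _).trans hN⟩
  -- If every `A N` is null, so is their union (0, t], and any constant will do. Otherwise the
  -- constants stabilize, because an increasing family agrees on a set of positive measure.
  by_cases hnull : ∀ N, volume (A N) = 0
  · refine ⟨0, ?_⟩
    have : ∀ᵐ s, ∀ N, s ∉ A N := ae_all_iff.mpr fun N => measure_eq_zero_iff_ae_notMem.mp (hnull N)
    filter_upwards [this] with s h1 hs
    obtain ⟨N, hN⟩ := hcover s hs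
    exact absurd hN (h1 N)
  · push Not at hnull
    obtain ⟨N₀, hN₀⟩ := hnull
    refine ⟨c N₀, ?_⟩
    have hconst : ∀ N, N₀ ≤ N → c N = c N₀ := fun N hN => by
      by_contra hne
      apply hN₀
      rw [measure_eq_zero_iff_ae_notMem]
      filter_upwards [hc N, hc N₀] with s h1 h2 hs
      exact hne ((h1 (hmono hN hs)).symm.trans (h2 hs))
    filter_upwards [ae_all_iff.mpr hc] with s h1 hs
    obtain ⟨N, hN⟩ := hcover s hs
    rw [← hconst (max N N₀) (le_max_right _ _)]
    exact h1 _ (hmono (le_max_left _ _) hN)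

/-- The momentum and the controls of a minimizer are bounded. -/
theorem IsRegularMinimizer.exists_bound (hm : IsRegularMinimizer Ω H g u₀ x t η v l)
    (hΩ : IsC2Domain Ω) (hH : AssumptionA1 H) (hg : IsBoundedC1 g) (ht : 0 ≤ t) :
    ∃ M, ∀ᵐ s, s ∈ Ioc 0 t → ‖v s‖ ≤ M ∧ l s ≤ M := by
  obtain ⟨c, hc⟩ := hm.exists_energy hH hg ht
  obtain ⟨R, hR⟩ := (isCompact_Icc (a := (0 : ℝ)) (b := t)).exists_bound_of_continuousOn
    hm.continuous.continuousOn
  -- Slope 1 suffices: H(η, p) ≥ |p| for |p| ≥ ρ, so conservation H = c forces |p| ≤ max(ρ, 1, |c|).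
  -- The 1 in the maximum only keeps the divisor |p| positive.
  have hev := hH.superlinear (|R| + 1) (by positivity) 1
  rw [← comap_norm_atTop, eventually_comap] at hev
  obtain ⟨ρ, hρ⟩ := eventually_atTop.mp hev
  set P := max (max ρ 1) |c| with hP
  obtain ⟨M, hM⟩ := ((isCompact_closedBall (0 : E) R).prod
    (isCompact_closedBall (0 : E) P)).exists_bound_of_continuousOn
    (f := fun z : E × E => gradP H z.1 z.2) hH.contDiff_gradP.continuous.continuousOn
  refine ⟨M, ?_⟩
  filter_upwards [hc, hm.isMinimizer.skorokhod.ae_tangential hΩ] with s h1 h2 hs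
  have hηs := hR s ⟨hs.1.le, hs.2⟩
  have hp : ‖dualMomentum H (η s) (-v s)‖ ≤ P := by
    by_contra hcon
    push Not at hcon
    have b1 : ρ ≤ P := (le_max_left _ _).trans (le_max_left _ _)
    have b2 : 1 ≤ P := (le_max_right _ _).trans (le_max_left _ _)
    have b3 : |c| ≤ P := le_max_right _ _
    have h3 := hρ _ (b1.trans hcon.le) _ rfl (η s) (by
      rw [mem_ball_zero_iff]; linarith [le_abs_self R])
    rw [le_div_iff₀ (by linarith), h1 hs] at h3
    linarith [le_abs_self c]
  have hv : ‖v s‖ ≤ M := by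
    have := hM (η s, dualMomentum H (η s) (-v s)) ⟨by simpa using hηs, by simpa using hp⟩
    simpa [hH.gradP_dualMomentum] using this
  refine ⟨hv, ?_⟩
  -- On the boundary l = v·ν ≤ |v|; elsewhere l = 0.
  by_cases hfr : η s ∈ frontier Ω
  · rw [h2 hs.1 (hΩ.notMem_of_mem_frontier hfr)]
    refine (real_inner_le_norm _ _).trans ?_
    rwa [hΩ.norm_outwardNormal hfr, mul_one]
  · rw [hm.eq_zero s hfr]
    exact (norm_nonneg _).trans hv

end Energy

/-! ### Symmetry of Dν and a C² retraction onto the boundary -/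

section Chart

open scoped NNReal

variable {n : ℕ} {Ω : Set (EuclideanSpace ℝ (Fin n))}

local notation "E" => EuclideanSpace ℝ (Fin n)

theorem IsDefiningFunction.contDiffAt_unitGradient {y : E} {φ : E → ℝ}
    (hφ : IsDefiningFunction Ω y φ) : ContDiffAt ℝ 1 (unitGradient φ) y :=
  ((hφ.contDiffAt_gradient.norm ℝ hφ.gradient_ne).inv
    (norm_ne_zero_iff.mpr hφ.gradient_ne)).smul hφ.contDiffAt_gradient

theorem IsDefiningFunction.inner_gradient_eq_zero_iff {y : E} {φ : E → ℝ}
    (hφ : IsDefiningFunction Ω y φ) (h : E) :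
    inner ℝ (gradient φ y) h = 0 ↔ inner ℝ (unitGradient φ y) h = 0 := by
  rw [hφ.gradient_eq_smul, real_inner_smul_left, mul_eq_zero,
    or_iff_right (norm_ne_zero_iff.mpr hφ.gradient_ne)]

/-- Moving from y along -∇φ makes φ negative, so y is a limit of points of Ω; y itself is not in Ω
because φ(y) = 0. -/
theorem IsDefiningFunction.mem_frontier {y : E} {φ : E → ℝ}
    (hφ : IsDefiningFunction Ω y φ) (h0 : φ y = 0) : y ∈ frontier Ω := by
  constructor
  · have h1 := eventually_neg_of_inner_neg (h := -gradient φ y)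
      (hφ.contDiffAt.differentiableAt (by norm_num)) h0 (by
        rw [inner_neg_right, neg_lt_zero]
        exact real_inner_self_pos.mpr hφ.gradient_ne)
    rw [mem_closure_iff_frequently]
    have h2 := tendsto_line y (-gradient φ y)
    refine h2.frequently (Eventually.frequently ?_)
    filter_upwards [h1, h2.eventually hφ.mem_iff] with t ht1 ht2 using ht2.mpr ht1
  · intro h
    have := (hφ.mem_iff.self_of_nhds).mp (interior_subset h)
    linarith

section NormalDeriv

variable {y : EuclideanSpace ℝ (Fin n)} {φ : EuclideanSpace ℝ (Fin n) → ℝ}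

theorem normalDeriv_apply_of_tangent (hφ : IsDefiningFunction Ω y φ) (hy : y ∈ frontier Ω) {h : E}
    (hh : inner ℝ (unitGradient φ y) h = 0) :
    normalDeriv Ω y h = fderiv ℝ (unitGradient φ) y h := by
  rw [normalDeriv_eq hφ hy]
  simp [tangentialPart, hh]

theorem normalDeriv_normal (hφ : IsDefiningFunction Ω y φ) (hy : y ∈ frontier Ω) :
    normalDeriv Ω y (unitGradient φ y) = 0 := by
  rw [normalDeriv_eq hφ hy]
  simp [tangentialPart, norm_unitGradient hφ.gradient_ne]

/-- Differentiate |∇φ/|∇φ||² = 1. -/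
theorem inner_fderiv_unitGradient (hφ : IsDefiningFunction Ω y φ) (h : E) :
    inner ℝ (fderiv ℝ (unitGradient φ) y h) (unitGradient φ y) = 0 := by
  have hd := hφ.differentiableAt_unitGradient.hasFDerivAt
  have h1 := hd.inner ℝ hd
  have h2 : (fun z => inner ℝ (unitGradient φ z) (unitGradient φ z)) =ᶠ[𝓝 y] fun _ => (1 : ℝ) := by
    filter_upwards [hφ.eventually] with z hz
    rw [real_inner_self_eq_norm_sq, norm_unitGradient hz.gradient_ne, one_pow]
  have h3 := (h1.congr_of_eventuallyEq h2.symm).unique (hasFDerivAt_const (1 : ℝ) y)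
  have h4 := congrArg (fun f : E →L[ℝ] ℝ => f h) h3
  simp only [ContinuousLinearMap.comp_apply, ContinuousLinearMap.prod_apply, fderivInnerCLM_apply,
    zero_apply] at h4
  rw [real_inner_comm] at h4
  linarith

theorem inner_fderiv_unitGradient_symm (hφ : IsDefiningFunction Ω y φ) {h k : E}
    (hh : inner ℝ (unitGradient φ y) h = 0) (hk : inner ℝ (unitGradient φ y) k = 0) :
    inner ℝ (fderiv ℝ (unitGradient φ) y h) k = inner ℝ (fderiv ℝ (unitGradient φ) y k) h := by
  have hsymm : IsSymmSndFDerivAt ℝ φ y := hφ.contDiffAt.isSymmSndFDerivAt (by simp)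
  have hgd : DifferentiableAt ℝ (gradient φ) y :=
    hφ.contDiffAt_gradient.differentiableAt (by norm_num)
  -- Differentiate ∇φ = |∇φ| ν. The derivative of |∇φ| multiplies ν and is annihilated by tangential
  -- b, so on tangent vectors |∇φ| Dν is the Hessian of φ, which is symmetric.
  have hN : ∀ a b : E, inner ℝ (unitGradient φ y) b = 0 →
      ‖gradient φ y‖ * inner ℝ (fderiv ℝ (unitGradient φ) y a) b
        = fderiv ℝ (fderiv ℝ φ) y a b := by
    intro a b hb
    have h1 : HasFDerivAt (fun z => inner ℝ (gradient φ z) b) _ y :=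
      hgd.hasFDerivAt.inner ℝ (hasFDerivAt_const b y)
    have h2 : HasFDerivAt (fun z => fderiv ℝ φ z b) _ y :=
      ((hφ.contDiffAt.fderiv_right (m := 1) (by norm_num)).differentiableAt
        (by norm_num)).hasFDerivAt.clm_apply (hasFDerivAt_const b y)
    have h0 : (fun z => inner ℝ (gradient φ z) b) = fun z => fderiv ℝ φ z b := by
      ext z; rw [inner_gradient]
    rw [h0] at h1
    have h3 := congrArg (fun f : E →L[ℝ] ℝ => f a) (h1.unique h2)
    have h4 := ((hgd.norm ℝ hφ.gradient_ne).hasFDerivAt.smul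
      hφ.differentiableAt_unitGradient.hasFDerivAt).congr_of_eventuallyEq
      (f₁ := gradient φ) (by
        filter_upwards [hφ.eventually] with z hz using hz.gradient_eq_smul)
    rw [h4.fderiv] at h3
    simp only [ContinuousLinearMap.comp_apply, ContinuousLinearMap.prod_apply,
      fderivInnerCLM_apply, zero_apply, inner_zero_right, zero_add, add_apply,
      smul_apply, ContinuousLinearMap.smulRight_apply, inner_add_left,
      real_inner_smul_left, hb, mul_zero, add_zero, ContinuousLinearMap.flip_apply,
      _root_.map_zero] at h3
    exact h3
  have h5 := hN h k hk
  have h6 := hN k h hh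
  have h7 := hsymm.eq h k
  rw [h7, ← h6] at h5
  exact mul_left_cancel₀ (norm_ne_zero_iff.mpr hφ.gradient_ne) h5

/-- By definition Dν sees only the tangential part of its argument, and its values are tangential
because |ν| = 1. Self-adjointness thus reduces to symmetry on tangent vectors. -/
theorem inner_normalDeriv_comm (hφ : IsDefiningFunction Ω y φ) (hy : y ∈ frontier Ω) (h k : E) :
    inner ℝ (normalDeriv Ω y h) k = inner ℝ h (normalDeriv Ω y k) := by
  have hT : ∀ a : E, inner ℝ (unitGradient φ y) (tangentialPart (unitGradient φ y) a) = 0 := by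
    intro a
    simp [tangentialPart, inner_sub_right, real_inner_smul_right,
      norm_unitGradient hφ.gradient_ne]
  have hdec : ∀ a b : E, inner ℝ (fderiv ℝ (unitGradient φ) y a) b
      = inner ℝ (fderiv ℝ (unitGradient φ) y a) (tangentialPart (unitGradient φ y) b) := by
    intro a b
    simp [tangentialPart, inner_sub_right, real_inner_smul_right, inner_fderiv_unitGradient hφ]
  rw [real_inner_comm (normalDeriv Ω y k) h, normalDeriv_eq hφ hy,
    ContinuousLinearMap.comp_apply, ContinuousLinearMap.comp_apply, hdec, hdec _ h,
    inner_fderiv_unitGradient_symm hφ (hT h) (hT k)]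

end NormalDeriv

/-- `Ψ` is a `C²` retraction of the open set `U` to the boundary, where `φ` is a defining
function of `Ω`. -/
structure IsBoundaryRetraction (Ω : Set E) (φ : E → ℝ) (Ψ : E → E) (U : Set E) : Prop where
  isOpen : IsOpen U
  defining : ∀ y ∈ U, IsDefiningFunction Ω y φ
  defining_map : ∀ y ∈ U, IsDefiningFunction Ω (Ψ y) φ
  contDiffAt : ∀ y ∈ U, ContDiffAt ℝ 2 Ψ y
  lipschitz : ∃ C : ℝ≥0, LipschitzOnWith C Ψ U
  mem_frontier : ∀ y ∈ U, Ψ y ∈ frontier Ω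
  map_eq : ∀ y ∈ U, y ∈ frontier Ω → Ψ y = y
  fderiv_eq : ∀ y ∈ U, y ∈ frontier Ω → ∀ h, inner ℝ (unitGradient φ y) h = 0 →
    fderiv ℝ Ψ y h = h

/-- With e the normal at x and P the projection orthogonal to e, the map Φ(y) = Py + φ(y)e flattens
∂Ω near x, and Ψ = Φ⁻¹ ∘ P slides points to ∂Ω in the direction e. Being built from φ alone, Ψ is
C², whereas the nearest-point projection onto a C² hypersurface is in general only C¹. Two
derivatives are needed, since the velocity of a varied trajectory already contains DΨ. -/
theorem IsC2Domain.exists_boundaryRetraction (hΩ : IsC2Domain Ω) {x : E} (hx : x ∈ frontier Ω) :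
    ∃ φ Ψ U, IsBoundaryRetraction Ω φ Ψ U ∧ x ∈ U := by
  obtain ⟨φ, hφ⟩ := hΩ.boundary x hx
  set e := unitGradient φ x with he
  have hee : inner ℝ e e = (1 : ℝ) := by
    rw [real_inner_self_eq_norm_sq, he, norm_unitGradient hφ.gradient_ne, one_pow]
  set P : E →L[ℝ] E := tangentialPart e with hP
  have hPapp : ∀ y, P y = y - inner ℝ e y • e := fun y => by simp [hP, tangentialPart]
  have heP : ∀ y, inner ℝ e (P y) = (0 : ℝ) := fun y => by
    rw [hPapp, inner_sub_right, real_inner_smul_right, hee, mul_one, sub_self]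
  set Φ : E → E := fun y => P y + φ y • e with hΦ
  have heΦ : ∀ y, inner ℝ e (Φ y) = φ y := fun y => by
    simp only [hΦ]
    rw [inner_add_right, heP, real_inner_smul_right, hee, zero_add, mul_one]
  -- The e-component gives ∇φ·h = 0 and the rest makes h a multiple of e; transversality ∇φ·e ≠ 0
  -- then forces h = 0.
  have hinj : ∀ y, inner ℝ (gradient φ y) e ≠ 0 → ∀ h,
      P h + (inner ℝ (gradient φ y) h) • e = 0 → h = 0 := by
    intro y hy h h0
    have h1 : inner ℝ (gradient φ y) h = 0 := by
      have := congrArg (fun z => inner ℝ e z) h0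
      simpa only [inner_add_right, heP, real_inner_smul_right, hee, zero_add, mul_one,
        inner_zero_right] using this
    rw [h1, zero_smul, add_zero, hPapp, sub_eq_zero] at h0
    rw [h0, real_inner_smul_right] at h1
    rw [h0, (mul_eq_zero.mp h1).resolve_right hy, zero_smul]
  have hΦd : ∀ y, IsDefiningFunction Ω y φ → ∀ h,
      fderiv ℝ Φ y h = P h + (inner ℝ (gradient φ y) h) • e := by
    intro y hy h
    have h1 : HasFDerivAt Φ _ y := P.hasFDerivAt.add
      ((hy.contDiffAt.differentiableAt (by norm_num)).hasFDerivAt.smul_const e)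
    rw [h1.fderiv, inner_gradient]
    simp
  have hΦc : ∀ y, IsDefiningFunction Ω y φ → ContDiffAt ℝ 2 Φ y := fun y hy =>
    P.contDiff.contDiffAt.add (hy.contDiffAt.smul contDiffAt_const)
  have hgx : inner ℝ (gradient φ x) e ≠ 0 := by
    rw [hφ.gradient_eq_smul, real_inner_smul_left, ← he, hee, mul_one]
    exact norm_ne_zero_iff.mpr hφ.gradient_ne
  obtain ⟨χ, hχ1, hχ2, hχ3, hχ4⟩ := exists_local_inverse (k := 2) (by norm_num) (hΦc x hφ)
    (fun h h0 => hinj x hgx h (by rw [← hΦd x hφ, h0]))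
  have hPx : P x = Φ x := by simp [hΦ, hφ.eq_zero hx]
  set Ψ : E → E := fun y => χ (P y) with hΨ
  have hΨc : ContDiffAt ℝ 2 Ψ x :=
    ContDiffAt.comp x (g := χ) (by rw [hPx]; exact hχ1) P.contDiff.contDiffAt
  have hΨx : Ψ x = x := by simp only [hΨ]; rw [hPx, hχ2]
  have hΨt : Tendsto Ψ (𝓝 x) (𝓝 x) := by
    have := hΨc.continuousAt.tendsto
    rwa [hΨx] at this
  have hPt : Tendsto P (𝓝 x) (𝓝 (Φ x)) := by
    rw [← hPx]; exact P.continuous.continuousAt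
  have ev1 : ∀ᶠ y in 𝓝 x, Φ (Ψ y) = P y := hPt.eventually hχ3
  have ev2 : ∀ᶠ y in 𝓝 x, inner ℝ (gradient φ y) e ≠ 0 :=
    (hφ.contDiffAt_gradient.continuousAt.inner continuousAt_const).eventually_ne hgx
  obtain ⟨C, T, hT, hC⟩ := (hΨc.of_le (by norm_num : (1 : WithTop ℕ∞) ≤ 2)).exists_lipschitzOnWith
  have hall : ∀ᶠ y in 𝓝 x, IsDefiningFunction Ω y φ ∧ IsDefiningFunction Ω (Ψ y) φ ∧
      ContDiffAt ℝ 2 Ψ y ∧ y ∈ T ∧ Ψ y ∈ frontier Ω ∧ (y ∈ frontier Ω → Ψ y = y) ∧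
      (y ∈ frontier Ω → ∀ h, inner ℝ (unitGradient φ y) h = 0 → fderiv ℝ Ψ y h = h) := by
    filter_upwards [hφ.eventually, hΨt.eventually hφ.eventually, hΨc.eventually (by simp), hT,
      ev1.eventually_nhds, ev2, hχ4] with y h1 h2 h3 h4 h5 h6 h7
    have hmap : y ∈ frontier Ω → Ψ y = y := fun hy => by
      have : P y = Φ y := by simp [hΦ, h1.eq_zero hy]
      simp only [hΨ]; rw [this, h7]
    refine ⟨h1, h2, h3, h4, h2.mem_frontier ?_, hmap, fun hy h hh => ?_⟩
    · rw [← heΦ, h5.self_of_nhds, heP]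
    · have d1 : HasFDerivAt (fun z => Φ (Ψ z)) _ y :=
        ((hΦc _ h2).differentiableAt (by norm_num)).hasFDerivAt.comp y
          (h3.differentiableAt (by norm_num)).hasFDerivAt
      have d2 : HasFDerivAt (fun z => Φ (Ψ z)) P y :=
        P.hasFDerivAt.congr_of_eventuallyEq h5
      have d3 := congrArg (fun f : E →L[ℝ] E => f h) (d1.unique d2)
      simp only [ContinuousLinearMap.comp_apply, hmap hy] at d3
      have d4 : fderiv ℝ Φ y h = P h := by
        rw [hΦd y h1, (h1.inner_gradient_eq_zero_iff h).mpr hh, zero_smul, add_zero]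
      -- From Φ ∘ Ψ = P one gets DΦ(DΨ h) = Ph, and for tangential h also DΦ h = Ph. Injectivity of
      -- DΦ gives DΨ h = h.
      have d5 : fderiv ℝ Φ y (fderiv ℝ Ψ y h - h) = 0 := by rw [map_sub, d3, d4, sub_self]
      rw [hΦd y h1] at d5
      exact sub_eq_zero.mp (hinj y h6 _ d5)
  obtain ⟨U, hU, hUo, hxU⟩ := eventually_nhds_iff.mp hall
  exact ⟨φ, Ψ, U, ⟨hUo, fun y hy => (hU y hy).1, fun y hy => (hU y hy).2.1,
    fun y hy => (hU y hy).2.2.1, ⟨C, hC.mono fun y hy => (hU y hy).2.2.2.1⟩,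
    fun y hy => (hU y hy).2.2.2.2.1, fun y hy => (hU y hy).2.2.2.2.2.1,
    fun y hy => (hU y hy).2.2.2.2.2.2⟩, hxU⟩

end Chart

/-! ### Variations along the boundary -/

section EulerLagrange

open scoped NNReal

variable {n : ℕ} {Ω : Set (EuclideanSpace ℝ (Fin n))}
  {H : EuclideanSpace ℝ (Fin n) → EuclideanSpace ℝ (Fin n) → ℝ}
  {g u₀ : EuclideanSpace ℝ (Fin n) → ℝ} {x : EuclideanSpace ℝ (Fin n)} {t : ℝ}
  {η v : ℝ → EuclideanSpace ℝ (Fin n)} {l : ℝ → ℝ}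
  {φ : EuclideanSpace ℝ (Fin n) → ℝ}
  {Ψ : EuclideanSpace ℝ (Fin n) → EuclideanSpace ℝ (Fin n)} {U : Set (EuclideanSpace ℝ (Fin n))}

local notation "E" => EuclideanSpace ℝ (Fin n)

/-- The position `Ψ(y + ε ψ h)` of the varied trajectory at `z = (ε, y, w, l, ψ, u)`. -/
def chartPosition (Ψ : E → E) (h : E) (z : ℝ × (E × E × ℝ × ℝ × ℝ)) : E :=
  Ψ (z.2.1 + (z.1 * z.2.2.2.2.1) • h)

/-- The control `η' + l ν(η)` of the varied trajectory at `z = (ε, y, w, l, ψ, u)`. -/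
def chartVelocity (φ : E → ℝ) (Ψ : E → E) (h : E) (z : ℝ × (E × E × ℝ × ℝ × ℝ)) : E :=
  fderiv ℝ Ψ (z.2.1 + (z.1 * z.2.2.2.2.1) • h) (z.2.2.1 + (z.1 * z.2.2.2.2.2) • h)
    + z.2.2.2.1 • unitGradient φ (chartPosition Ψ h z)

/-- The momentum in terms of `(η, η', l)`. -/
def chartMomentum (H : E → E → ℝ) (φ : E → ℝ) (z : E × E × ℝ) : E :=
  dualMomentum H z.1 (-(z.2.1 + z.2.2 • unitGradient φ z.1))

/-- The restriction `h ↦ p · DΨ h` of the momentum to the tangent space. -/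
def chartCovector (H : E → E → ℝ) (φ : E → ℝ) (Ψ : E → E) (z : E × E × ℝ) : E →L[ℝ] ℝ :=
  (innerSL ℝ (chartMomentum H φ z)).comp (fderiv ℝ Ψ z.1)

/-- The derivative of `chartCovector` along extremals. -/
def chartForce (H : E → E → ℝ) (g φ : E → ℝ) (Ψ : E → E) (z : E × E × ℝ) : E →L[ℝ] ℝ :=
  (innerSL ℝ (chartMomentum H φ z)).comp ((fderiv ℝ (fderiv ℝ Ψ) z.1).flip z.2.1)
    + z.2.2 • (innerSL ℝ (chartMomentum H φ z)).comp
      ((fderiv ℝ (unitGradient φ) z.1).comp (fderiv ℝ Ψ z.1))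
    + (innerSL ℝ (gradX H z.1 (chartMomentum H φ z) - z.2.2 • gradient g z.1)).comp
      (fderiv ℝ Ψ z.1)

namespace IsBoundaryRetraction

theorem contDiffAt_chartPosition (hr : IsBoundaryRetraction Ω φ Ψ U) {h : E}
    {z : ℝ × (E × E × ℝ × ℝ × ℝ)} (hz : z.2.1 + (z.1 * z.2.2.2.2.1) • h ∈ U) :
    ContDiffAt ℝ 1 (chartPosition Ψ h) z :=
  ((hr.contDiffAt _ hz).of_le (by norm_num)).comp z
    (f := fun z : ℝ × (E × E × ℝ × ℝ × ℝ) => z.2.1 + (z.1 * z.2.2.2.2.1) • h) (by fun_prop)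

theorem contDiffAt_chartVelocity (hr : IsBoundaryRetraction Ω φ Ψ U) {h : E}
    {z : ℝ × (E × E × ℝ × ℝ × ℝ)} (hz : z.2.1 + (z.1 * z.2.2.2.2.1) • h ∈ U) :
    ContDiffAt ℝ 1 (chartVelocity φ Ψ h) z := by
  have h1 : ContDiffAt ℝ 1 (fun z : ℝ × (E × E × ℝ × ℝ × ℝ) =>
      fderiv ℝ Ψ (z.2.1 + (z.1 * z.2.2.2.2.1) • h)) z :=
    ((hr.contDiffAt _ hz).fderiv_right (m := 1) (by norm_num)).comp z
      (f := fun z : ℝ × (E × E × ℝ × ℝ × ℝ) => z.2.1 + (z.1 * z.2.2.2.2.1) • h) (by fun_prop)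
  have h2 := ((hr.defining_map _ hz).contDiffAt_unitGradient).comp z
    (f := chartPosition Ψ h) (hr.contDiffAt_chartPosition hz)
  exact (h1.clm_apply (by fun_prop)).add
    (ContDiffAt.smul (f := fun z : ℝ × (E × E × ℝ × ℝ × ℝ) => z.2.2.2.1) (by fun_prop) h2)

theorem continuousAt_chartMomentum (hr : IsBoundaryRetraction Ω φ Ψ U) (hH : AssumptionA1 H)
    {z : E × E × ℝ} (hz : z.1 ∈ U) : ContinuousAt (chartMomentum H φ) z := by
  have h1 : ContinuousAt (fun z : E × E × ℝ => unitGradient φ z.1) z :=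
    (hr.defining _ hz).contDiffAt_unitGradient.continuousAt.comp (f := fun z : E × E × ℝ => z.1)
      (by fun_prop)
  exact hH.continuous_dualMomentum.continuousAt.comp
    (f := fun z : E × E × ℝ => (z.1, -(z.2.1 + z.2.2 • unitGradient φ z.1))) (by fun_prop)

theorem continuousAt_fderiv (hr : IsBoundaryRetraction Ω φ Ψ U) {z : E × E × ℝ} (hz : z.1 ∈ U) :
    ContinuousAt (fun z : E × E × ℝ => fderiv ℝ Ψ z.1) z :=
  ((hr.contDiffAt _ hz).fderiv_right (m := 1) (by norm_num)).continuousAt.comp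
    (f := fun z : E × E × ℝ => z.1) (by fun_prop)

theorem continuousAt_chartCovector (hr : IsBoundaryRetraction Ω φ Ψ U) (hH : AssumptionA1 H)
    {z : E × E × ℝ} (hz : z.1 ∈ U) : ContinuousAt (chartCovector H φ Ψ) z :=
  ((innerSL ℝ).continuous.continuousAt.comp (hr.continuousAt_chartMomentum hH hz)).clm_comp
    (hr.continuousAt_fderiv hz)

theorem continuousAt_chartForce (hr : IsBoundaryRetraction Ω φ Ψ U) (hH : AssumptionA1 H)
    (hg : IsBoundedC1 g) {z : E × E × ℝ} (hz : z.1 ∈ U) :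
    ContinuousAt (chartForce H g φ Ψ) z := by
  have hp := hr.continuousAt_chartMomentum hH hz
  have h1 : ContinuousAt (fun z => innerSL ℝ (chartMomentum H φ z)) z :=
    (innerSL ℝ).continuous.continuousAt.comp hp
  have h2 := hr.continuousAt_fderiv hz
  have h3 : ContinuousAt (fun z : E × E × ℝ => fderiv ℝ (fderiv ℝ Ψ) z.1) z :=
    (((hr.contDiffAt _ hz).fderiv_right (m := 1) (by norm_num)).fderiv_right (m := 0)
      (by norm_num)).continuousAt.comp (f := fun z : E × E × ℝ => z.1) (by fun_prop)
  have h4 : ContinuousAt (fun z : E × E × ℝ => (fderiv ℝ (fderiv ℝ Ψ) z.1).flip z.2.1) z :=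
    (((ContinuousLinearMap.flipₗᵢ ℝ E E E).continuous.continuousAt.comp h3).clm_apply
      (by fun_prop))
  have h5 : ContinuousAt (fun z : E × E × ℝ => fderiv ℝ (unitGradient φ) z.1) z :=
    ((hr.defining _ hz).contDiffAt_unitGradient.fderiv_right (m := 0)
      (by norm_num)).continuousAt.comp (f := fun z : E × E × ℝ => z.1) (by fun_prop)
  have h6 : ContinuousAt (fun z : E × E × ℝ => gradX H z.1 (chartMomentum H φ z)) z :=
    hH.continuous_gradX.continuousAt.comp
      (f := fun z : E × E × ℝ => (z.1, chartMomentum H φ z)) (by fun_prop)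
  have h7 : Continuous (gradient g) :=
    (InnerProductSpace.toDual ℝ E).symm.continuous.comp
      (hg.contDiff.continuous_fderiv (by norm_num))
  have h9 : ContinuousAt (fun z : E × E × ℝ => z.2.2 • gradient g z.1) z := by fun_prop
  have h8 : ContinuousAt (fun z : E × E × ℝ =>
      innerSL ℝ (gradX H z.1 (chartMomentum H φ z) - z.2.2 • gradient g z.1)) z :=
    (innerSL ℝ).continuous.continuousAt.comp (h6.sub h9)
  have k1 : ContinuousAt (fun z : E × E × ℝ => (innerSL ℝ (chartMomentum H φ z)).comp
      ((fderiv ℝ (fderiv ℝ Ψ) z.1).flip z.2.1)) z := h1.clm_comp h4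
  have k2 : ContinuousAt (fun z : E × E × ℝ => (innerSL ℝ (chartMomentum H φ z)).comp
      ((fderiv ℝ (unitGradient φ) z.1).comp (fderiv ℝ Ψ z.1))) z := h1.clm_comp (h5.clm_comp h2)
  have k3 : ContinuousAt (fun z : E × E × ℝ => z.2.2) z := by fun_prop
  have k4 : ContinuousAt (fun z : E × E × ℝ =>
      (innerSL ℝ (gradX H z.1 (chartMomentum H φ z) - z.2.2 • gradient g z.1)).comp
      (fderiv ℝ Ψ z.1)) z := h8.clm_comp h2
  exact (k1.add (k3.smul k2)).add k4

end IsBoundaryRetraction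

/-- The trajectory may be varied along the boundary while it stays there. -/
theorem IsSkorokhod.boundaryVariation (hs : IsSkorokhod Ω x η v l) (hΩ : IsC2Domain Ω)
    (hr : IsBoundaryRetraction Ω φ Ψ U) {a b : ℝ} (hab : a < b) (ha : 0 < a)
    (hfr : ∀ s ∈ Icc a b, η s ∈ frontier Ω) (hU : ∀ s ∈ Icc a b, η s ∈ U)
    {C : ℝ≥0} (hη : LipschitzOnWith C η (Icc a b)) {ζ u : ℝ → E} {C' : ℝ≥0}
    (hζ : LipschitzOnWith C' ζ (Icc a b)) (hζa : ζ a = 0) (hζb : ζ b = 0)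
    (hζd : ∀ᵐ s, s ∈ Icc a b → HasDerivAt ζ (u s) s)
    (hmem : ∀ s ∈ Icc a b, η s + ζ s ∈ U) {V : ℝ → E} (hV : IntegrableOn V (Icc a b))
    (hVeq : ∀ s ∈ Icc a b, V s
      = fderiv ℝ Ψ (η s + ζ s) (v s - l s • outwardNormal Ω (η s) + u s)
        + l s • unitGradient φ (Ψ (η s + ζ s))) :
    IsSkorokhod Ω x ((Icc a b).piecewise (fun s => Ψ (η s + ζ s)) η)
      ((Icc a b).piecewise V v) l := by
  classical
  set η' : ℝ → E := (Icc a b).piecewise (fun s => Ψ (η s + ζ s)) η with hη'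
  have hin : ∀ s ∈ Icc a b, η' s = Ψ (η s + ζ s) := fun s h => piecewise_eq_of_mem _ _ _ h
  have hout : ∀ s ∉ Icc a b, η' s = η s := fun s h => piecewise_eq_of_notMem _ _ _ h
  -- The varied arc joins the old trajectory at both ends because ζ vanishes there and Ψ fixes
  -- boundary points.
  have hηa : Ψ (η a + ζ a) = η a := by
    have := left_mem_Icc.mpr hab.le
    rw [hζa, add_zero, hr.map_eq _ (hU a this) (hfr a this)]
  have hηb : Ψ (η b + ζ b) = η b := by
    have := right_mem_Icc.mpr hab.le
    rw [hζb, add_zero, hr.map_eq _ (hU b this) (hfr b this)]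
  obtain ⟨CΨ, hCΨ⟩ := hr.lipschitz
  have hLip : LipschitzOnWith (CΨ * (C + C') + C) (fun s => Ψ (η s + ζ s) - η s) (Icc a b) :=
    (hCΨ.comp (hη.add hζ) hmem).sub hη
  set Z : ℝ → E := fun s => Ψ (η s + ζ s) - η s with hZ
  -- The displacement `Z` is zero at `a` and `b`. Freezing its argument outside [a, b] extends it by
  -- zero to a Lipschitz function on the line, so η' is η plus a Lipschitz function, hence
  -- absolutely continuous.
  have hext : LipschitzWith ((CΨ * (C + C') + C) * 1)
      (fun s => Z (projIcc a b hab.le s : ℝ)) :=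
    hLip.to_restrict.comp (LipschitzWith.projIcc hab.le)
  have hsum : η' = η + fun s => Z (projIcc a b hab.le s : ℝ) := by
    ext1 s
    simp only [Pi.add_apply, coe_projIcc]
    rcases lt_or_ge s a with h | h
    · rw [hout s (fun hs => by linarith [hs.1]), min_eq_right (by linarith), max_eq_left h.le]
      simp [hZ, hηa]
    rcases lt_or_ge b s with h' | h'
    · rw [hout s (fun hs => by linarith [hs.2]), min_eq_left h'.le, max_eq_right hab.le]
      simp [hZ, hηb]
    rw [hin s ⟨h, h'⟩, min_eq_right h', max_eq_right h]
    simp [hZ]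
  have hfr' : ∀ s ∈ Icc a b, η' s ∈ frontier Ω := fun s h => by
    rw [hin s h]; exact hr.mem_frontier _ (hmem s h)
  refine ⟨fun T hT => ?_, ?_, hs.locallyIntegrable_l, ?_, fun s h => ?_, ?_, hs.nonneg, ?_⟩
  · rw [hsum]
    exact (hs.absolutelyContinuous T hT).add
      (hext.lipschitzOnWith (s := uIcc 0 T)).absolutelyContinuousOnInterval
  · have hvi : IntegrableOn v (Icc a b) := hs.locallyIntegrable_v.integrableOn_compact_subset
      (fun s h => ha.le.trans h.1) isCompact_Icc
    have h1 : Integrable ((Icc a b).indicator (fun s => V s - v s)) :=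
      (hV.sub hvi).integrable_indicator measurableSet_Icc
    have h2 := hs.locallyIntegrable_v.add (h1.locallyIntegrable.locallyIntegrableOn (Ici 0))
    have h3 : (Icc a b).piecewise V v
        = v + (Icc a b).indicator (fun s => V s - v s) := by
      ext1 s
      by_cases h : s ∈ Icc a b <;> simp [h]
    rw [h3]; exact h2
  · rw [hout 0 (fun h => by linarith [h.1]), hs.initial]
  · by_cases h' : s ∈ Icc a b
    · exact frontier_subset_closure (hfr' s h')
    · rw [hout s h']; exact hs.mem_closure s h
  -- Away from the two endpoints each piece of the definition is valid in a neighbourhood of `s` and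
  -- can be differentiated.
  · have hne : ∀ᵐ s : ℝ, s ≠ a ∧ s ≠ b :=
      (Measure.ae_ne volume a).and (Measure.ae_ne volume b)
    filter_upwards [hs.equation, hζd, hne] with s h1 h2 h3 h0
    by_cases h : s ∈ Icc a b
    · have hnhds : Icc a b ∈ 𝓝 s :=
        Icc_mem_nhds (lt_of_le_of_ne h.1 (Ne.symm h3.1)) (lt_of_le_of_ne h.2 h3.2)
      have d1 : HasDerivAt (fun s => Ψ (η s + ζ s)) _ s :=
        ((hr.contDiffAt _ (hmem s h)).differentiableAt
          (by norm_num)).hasFDerivAt.comp_hasDerivAt s ((h1 h0).add (h2 h))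
      have d2 : HasDerivAt η' _ s := d1.congr_of_eventuallyEq (by
        filter_upwards [hnhds] with r hr' using hin r hr')
      rw [piecewise_eq_of_mem _ _ _ h, hVeq s h, hin s h,
        outwardNormal_eq (hr.defining_map _ (hmem s h)) (hr.mem_frontier _ (hmem s h)),
        add_sub_cancel_right]
      exact d2
    · have hnhds : (Icc a b)ᶜ ∈ 𝓝 s := isClosed_Icc.isOpen_compl.mem_nhds h
      rw [piecewise_eq_of_notMem _ _ _ h, hout s h]
      exact (h1 h0).congr_of_eventuallyEq (by
        filter_upwards [hnhds] with r hr' using hout r hr')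
  · filter_upwards [hs.eq_zero] with s h1 h0 hmemΩ
    by_cases h : s ∈ Icc a b
    · exact absurd hmemΩ (hΩ.notMem_of_mem_frontier (hfr' s h))
    · rw [hout s h] at hmemΩ; exact h1 h0 hmemΩ

end EulerLagrange

/-! ### The Euler-Lagrange equation on a boundary arc -/

section EulerLagrange

open scoped NNReal

variable {n : ℕ} {Ω : Set (EuclideanSpace ℝ (Fin n))}
  {H : EuclideanSpace ℝ (Fin n) → EuclideanSpace ℝ (Fin n) → ℝ}
  {g u₀ : EuclideanSpace ℝ (Fin n) → ℝ} {x : EuclideanSpace ℝ (Fin n)} {t : ℝ}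
  {η v : ℝ → EuclideanSpace ℝ (Fin n)} {l : ℝ → ℝ}
  {φ : EuclideanSpace ℝ (Fin n) → ℝ}
  {Ψ : EuclideanSpace ℝ (Fin n) → EuclideanSpace ℝ (Fin n)} {U : Set (EuclideanSpace ℝ (Fin n))}

local notation "E" => EuclideanSpace ℝ (Fin n)

theorem integrable_add_of_normed {α F : Type*} [MeasurableSpace α] [NormedAddCommGroup F]
    {μ : Measure α} {f₁ f₂ : α → F} (h₁ : Integrable f₁ μ) (h₂ : Integrable f₂ μ) :
    Integrable (fun a => f₁ a + f₂ a) μ := h₁.add h₂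

/-- First variation of the running cost under a variation along the boundary. -/
theorem IsBoundaryRetraction.hasDerivAt_chart (hr : IsBoundaryRetraction Ω φ Ψ U)
    (hH : AssumptionA1 H) (hg : IsBoundedC1 g) {y w h : E} {a ψ u : ℝ} (hy : y ∈ U)
    (hyf : y ∈ frontier Ω) (hw : inner ℝ (unitGradient φ y) w = 0) :
    HasDerivAt (fun ε : ℝ => lagrangian H (chartPosition Ψ h (ε, (y, w, a, ψ, u)))
        (-chartVelocity φ Ψ h (ε, (y, w, a, ψ, u))) + g (chartPosition Ψ h (ε, (y, w, a, ψ, u))) * a)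
      (-(u • chartCovector H φ Ψ (y, w, a) + ψ • chartForce H g φ Ψ (y, w, a)) h) 0 := by
  have hΨy : Ψ y = y := hr.map_eq y hy hyf
  have e0 : ∀ c : ℝ, y + ((0 : ℝ) * c) • h = y := fun c => by simp
  have d0 : HasDerivAt (fun ε : ℝ => y + (ε * ψ) • h) (ψ • h) 0 := by
    simpa using (((hasDerivAt_id (0 : ℝ)).mul_const ψ).smul_const h).const_add y
  have d0' : HasDerivAt (fun ε : ℝ => w + (ε * u) • h) (u • h) 0 := by
    simpa using (((hasDerivAt_id (0 : ℝ)).mul_const u).smul_const h).const_add w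
  have d1 : HasDerivAt (fun ε : ℝ => chartPosition Ψ h (ε, (y, w, a, ψ, u)))
      (fderiv ℝ Ψ y (ψ • h)) 0 := by
    have := ((hr.contDiffAt y hy).differentiableAt (by norm_num)).hasFDerivAt
    exact HasFDerivAt.comp_hasDerivAt (l := Ψ) (0 : ℝ) (by rw [e0]; exact this) d0
  have d2 : HasDerivAt (fun ε : ℝ => fderiv ℝ Ψ (y + (ε * ψ) • h))
      (fderiv ℝ (fderiv ℝ Ψ) y (ψ • h)) 0 := by
    have := (((hr.contDiffAt y hy).fderiv_right (m := 1) (by norm_num)).differentiableAt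
      (by norm_num)).hasFDerivAt
    exact HasFDerivAt.comp_hasDerivAt (l := fderiv ℝ Ψ) (0 : ℝ) (by rw [e0]; exact this) d0
  have hp0 : chartPosition Ψ h (0, (y, w, a, ψ, u)) = y := by
    simp [chartPosition, hΨy]
  have d3 : HasDerivAt (fun ε : ℝ => unitGradient φ (chartPosition Ψ h (ε, (y, w, a, ψ, u))))
      (fderiv ℝ (unitGradient φ) y (fderiv ℝ Ψ y (ψ • h))) 0 := by
    have := (hr.defining y hy).differentiableAt_unitGradient.hasFDerivAt
    exact HasFDerivAt.comp_hasDerivAt (l := unitGradient φ) (0 : ℝ)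
      (by rw [hp0]; exact this) d1
  have d4 : HasDerivAt (fun ε : ℝ => chartVelocity φ Ψ h (ε, (y, w, a, ψ, u))) _ 0 :=
    (d2.clm_apply d0').add (d3.const_smul a)
  -- At ε = 0 the original control is recovered because DΨ fixes the tangential velocity w.
  have hv0 : chartVelocity φ Ψ h (0, (y, w, a, ψ, u)) = w + a • unitGradient φ y := by
    simp [chartVelocity, hp0, hr.fderiv_eq y hy hyf w hw]
  have d5 := hasDerivAt_runningCost hH hg d1 d4 (hasDerivAt_const (0 : ℝ) a)
  refine d5.congr_deriv ?_
  rw [hp0, hv0]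
  simp only [chartCovector, chartForce, chartMomentum, zero_mul, zero_smul, add_zero,
    map_smul, smul_apply, add_apply, inner_add_right, real_inner_smul_right, mul_zero,
    ContinuousLinearMap.comp_apply, ContinuousLinearMap.flip_apply, innerSL_apply_apply,
    inner_sub_left, real_inner_smul_left, smul_eq_mul]
  ring

/-- Off the boundary `outwardNormal` is an arbitrary choice with no measurability; since l vanishes
there, it may be replaced by `boundaryNormal`. -/
theorem IsRegularMinimizer.measurable_velocity (hm : IsRegularMinimizer Ω H g u₀ x t η v l)
    (hΩ : IsC2Domain Ω) : Measurable fun s => v s - l s • outwardNormal Ω (η s) := by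
  have h1 : (fun s => v s - l s • outwardNormal Ω (η s))
      = fun s => v s - l s • boundaryNormal Ω (η s) :=
    funext fun s => by rw [hm.smul_boundaryNormal]
  rw [h1]
  exact hm.measurable_v.sub
    (hm.measurable_l.smul (hΩ.measurable_boundaryNormal.comp hm.continuous.measurable))

/-- Conservation of energy enters here: through the bounds on v and l it makes |η'| bounded. -/
theorem IsRegularMinimizer.lipschitzOnWith (hm : IsRegularMinimizer Ω H g u₀ x t η v l)
    (hΩ : IsC2Domain Ω) (hH : AssumptionA1 H) (hg : IsBoundedC1 g) (ht : 0 ≤ t) {a b : ℝ}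
    (hab : a ≤ b) (ha : 0 < a) (hb : b ≤ t) : ∃ C : ℝ≥0, LipschitzOnWith C η (Icc a b) := by
  obtain ⟨M, hM⟩ := hm.exists_bound hΩ hH hg ht
  have hs := hm.isMinimizer.skorokhod
  have hbd : ∀ᵐ s, s ∈ uIcc a b → ‖v s - l s • outwardNormal Ω (η s)‖ ≤ M + M := by
    filter_upwards [hM] with s h h'
    rw [uIcc_of_le hab] at h'
    obtain ⟨h1, h2⟩ := h ⟨ha.trans_le h'.1, h'.2.trans hb⟩
    refine (norm_sub_le _ _).trans (add_le_add h1 ?_)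
    rw [hm.smul_boundaryNormal, norm_smul, Real.norm_of_nonneg (hm.nonneg s)]
    exact (mul_le_of_le_one_right (hm.nonneg s) (hΩ.norm_boundaryNormal_le _)).trans h2
  refine ⟨_, uIcc_of_le hab ▸ lipschitzOnWith_of_absolutelyContinuous
    (w := fun s => v s - l s • outwardNormal Ω (η s)) (C := M + M)
    ((hs.absolutelyContinuous b (ha.trans_le hab)).mono ?_) ?_ ?_ hbd⟩
  · rw [uIcc_of_le hab, uIcc_of_le (ha.le.trans hab)]
    exact Icc_subset_Icc_left ha.le
  · filter_upwards [hs.equation] with s h h'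
    rw [uIcc_of_le hab] at h'
    exact h (ha.trans_le h'.1)
  · rw [intervalIntegrable_iff]
    refine Measure.integrableOn_of_bounded (M := M + M) (by simp)
      (hm.measurable_velocity hΩ).aestronglyMeasurable ?_
    rw [ae_restrict_iff' measurableSet_uIoc]
    filter_upwards [hbd] with s h h' using h (uIoc_subset_uIcc h')

/-- The Euler-Lagrange equation along a boundary arc. -/
theorem IsRegularMinimizer.euler_lagrange (hm : IsRegularMinimizer Ω H g u₀ x t η v l)
    (hΩ : IsC2Domain Ω) (hH : AssumptionA1 H) (hg : IsBoundedC1 g) (ht : 0 ≤ t)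
    (hr : IsBoundaryRetraction Ω φ Ψ U) {a b : ℝ} (hab : a < b) (ha : 0 < a) (hb : b < t)
    (hfr : ∀ s ∈ Icc a b, η s ∈ frontier Ω) (hU : ∀ s ∈ Icc a b, η s ∈ U) :
    ∃ R : ℝ → E →L[ℝ] ℝ, (∀ s, R s
        = chartForce H g φ Ψ (η s, v s - l s • outwardNormal Ω (η s), l s)) ∧
      IntervalIntegrable R volume a b ∧ (∃ C, ∀ᵐ s, s ∈ uIcc a b → ‖R s‖ ≤ C) ∧
      ∃ c, ∀ᵐ s, s ∈ Ioc a b →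
        chartCovector H φ Ψ (η s, v s - l s • outwardNormal Ω (η s), l s)
          = c + ∫ r in a..s, R r := by
  classical
  set A : Set ℝ := Icc a b with hA
  have hAt : A ⊆ Ioc 0 t := fun s hs => ⟨ha.trans_le hs.1, hs.2.trans hb.le⟩
  have hAv : volume A < ⊤ := measure_Icc_lt_top
  have hAm : MeasurableSet A := measurableSet_Icc
  have hs := hm.isMinimizer.skorokhod
  obtain ⟨M, hM⟩ := hm.exists_bound hΩ hH hg ht
  obtain ⟨C, hC⟩ := hm.lipschitzOnWith hΩ hH hg ht hab.le ha hb.le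
  set w : ℝ → E := fun s => v s - l s • outwardNormal Ω (η s) with hw
  have hwm : Measurable w := hm.measurable_velocity hΩ
  have hνA : ∀ s ∈ A, outwardNormal Ω (η s) = unitGradient φ (η s) := fun s h =>
    outwardNormal_eq (hr.defining _ (hU s h)) (hfr s h)
  have hwA : ∀ᵐ s, s ∈ A → inner ℝ (unitGradient φ (η s)) (w s) = 0 := by
    filter_upwards [hs.equation] with s h1 h
    rw [← hνA s h]
    refine hΩ.inner_outwardNormal_eq_zero (h1 (hAt h).1) ?_ (hfr s h)
    filter_upwards [lt_mem_nhds (hAt h).1] with r hr using hs.mem_closure r hr.le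
  have hbd : ∀ᵐ s, s ∈ A → ‖w s‖ ≤ M + M ∧ ‖l s‖ ≤ M := by
    filter_upwards [hM] with s h h'
    obtain ⟨h1, h2⟩ := h (hAt h')
    refine ⟨(norm_sub_le _ _).trans (add_le_add h1 ?_), ?_⟩
    · rw [norm_smul, hΩ.norm_outwardNormal (hfr s h'), mul_one, Real.norm_of_nonneg (hm.nonneg s)]
      exact h2
    · rwa [Real.norm_of_nonneg (hm.nonneg s)]
  set K0 : Set E := η '' A with hK0
  have hK0c : IsCompact K0 := isCompact_Icc.image hm.continuous
  have hK0U : K0 ⊆ U := by rintro _ ⟨s, h, rfl⟩; exact hU s h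
  -- Compactness of the arc gives a uniform margin `r` by which it can be displaced inside `U`.
  obtain ⟨r, hr0, hrU⟩ := hK0c.exists_thickening_subset_open hr.isOpen hK0U
  have hnear : ∀ y ∈ K0, ∀ z : E, ‖z‖ < r → y + z ∈ U := fun y hy z hz => by
    apply hrU
    rw [Metric.mem_thickening_iff]
    exact ⟨y, hy, by simpa using hz⟩
  -- the covector and the force along the trajectory
  set Z : ℝ → E × E × ℝ := fun s => (η s, w s, l s) with hZ
  have hZm : Measurable Z := hm.continuous.measurable.prodMk (hwm.prodMk hm.measurable_l)
  have hK1 : IsCompact (K0 ×ˢ (Metric.closedBall (0 : E) (M + M) ×ˢ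
      Metric.closedBall (0 : ℝ) M)) :=
    hK0c.prod ((isCompact_closedBall _ _).prod (isCompact_closedBall _ _))
  have hZK : ∀ᵐ s ∂(volume.restrict A), Z s ∈ K0 ×ˢ (Metric.closedBall (0 : E) (M + M) ×ˢ
      Metric.closedBall (0 : ℝ) M) := by
    rw [ae_restrict_iff' hAm]
    filter_upwards [hbd] with s h h'
    obtain ⟨h1, h2⟩ := h h'
    exact ⟨mem_image_of_mem _ h', by simpa using h1, by simpa using h2⟩
  have hfc : ContinuousOn (chartCovector H φ Ψ) (K0 ×ˢ (Metric.closedBall (0 : E) (M + M) ×ˢ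
      Metric.closedBall (0 : ℝ) M)) := fun z hz =>
    (hr.continuousAt_chartCovector hH (hK0U hz.1)).continuousWithinAt
  have hRc : ContinuousOn (chartForce H g φ Ψ) (K0 ×ˢ (Metric.closedBall (0 : E) (M + M) ×ˢ
      Metric.closedBall (0 : ℝ) M)) := fun z hz =>
    (hr.continuousAt_chartForce hH hg (hK0U hz.1)).continuousWithinAt
  have hfi : IntegrableOn (fun s => chartCovector H φ Ψ (Z s)) A :=
    integrableOn_comp_of_continuousOn hfc hK1 hZm hAv hZK
  have hRi : IntegrableOn (fun s => chartForce H g φ Ψ (Z s)) A :=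
    integrableOn_comp_of_continuousOn hRc hK1 hZm hAv hZK
  have hIcc : ∀ {F : Type} [NormedAddCommGroup F] {f : ℝ → F}, IntegrableOn f A →
      IntervalIntegrable f volume a b := fun {F} _ {f} hf => by
    rw [intervalIntegrable_iff_integrableOn_Icc_of_le hab.le]; exact hf
  have hRb : ∃ C, ∀ᵐ s, s ∈ uIcc a b → ‖chartForce H g φ Ψ (Z s)‖ ≤ C := by
    obtain ⟨B, hB⟩ := hK1.exists_bound_of_continuousOn hRc
    refine ⟨B, ?_⟩
    rw [ae_restrict_iff' hAm] at hZK
    rw [uIcc_of_le hab.le]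
    filter_upwards [hZK] with s h h' using hB _ (h h')
  obtain ⟨B, hB⟩ := hRb
  refine ⟨fun s => chartForce H g φ Ψ (Z s), fun s => rfl, hIcc hRi, ⟨B, hB⟩, ?_⟩
  refine du_bois_reymond hab (hIcc hfi) (hIcc hRi) hB ?_
  intro u hum hub hu0
  -- The primitive of the test function vanishes at `a`, and at `b` since `u` has mean zero. It is
  -- therefore an admissible amplitude for a variation with fixed ends.
  set ψ : ℝ → ℝ := fun s => ∫ r in a..s, u r with hψ
  have hui : ∀ c d, IntervalIntegrable u volume c d := fun c d => by
    rw [intervalIntegrable_iff]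
    exact Measure.integrableOn_of_bounded (M := 1) (by simp) hum.aestronglyMeasurable
      (ae_of_all _ hub)
  have hψc : Continuous ψ := intervalIntegral.continuous_primitive hui a
  have hψL : LipschitzOnWith (Real.toNNReal 1) ψ A := by
    have := lipschitzOnWith_integral (hui a b) (C := 1) (ae_of_all _ fun s _ => hub s)
    rwa [uIcc_of_le hab.le] at this
  have hψb : ∀ s ∈ A, ‖ψ s‖ ≤ b - a := fun s h => by
    have := intervalIntegral.norm_integral_le_of_norm_le_const (a := a) (b := s) (f := u)
      (C := 1) (fun r _ => hub r)
    rw [abs_of_nonneg (by linarith [h.1]), one_mul] at this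
    exact this.trans (by linarith [h.2])
  have hψd : ∀ᵐ s, s ∈ A → HasDerivAt ψ (u s) s := by
    filter_upwards [(hui a b).ae_hasDerivAt_integral] with s h h'
    rw [uIcc_of_le hab.le] at h
    exact h h' a (left_mem_Icc.mpr hab.le)
  set Y : ℝ → E × E × ℝ × ℝ × ℝ := fun s => (η s, w s, l s, ψ s, u s) with hY
  have hYm : Measurable Y := hm.continuous.measurable.prodMk (hwm.prodMk
    (hm.measurable_l.prodMk (hψc.measurable.prodMk hum)))
  set K : Set (E × E × ℝ × ℝ × ℝ) := K0 ×ˢ (Metric.closedBall (0 : E) (M + M) ×ˢ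
    (Metric.closedBall (0 : ℝ) M ×ˢ (Metric.closedBall (0 : ℝ) (b - a) ×ˢ
      Metric.closedBall (0 : ℝ) 1))) with hK
  have hKc : IsCompact K := hK0c.prod ((isCompact_closedBall _ _).prod
    ((isCompact_closedBall _ _).prod ((isCompact_closedBall _ _).prod (isCompact_closedBall _ _))))
  have hYK : ∀ᵐ s ∂(volume.restrict A), Y s ∈ K := by
    rw [ae_restrict_iff' hAm]
    filter_upwards [hbd] with s h h'
    obtain ⟨h1, h2⟩ := h h'
    refine ⟨mem_image_of_mem _ h', by simpa using h1, by simpa using h2, ?_, ?_⟩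
    · rw [mem_closedBall_zero_iff]; exact hψb s h'
    · rw [mem_closedBall_zero_iff]; exact hub s
  -- For each fixed direction h the variation is Ψ(η + εψh). The operator-valued identity follows by
  -- evaluating at every h.
  have hgoal : ∀ h : E, ∫ s in A, (u s • chartCovector H φ Ψ (Z s)
      + ψ s • chartForce H g φ Ψ (Z s)) h = 0 := by
    intro h
    set Γ : ℝ × (E × E × ℝ × ℝ × ℝ) → ℝ := fun z =>
      lagrangian H (chartPosition Ψ h z) (-chartVelocity φ Ψ h z)
        + g (chartPosition Ψ h z) * z.2.2.2.1 with hΓ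
    have hΓc : ∀ z : ℝ × (E × E × ℝ × ℝ × ℝ), z.2.1 + (z.1 * z.2.2.2.2.1) • h ∈ U →
        ContDiffAt ℝ 1 Γ z := fun z hz =>
      contDiff_runningCost hH hg (hr.contDiffAt_chartPosition hz) (hr.contDiffAt_chartVelocity hz)
        (by fun_prop)
    have key := first_variation hKc (fun y hy => hΓc (0, y) (by simpa using hK0U hy.1)) hYm hAv
      hYK (D := fun s => -(u s • chartCovector H φ Ψ (Z s)
        + ψ s • chartForce H g φ Ψ (Z s)) h) (by
      have hev : ∀ᶠ ε in 𝓝 (0 : ℝ), |ε| * (b - a) * ‖h‖ < r := by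
        have hc : Continuous fun ε : ℝ => |ε| * (b - a) * ‖h‖ := by fun_prop
        exact hc.continuousAt.eventually (gt_mem_nhds (by simpa using hr0))
      filter_upwards [hev] with ε hε
      have hsmall : ∀ c : ℝ, ‖c‖ ≤ b - a → ‖(ε * c) • h‖ < r := fun c hc => by
        rw [norm_smul, norm_mul, Real.norm_eq_abs]
        exact lt_of_le_of_lt (by gcongr) hε
      have hUK : ∀ y ∈ K, y.1 + (ε * y.2.2.2.1) • h ∈ U := fun y hy =>
        hnear _ hy.1 _ (hsmall _ (by simpa using hy.2.2.2.1))
      have hUA : ∀ s ∈ A, η s + (ε * ψ s) • h ∈ U := fun s h' =>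
        hnear _ (mem_image_of_mem _ h') _ (hsmall _ (hψb s h'))
      set V : ℝ → E := fun s => chartVelocity φ Ψ h (ε, Y s) with hV
      have hVi : IntegrableOn V A := integrableOn_comp_of_continuousOn
        (f := fun y => chartVelocity φ Ψ h (ε, y)) (fun y hy =>
          ((hr.contDiffAt_chartVelocity (z := (ε, y)) (hUK y hy)).continuousAt.comp
            (f := fun y => (ε, y)) (by fun_prop)).continuousWithinAt) hKc hYm hAv hYK
      have hsk := hs.boundaryVariation hΩ hr hab ha hfr hU hC
        (ζ := fun s => (ε * ψ s) • h) (u := fun s => (ε * u s) • h)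
        (C' := ‖ε‖₊ * Real.toNNReal 1 * ‖h‖₊) (LipschitzOnWith.of_dist_le_mul fun s h1 s' h2 => by
          have := hψL.dist_le_mul s h1 s' h2
          rw [dist_eq_norm, ← sub_smul, ← mul_sub, norm_smul, norm_mul]
          rw [dist_eq_norm] at this
          push_cast
          calc ‖ε‖ * ‖ψ s - ψ s'‖ * ‖h‖
              ≤ ‖ε‖ * (Real.toNNReal 1 * dist s s') * ‖h‖ := by gcongr
            _ = _ := by simp only [Real.coe_toNNReal', max_eq_left zero_le_one]; ring)
        (by simp [hψ]) (by simp [hψ, hu0])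
        (by
          filter_upwards [hψd] with s h1 h2
          exact ((h1 h2).const_mul ε).smul_const h)
        hUA hVi (fun s h' => rfl)
      -- Because b < t the final point is untouched, so the terminal cost plays no role.
      have hone := hm.isMinimizer.setIntegral_le ht hAm hAt hsk
        (piecewise_eq_of_notMem _ _ _ (fun h' => by linarith [h'.2]))
        (c := fun s => Γ (ε, Y s))
        (ae_of_all _ fun s _ (h' : s ∉ Icc a b) => by
          simp only [runningCost, piecewise_eq_of_notMem _ _ _ h'])
        (integrableOn_comp_of_continuousOn (f := fun y => Γ (ε, y)) (fun y hy =>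
          ((hΓc (ε, y) (hUK y hy)).continuousAt.comp
            (f := fun y => (ε, y)) (by fun_prop)).continuousWithinAt) hKc hYm hAv hYK)
        (ae_of_all _ fun s (h' : s ∈ Icc a b) => by
          simp only [runningCost, piecewise_eq_of_mem _ _ _ h']; rfl)
      refine le_trans (le_of_eq ?_) hone
      refine setIntegral_congr_ae hAm ?_
      filter_upwards [hwA] with s h1 h'
      have e1 : chartPosition Ψ h (0, Y s) = η s := by
        simp [chartPosition, hY, hr.map_eq _ (hU s h') (hfr s h')]
      have e2 : chartVelocity φ Ψ h (0, Y s) = v s := by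
        simp only [chartVelocity, e1]
        simp only [hY, zero_mul, zero_smul, add_zero]
        rw [hr.fderiv_eq _ (hU s h') (hfr s h') _ (h1 h'), ← hνA s h', hw]
        simp
      simp only [hΓ, e1, e2, runningCost]
      rfl)
      (by
        rw [ae_restrict_iff' hAm]
        filter_upwards [hwA] with s h1 h'
        exact hr.hasDerivAt_chart hH hg (hU s h') (hfr s h') (h1 h'))
    rw [integral_neg, neg_eq_zero] at key
    exact key
  have hi1 : IntegrableOn (fun s => u s • chartCovector H φ Ψ (Z s)) A :=
    hfi.bdd_smul 1 hum.aestronglyMeasurable (ae_of_all _ hub)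
  have hi2 : IntegrableOn (fun s => ψ s • chartForce H g φ Ψ (Z s)) A := by
    refine Integrable.bdd_smul hRi (b - a) hψc.aestronglyMeasurable ?_
    rw [ae_restrict_iff' hAm]
    exact ae_of_all _ hψb
  rw [intervalIntegral.integral_of_le hab.le, ← integral_Icc_eq_integral_Ioc]
  ext h
  have hi3 := integrable_add_of_normed hi1 hi2
  exact (ContinuousLinearMap.integral_apply hi3 h).trans (hgoal h)

end EulerLagrange

/-! ### The equation for p near a reflection time -/

section LocalMomentum

open scoped NNReal

variable {n : ℕ} {Ω : Set (EuclideanSpace ℝ (Fin n))}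
  {H : EuclideanSpace ℝ (Fin n) → EuclideanSpace ℝ (Fin n) → ℝ}
  {g u₀ : EuclideanSpace ℝ (Fin n) → ℝ} {x : EuclideanSpace ℝ (Fin n)} {t : ℝ}
  {η v : ℝ → EuclideanSpace ℝ (Fin n)} {l : ℝ → ℝ}
  {φ : EuclideanSpace ℝ (Fin n) → ℝ}
  {Ψ : EuclideanSpace ℝ (Fin n) → EuclideanSpace ℝ (Fin n)} {U : Set (EuclideanSpace ℝ (Fin n))}

local notation "E" => EuclideanSpace ℝ (Fin n)

theorem eq_of_inner_tangential_normal {N p q : E} (hN : ‖N‖ = 1)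
    (h1 : ∀ h, inner ℝ N h = 0 → inner ℝ p h = inner ℝ q h)
    (h2 : inner ℝ p N = inner ℝ q N) : p = q := by
  refine ext_inner_right ℝ fun h => ?_
  have h3 := h1 (h - inner ℝ N h • N) (by
    rw [inner_sub_right, real_inner_smul_right, real_inner_self_eq_norm_sq, hN]; ring)
  rw [inner_sub_right, inner_sub_right, real_inner_smul_right, real_inner_smul_right, h2] at h3
  linarith

/-- The right-hand side of the equation for `p'`, characterized by its tangential and normal
components. -/
theorem eq_reflectedForce {y p π w : E} {a : ℝ} (hφ : IsDefiningFunction Ω y φ)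
    (hy : y ∈ frontier Ω) (hw : w = -gradP H y p - a • unitGradient φ y)
    (hwN : inner ℝ (unitGradient φ y) w = 0)
    (h1 : ∀ h, inner ℝ (unitGradient φ y) h = 0 → inner ℝ π h
      = a * inner ℝ p (fderiv ℝ (unitGradient φ) y h) + inner ℝ (gradX H y p - a • gradient g y) h)
    (h2 : inner ℝ π (unitGradient φ y) + inner ℝ p (fderiv ℝ (unitGradient φ) y w)
      = inner ℝ (gradient g y) w) :
    π = reflectedForce Ω H g y p := by
  have hN := norm_unitGradient hφ.gradient_ne
  have hNN : inner ℝ (unitGradient φ y) (unitGradient φ y) = (1 : ℝ) := by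
    rw [real_inner_self_eq_norm_sq, hN, one_pow]
  -- Pairing D_pH = -w - aν with ν identifies the reflection intensity a with -D_pH·ν.
  have ha : inner ℝ (gradP H y p) (unitGradient φ y) = -a := by
    rw [hw, inner_sub_right, inner_neg_right, real_inner_smul_right, hNN, real_inner_comm] at hwN
    linarith
  have hgp : gradP H y p = -w - a • unitGradient φ y := by rw [hw]; abel
  have hDN := normalDeriv_normal hφ hy
  -- In the tangential component Dν is moved from the test vector onto p by self-adjointness. In the
  -- normal component Dν p drops out, as Dν ν = 0.
  refine eq_of_inner_tangential_normal hN (fun h hh => ?_) ?_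
  · rw [h1 h hh, reflectedForce, outwardNormal_eq hφ hy, ha,
      ← normalDeriv_apply_of_tangent hφ hy hh, ← inner_normalDeriv_comm hφ hy]
    simp only [inner_sub_left, inner_add_left, real_inner_smul_left, hh]
    ring
  · have h3 : inner ℝ (normalDeriv Ω y (gradP H y p)) p
        = -inner ℝ p (fderiv ℝ (unitGradient φ) y w) := by
      rw [hgp, map_sub, map_smul, hDN, smul_zero, sub_zero, map_neg, inner_neg_left,
        normalDeriv_apply_of_tangent hφ hy hwN, real_inner_comm]
    have h4 : inner ℝ (normalDeriv Ω y p) (unitGradient φ y) = 0 := by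
      rw [inner_normalDeriv_comm hφ hy, hDN, inner_zero_right]
    have h5 : inner ℝ (gradient g y) (gradP H y p)
        = -inner ℝ (gradient g y) w - a * inner ℝ (gradient g y) (unitGradient φ y) := by
      rw [hgp, inner_sub_right, inner_neg_right, real_inner_smul_right]
    rw [reflectedForce, outwardNormal_eq hφ hy]
    simp only [inner_sub_left, inner_add_left, real_inner_smul_left, hNN, ha, h3, h4, h5]
    linarith

/-- The covector on the tangent space at `y` and the normal component `g y` determine a vector. -/
def gluedMomentum (g φ : E → ℝ) (z : (E →L[ℝ] ℝ) × E) : E :=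
  (InnerProductSpace.toDual ℝ E).symm z.1
    + (g z.2 - inner ℝ ((InnerProductSpace.toDual ℝ E).symm z.1) (unitGradient φ z.2)) •
      unitGradient φ z.2

theorem contDiffAt_gluedMomentum (hg : IsBoundedC1 g) {z : (E →L[ℝ] ℝ) × E}
    (hφ : IsDefiningFunction Ω z.2 φ) : ContDiffAt ℝ 1 (gluedMomentum g φ) z := by
  have h1 : ContDiffAt ℝ 1 (fun z : (E →L[ℝ] ℝ) × E => unitGradient φ z.2) z :=
    hφ.contDiffAt_unitGradient.comp z contDiffAt_snd
  have h2 : ContDiffAt ℝ 1 (fun z : (E →L[ℝ] ℝ) × E =>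
      (InnerProductSpace.toDual ℝ E).symm z.1) z :=
    (InnerProductSpace.toDual ℝ E).symm.toContinuousLinearEquiv.contDiff.contDiffAt.comp z
      contDiffAt_fst
  have h3 : ContDiffAt ℝ 1 (fun z : (E →L[ℝ] ℝ) × E => g z.2) z :=
    hg.contDiff.contDiffAt.comp z contDiffAt_snd
  exact h2.add ((h3.sub (h2.inner ℝ h1)).smul h1)

theorem inner_gluedMomentum_normal {z : (E →L[ℝ] ℝ) × E} (hφ : IsDefiningFunction Ω z.2 φ) :
    inner ℝ (gluedMomentum g φ z) (unitGradient φ z.2) = g z.2 := by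
  rw [gluedMomentum, inner_add_left, real_inner_smul_left, real_inner_self_eq_norm_sq,
    norm_unitGradient hφ.gradient_ne]
  ring

theorem inner_gluedMomentum_of_tangent {z : (E →L[ℝ] ℝ) × E} {h : E}
    (hh : inner ℝ (unitGradient φ z.2) h = 0) : inner ℝ (gluedMomentum g φ z) h = z.1 h := by
  rw [gluedMomentum, inner_add_left, real_inner_smul_left, hh, mul_zero, add_zero,
    InnerProductSpace.toDual_symm_apply]

/-- The Euler-Lagrange primitive `Q` supplies the tangential part of p and g(η) the normal part.
Thus p is a C¹ function of the Lipschitz curve (Q, η). The two defining identities hold on an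
interval and may be differentiated there, yielding the two components of p'. -/
theorem IsRegularMinimizer.exists_local_momentum (hm : IsRegularMinimizer Ω H g u₀ x t η v l)
    (hΩ : IsC2Domain Ω) (hH : AssumptionA1 H) (hg : IsBoundedC1 g) (ht : 0 ≤ t)
    (hr : IsBoundaryRetraction Ω φ Ψ U) {a b s₀ : ℝ} (hs₀ : s₀ ∈ Ioo a b) (ha : 0 < a) (hb : b < t)
    (hfr : ∀ s ∈ Icc a b, η s ∈ frontier Ω) (hU : ∀ s ∈ Icc a b, η s ∈ U)
    (hl : ∀ᵐ s, s ∈ Ioo a b → 0 < l s) :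
    ∃ p : ℝ → E, ∃ K : ℝ≥0, ∃ V : Set ℝ, IsOpen V ∧ s₀ ∈ V ∧ LipschitzOnWith K p V ∧
      ∀ᵐ s, s ∈ V → p s = dualMomentum H (η s) (-v s) ∧
        HasDerivAt p (reflectedForce Ω H g (η s) (p s)) s := by
  have hab : a < b := hs₀.1.trans hs₀.2
  have hs := hm.isMinimizer.skorokhod
  obtain ⟨R, hR, hRi, ⟨C, hRC⟩, c, hc⟩ := hm.euler_lagrange hΩ hH hg ht hr hab ha hb hfr hU
  obtain ⟨C', hηL⟩ := hm.lipschitzOnWith hΩ hH hg ht hab.le ha hb.le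
  set Q : ℝ → E →L[ℝ] ℝ := fun s => c + ∫ r in a..s, R r with hQ
  have hIL := lipschitzOnWith_integral hRi hRC
  rw [uIcc_of_le hab.le] at hIL
  have hQL : LipschitzOnWith (Real.toNNReal C) Q (Icc a b) := fun s h1 s' h2 => by
    simpa only [hQ, edist_add_left] using hIL h1 h2
  have hzL : LipschitzOnWith (max (Real.toNNReal C) C') (fun s => (Q s, η s)) (Icc a b) :=
    hQL.prodMk hηL
  set p : ℝ → E := fun s => gluedMomentum g φ (Q s, η s) with hp
  have hsub : Ioo a b ⊆ Icc a b := Ioo_subset_Icc_self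
  have hF : ∀ s ∈ Icc a b, ContDiffAt ℝ 1 (gluedMomentum g φ) (Q s, η s) := fun s h =>
    contDiffAt_gluedMomentum (z := (Q s, η s)) hg (hr.defining _ (hU s h))
  have hpc : ContinuousOn p (Ioo a b) := fun s h =>
    (ContinuousAt.comp_continuousWithinAt (f := fun s => (Q s, η s))
      (hF s (hsub h)).continuousAt (hzL.continuousOn s (hsub h))).mono hsub
  have hηc := hm.continuous
  have hpae : ∀ᵐ s, s ∈ Ioo a b → p s = dualMomentum H (η s) (-v s) ∧
      chartMomentum H φ (η s, v s - l s • outwardNormal Ω (η s), l s) = p s ∧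
      chartCovector H φ Ψ (η s, v s - l s • outwardNormal Ω (η s), l s) = Q s := by
    filter_upwards [hc, hl, hm.ae_inner_momentum_eq hΩ hH hg ht] with s h1 h2 h3 h
    have h1' := h1 ⟨h.1, h.2.le⟩
    have h3' := h3 ⟨ha.trans h.1, (h.2.trans hb).le⟩ (h2 h)
    have hy := hfr s (hsub h)
    have hd := hr.defining _ (hU s (hsub h))
    have hcm : chartMomentum H φ (η s, v s - l s • outwardNormal Ω (η s), l s)
        = dualMomentum H (η s) (-v s) := by
      simp [chartMomentum, outwardNormal_eq hd hy]
    have heq : p s = dualMomentum H (η s) (-v s) := by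
      rw [outwardNormal_eq hd hy] at h3'
      refine eq_of_inner_tangential_normal (norm_unitGradient hd.gradient_ne) (fun h' hh => ?_) ?_
      · rw [hp, inner_gluedMomentum_of_tangent (z := (Q s, η s)) hh]
        change (c + ∫ r in a..s, R r) h' = _
        rw [← h1', chartCovector, ContinuousLinearMap.comp_apply, hcm, innerSL_apply_apply,
          hr.fderiv_eq _ (hU s (hsub h)) hy h' hh]
      · rw [h3', hp]
        exact inner_gluedMomentum_normal (z := (Q s, η s)) hd
    exact ⟨heq, hcm.trans heq.symm, h1'⟩
  have hDΨ : ∀ s ∈ Icc a b, ContDiffAt ℝ 1 (fderiv ℝ Ψ) (η s) := fun s h =>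
    (hr.contDiffAt _ (hU s h)).fderiv_right (by norm_num)
  -- The tangent space moves with s; composing with DΨ(η) gives an identity for a fixed vector h. It
  -- holds a.e. between continuous functions, hence everywhere on the interval, and so can be
  -- differentiated.
  have hid1 : ∀ h : E, EqOn (fun s => inner ℝ (p s) (fderiv ℝ Ψ (η s) h)) (fun s => Q s h)
      (Ioo a b) := by
    intro h
    refine Measure.eqOn_open_of_ae_eq (μ := volume) ?_ isOpen_Ioo ?_ ?_
    · rw [EventuallyEq, ae_restrict_iff' measurableSet_Ioo]
      filter_upwards [hpae] with s h1 h2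
      obtain ⟨-, h3, h4⟩ := h1 h2
      rw [← h4, ← h3, chartCovector, ContinuousLinearMap.comp_apply, innerSL_apply_apply]
    · exact hpc.inner fun s h1 => (((hDΨ s (hsub h1)).continuousAt.comp
        hηc.continuousAt).clm_apply continuousAt_const).continuousWithinAt
    · exact (hQL.continuousOn.mono hsub).clm_apply continuousOn_const
  obtain ⟨K, W, hW, hKW⟩ := (hF s₀ (hsub hs₀)).exists_lipschitzOnWith
  have hzc : ContinuousAt (fun s => (Q s, η s)) s₀ :=
    hzL.continuousOn.continuousAt (Icc_mem_nhds hs₀.1 hs₀.2)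
  obtain ⟨V, hVsub, hVo, hV⟩ := mem_nhds_iff.mp (inter_mem (hzc hW) (Ioo_mem_nhds hs₀.1 hs₀.2))
  refine ⟨p, K * max (Real.toNNReal C) C', V, hVo, hV,
    hKW.comp (hzL.mono fun s h => hsub (hVsub h).2) fun s h => (hVsub h).1, ?_⟩
  filter_upwards [hpae, hs.equation, hs.ae_tangential hΩ, hRi.ae_hasDerivAt_integral]
    with s h1 h2 h3 h4 hsV
  have hsI := (hVsub hsV).2
  have hsJ := hsub hsI
  have hs0 : 0 < s := ha.trans hsI.1
  obtain ⟨e1, e2, e3⟩ := h1 hsI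
  have hy := hfr s hsJ
  have hd := hr.defining _ (hU s hsJ)
  have dη := h2 hs0
  have htan := h3 hs0 (hΩ.notMem_of_mem_frontier hy)
  have dQ : HasDerivAt Q (R s) s := by
    have := h4 (by rwa [uIcc_of_le hab.le]) a left_mem_uIcc
    exact this.const_add c
  have hRs := hR s
  rw [outwardNormal_eq hd hy] at dη hRs htan
  rw [outwardNormal_eq hd hy] at e2
  set w := v s - l s • unitGradient φ (η s) with hw
  have hwN : inner ℝ (unitGradient φ (η s)) w = 0 := by
    rw [hw, inner_sub_right, real_inner_smul_right, real_inner_self_eq_norm_sq,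
      norm_unitGradient hd.gradient_ne, htan, real_inner_comm]
    ring
  have dp : HasDerivAt p (deriv p s) s :=
    (DifferentiableAt.comp (g := gluedMomentum g φ) (f := fun s => (Q s, η s)) s
      ((hF s hsJ).differentiableAt (by norm_num))
      (dQ.differentiableAt.prodMk dη.differentiableAt)).hasDerivAt
  refine ⟨e1, dp.congr_deriv (eq_reflectedForce (φ := φ) (w := w) (a := l s) hd hy ?_ hwN ?_ ?_)⟩
  · rw [e1, hH.gradP_dualMomentum, neg_neg, hw]
  · intro h hh
    have dD := HasFDerivAt.comp_hasDerivAt (l := fderiv ℝ Ψ) s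
      ((hDΨ s hsJ).differentiableAt (by norm_num)).hasFDerivAt dη
    have d1 := dp.inner ℝ (dD.clm_apply (hasDerivAt_const s h))
    have d2 := (dQ.clm_apply (hasDerivAt_const s h)).congr_of_eventuallyEq
      ((hid1 h).eventuallyEq_of_mem (Ioo_mem_nhds hsI.1 hsI.2))
    have d3 := d1.unique d2
    -- Differentiating p·DΨ(η)h produces p·D²Ψ(w, h), while the force contains p·D²Ψ(h, w); by
    -- symmetry they cancel and the equation no longer depends on Ψ.
    have hsym := ((hr.contDiffAt _ (hU s hsJ)).isSymmSndFDerivAt (by simp)).eq w h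
    have hΨh := hr.fderiv_eq _ (hU s hsJ) hy h hh
    simp only [map_zero, add_zero, Function.comp_apply, hΨh] at d3
    rw [hRs, chartForce] at d3
    simp only [e2, add_apply, smul_apply, smul_eq_mul, ContinuousLinearMap.comp_apply,
      ContinuousLinearMap.flip_apply, innerSL_apply_apply, hΨh, hsym] at d3
    linarith
  · have dN := HasFDerivAt.comp_hasDerivAt (l := unitGradient φ) s
      hd.differentiableAt_unitGradient.hasFDerivAt dη
    have dg := HasFDerivAt.comp_hasDerivAt (l := g) s
      (hg.contDiff.differentiable (by norm_num) (η s)).hasFDerivAt dη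
    -- The normal component of p' comes from differentiating p·ν(η) = g(η), valid throughout the
    -- interval.
    have d1 := (dp.inner ℝ dN).unique (dg.congr_of_eventuallyEq (by
      filter_upwards [Ioo_mem_nhds hsI.1 hsI.2] with r hr'
      exact inner_gluedMomentum_normal (z := (Q r, η r)) (hr.defining _ (hU r (hsub hr')))))
    rw [inner_gradient, ← d1]
    simp only [Function.comp_apply]
    ring

end LocalMomentum

/-! ### Regular representatives and patching -/

section Normalization

open scoped NNReal

variable {n : ℕ} {Ω : Set (EuclideanSpace ℝ (Fin n))}
  {H : EuclideanSpace ℝ (Fin n) → EuclideanSpace ℝ (Fin n) → ℝ}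
  {g u₀ : EuclideanSpace ℝ (Fin n) → ℝ} {x : EuclideanSpace ℝ (Fin n)} {t : ℝ}
  {η v : ℝ → EuclideanSpace ℝ (Fin n)} {l : ℝ → ℝ}

local notation "E" => EuclideanSpace ℝ (Fin n)

theorem absolutelyContinuousOnInterval_congr {X : Type*} [PseudoMetricSpace X] {f₁ f₂ : ℝ → X}
    {a b : ℝ} (hf : AbsolutelyContinuousOnInterval f₁ a b) (h : EqOn f₁ f₂ (uIcc a b)) :
    AbsolutelyContinuousOnInterval f₂ a b := by
  rw [absolutelyContinuousOnInterval_iff] at hf ⊢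
  intro ε hε
  obtain ⟨δ, hδ, hf⟩ := hf ε hε
  refine ⟨δ, hδ, fun e he hlt => lt_of_eq_of_lt (Finset.sum_congr rfl fun i hi => ?_) (hf e he hlt)⟩
  obtain ⟨h1, h2⟩ := he.1 i hi
  rw [h h1, h h2]

/-- The path of a minimizer may be made continuous, and its controls Borel measurable. -/
theorem IsMinimizer.exists_isRegularMinimizer (hm : IsMinimizer Ω H g u₀ x t η v l)
    (hΩ : IsC2Domain Ω) (ht : 0 ≤ t) :
    ∃ η₀ v₀ l₀, IsRegularMinimizer Ω H g u₀ x t η₀ v₀ l₀ ∧ (∀ s, 0 ≤ s → η₀ s = η s) ∧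
      ∀ᵐ s, 0 < s → v₀ s = v s ∧ l₀ s = l s := by
  have hs := hm.skorokhod
  have hvm := hs.locallyIntegrable_v.aestronglyMeasurable
  have hlm := hs.locallyIntegrable_l.aestronglyMeasurable
  have hηc : ContinuousOn η (Ici 0) := fun s (h : 0 ≤ s) => by
    have h1 := (hs.absolutelyContinuous (s + 1) (by linarith)).continuousOn
    rw [uIcc_of_le (by linarith)] at h1
    refine (h1 s ⟨h, by linarith⟩).mono_of_mem_nhdsWithin ?_
    rw [mem_nhdsWithin]
    exact ⟨Iio (s + 1), isOpen_Iio, by simp, fun r hr => ⟨hr.2, le_of_lt hr.1⟩⟩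
  -- Values at negative times are irrelevant; freezing η at time 0 makes it continuous on the whole
  -- line.
  set η₀ : ℝ → E := fun s => η (max s 0) with hη₀
  have hη₀c : Continuous η₀ := hηc.comp_continuous (by fun_prop) fun s => mem_Ici.mpr (le_max_right _ _)
  have hη : ∀ s, 0 ≤ s → η₀ s = η s := fun s h => by simp [hη₀, max_eq_left h]
  set v₀ : ℝ → E := hvm.mk v with hv₀
  set S : Set ℝ := η₀ ⁻¹' frontier Ω with hS
  -- A Borel representative, truncated at zero and cut off to the boundary times, so that the sign
  -- and support conditions hold at every time and not only a.e.
  set l₀ : ℝ → ℝ := S.indicator fun s => max (hlm.mk l s) 0 with hl₀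
  have hv : ∀ᵐ s, 0 < s → v₀ s = v s := by
    have := hvm.ae_eq_mk
    rw [EventuallyEq, ae_restrict_iff' measurableSet_Ici] at this
    filter_upwards [this] with s h h' using (h h'.le).symm
  have hl : ∀ᵐ s, 0 < s → l₀ s = l s := by
    have := hlm.ae_eq_mk
    rw [EventuallyEq, ae_restrict_iff' measurableSet_Ici] at this
    filter_upwards [this, hs.nonneg, hs.eq_zero] with s h1 h2 h3 h
    by_cases hfr : η s ∈ frontier Ω
    · rw [hl₀, indicator_of_mem (by rwa [hS, mem_preimage, hη s h.le]), ← h1 h.le,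
        max_eq_left (h2 h)]
    · rw [hl₀, indicator_of_notMem (by rwa [hS, mem_preimage, hη s h.le])]
      refine (h3 h ?_).symm
      by_contra hΩs
      exact hfr (hΩ.mem_frontier (hs.mem_closure s h.le) hΩs)
  have hev : ∀ s, 0 < s → η₀ =ᶠ[𝓝 s] η := fun s h => by
    filter_upwards [lt_mem_nhds h] with r hr using hη r hr.le
  have hres : ∀ {F : Type} {f₁ f₂ : ℝ → F}, (∀ᵐ s, 0 < s → f₁ s = f₂ s) →
      f₂ =ᵐ[volume.restrict (Ici 0)] f₁ := fun h => by
    rw [EventuallyEq, restrict_Ioi_eq_restrict_Ici.symm, ae_restrict_iff' measurableSet_Ioi]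
    filter_upwards [h] with s h1 h2 using (h1 h2).symm
  have hsk : IsSkorokhod Ω x η₀ v₀ l₀ :=
    { absolutelyContinuous := fun T hT => absolutelyContinuousOnInterval_congr
        (hs.absolutelyContinuous T hT) fun s h => by
          rw [uIcc_of_le hT.le] at h
          exact (hη s h.1).symm
      locallyIntegrable_v := hs.locallyIntegrable_v.congr (hres hv)
      locallyIntegrable_l := hs.locallyIntegrable_l.congr (hres hl)
      initial := by rw [hη 0 le_rfl, hs.initial]
      mem_closure := fun s h => by rw [hη s h]; exact hs.mem_closure s h
      equation := by
        filter_upwards [hs.equation, hv, hl] with s h1 h2 h3 h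
        rw [h2 h, h3 h, hη s h.le]
        exact (h1 h).congr_of_eventuallyEq (hev s h)
      nonneg := by
        filter_upwards [hs.nonneg, hl] with s h1 h2 h
        rw [h2 h]; exact h1 h
      eq_zero := by
        filter_upwards [hs.eq_zero, hl] with s h1 h2 h h'
        rw [h2 h]; exact h1 h (hη s h.le ▸ h') }
  have hcost : ∀ᵐ s, s ∈ uIoc 0 t → runningCost H g η v l s = runningCost H g η₀ v₀ l₀ s := by
    filter_upwards [hv, hl] with s h1 h2 h
    rw [uIoc_of_le ht] at h
    simp only [runningCost, h1 h.1, h2 h.1, hη s h.1.le]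
  have htot : totalCost H g u₀ t η₀ v₀ l₀ = totalCost H g u₀ t η v l := by
    rw [totalCost, totalCost, hη t ht, intervalIntegral.integral_congr_ae hcost]
  refine ⟨η₀, v₀, l₀, ⟨⟨hsk, ?_, fun η' v' l' h1 h2 => htot ▸ hm.le η' v' l' h1 h2⟩, hη₀c,
    hvm.stronglyMeasurable_mk.measurable, ?_, fun s => ?_, fun s h => ?_⟩, hη, ?_⟩
  · refine hm.integrable.congr_ae ?_
    rw [EventuallyEq, ae_restrict_iff' measurableSet_uIoc]
    exact hcost
  · exact (hlm.stronglyMeasurable_mk.measurable.max measurable_const).indicator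
      (hη₀c.measurable isClosed_frontier.measurableSet)
  · exact indicator_nonneg (fun _ _ => le_max_right _ _) s
  · exact indicator_of_notMem (s := S) h _
  · filter_upwards [hv, hl] with s h1 h2 h using ⟨h1 h, h2 h⟩

/-- Local Lipschitz representatives of `P` solving an equation patch together. -/
theorem exists_locallyLipschitzOn_of_local {F : Type*} [NormedAddCommGroup F] [NormedSpace ℝ F]
    {I : Set ℝ} (hI : IsOpen I) {P : ℝ → F} {G : ℝ → F → F}
    (h : ∀ s₀ ∈ I, ∃ p : ℝ → F, ∃ K : ℝ≥0, ∃ V : Set ℝ, IsOpen V ∧ s₀ ∈ V ∧ LipschitzOnWith K p V ∧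
      ∀ᵐ s, s ∈ V → p s = P s ∧ HasDerivAt p (G s (p s)) s) :
    ∃ p : ℝ → F, LocallyLipschitzOn I p ∧
      ∀ᵐ s, s ∈ I → p s = P s ∧ HasDerivAt p (G s (p s)) s := by
  classical
  choose! p K V hVo hV hL hae using h
  -- On an overlap both local representatives agree a.e. with `P` and are continuous, hence
  -- coincide. The diagonal s ↦ p s s is therefore equal to p s₀ near s₀.
  have heq : ∀ s₀ ∈ I, EqOn (fun s => p s s) (p s₀) (V s₀ ∩ I) := fun s₀ h0 s h1 => by
    have hc : EqOn (p s) (p s₀) (V s ∩ V s₀) := by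
      refine Measure.eqOn_open_of_ae_eq (μ := volume) ?_ ((hVo s h1.2).inter (hVo s₀ h0))
        ((hL s h1.2).continuousOn.mono inter_subset_left)
        ((hL s₀ h0).continuousOn.mono inter_subset_right)
      rw [EventuallyEq, ae_restrict_iff' ((hVo s h1.2).inter (hVo s₀ h0)).measurableSet]
      filter_upwards [hae s h1.2, hae s₀ h0] with r h2 h3 h4
      rw [(h2 h4.1).1, (h3 h4.2).1]
    exact hc ⟨hV s h1.2, h1.1⟩
  have hnhds : ∀ s₀ ∈ I, V s₀ ∩ I ∈ 𝓝 s₀ := fun s₀ h0 =>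
    ((hVo s₀ h0).inter hI).mem_nhds ⟨hV s₀ h0, h0⟩
  refine ⟨fun s => p s s, fun s₀ h0 => ⟨K s₀, V s₀ ∩ I,
    mem_nhdsWithin_of_mem_nhds (hnhds s₀ h0), fun s h1 s' h2 => ?_⟩, ?_⟩
  · rw [heq s₀ h0 h1, heq s₀ h0 h2]
    exact hL s₀ h0 h1.1 h2.1
  · rw [ae_iff]
    refine measure_null_of_locally_null _ fun s₀ h0 => ?_
    have h0' : s₀ ∈ I := by
      by_contra hc
      exact h0 fun h => absurd h hc
    refine ⟨_, inter_mem_nhdsWithin _ (hnhds s₀ h0'), ?_⟩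
    refine measure_mono_null ?_ (ae_iff.mp (hae s₀ h0'))
    intro s hs hcon
    refine hs.1 fun _ => ?_
    obtain ⟨h1, h2⟩ := hcon hs.2.1
    have h3 : p s s = p s₀ s := heq s₀ h0' hs.2
    refine ⟨h3.trans h1, ?_⟩
    simp only [h3]
    exact h2.congr_of_eventuallyEq ((heq s₀ h0').eventuallyEq_of_mem
      (((hVo s₀ h0').inter hI).mem_nhds hs.2))

theorem interior_reflectionTimes_subset : interior (reflectionTimes Ω t η l) ⊆ Ioo 0 t := by
  rw [← interior_Icc]
  exact interior_mono fun s hs => hs.1.1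

end Normalization
end ReflectedHJ
end

/-! ### Assembly of the three conclusions -/

theorem mainTheorem3 (n : ℕ) (Ω : Set (EuclideanSpace ℝ (Fin n))) (hΩ : ReflectedHJ.IsC2Domain Ω)
    (H : EuclideanSpace ℝ (Fin n) → EuclideanSpace ℝ (Fin n) → ℝ)
    (hH : ReflectedHJ.AssumptionA1 H)
    (g u₀ : EuclideanSpace ℝ (Fin n) → ℝ)
    (hg : ReflectedHJ.IsBoundedC1 g) (hu₀ : ReflectedHJ.IsBoundedC1 u₀)
    (x : EuclideanSpace ℝ (Fin n)) (t : ℝ) (hx : x ∈ closure Ω) (ht : 0 ≤ t)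
    (η v : ℝ → EuclideanSpace ℝ (Fin n)) (l : ℝ → ℝ)
    (hmin : ReflectedHJ.IsMinimizer Ω H g u₀ x t η v l) :
    (∀ᵐ s, s ∈ ReflectedHJ.boundaryTimes Ω t η →
      l s = -inner ℝ (ReflectedHJ.gradP H (η s) (ReflectedHJ.momentum H η v s))
        (ReflectedHJ.outwardNormal Ω (η s))) ∧
    (∀ᵐ s, s ∈ ReflectedHJ.reflectionTimes Ω t η l →
      inner ℝ (ReflectedHJ.momentum H η v s) (ReflectedHJ.outwardNormal Ω (η s)) = g (η s)) ∧
    ∃ p : ℝ → EuclideanSpace ℝ (Fin n),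
      LocallyLipschitzOn (interior (ReflectedHJ.reflectionTimes Ω t η l)) p ∧
      ∀ᵐ s, s ∈ interior (ReflectedHJ.reflectionTimes Ω t η l) →
        p s = ReflectedHJ.momentum H η v s ∧
        HasDerivAt η
          (-ReflectedHJ.gradP H (η s) (p s)
            + inner ℝ (ReflectedHJ.gradP H (η s) (p s)) (ReflectedHJ.outwardNormal Ω (η s)) •
              ReflectedHJ.outwardNormal Ω (η s)) s ∧
        HasDerivAt p (ReflectedHJ.reflectedForce Ω H g (η s) (p s)) s := by
  have hs := hmin.skorokhod
  obtain ⟨η₀, v₀, l₀, hm, hη, hvl⟩ := hmin.exists_isRegularMinimizer hΩ ht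
  have hmom : ∀ s, ReflectedHJ.momentum H η v s = ReflectedHJ.dualMomentum H (η s) (-v s) :=
    fun s => hH.gradient_lagrangian _ _
  -- With D_pH(η, p) = -v, conclusion (i) becomes the pointwise formula l = v·ν of
  -- `IsSkorokhod.ae_tangential`.
  have hgp : ∀ s, ReflectedHJ.gradP H (η s) (ReflectedHJ.momentum H η v s) = -v s :=
    fun s => by rw [hmom, hH.gradP_dualMomentum]
  -- The boundary times may include 0, whereas the Skorokhod conditions are imposed only for
  -- positive times.
  have h0 : ∀ᵐ s : ℝ, s ≠ 0 := by simp [ae_iff]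
  refine ⟨?_, ?_, ?_⟩
  · filter_upwards [hs.ae_tangential hΩ, h0] with s h1 h2 h3
    rw [hgp, inner_neg_left, neg_neg]
    exact h1 (lt_of_le_of_ne h3.1.1 h2.symm) h3.2
  · filter_upwards [hm.ae_inner_momentum_eq hΩ hH hg ht, h0, hvl] with s h1 h2 h3 h4
    have hpos : 0 < s := lt_of_le_of_ne h4.1.1.1 h2.symm
    have h5 := h1 ⟨hpos, h4.1.1.2⟩
    rw [(h3 hpos).1, (h3 hpos).2, hη s hpos.le] at h5
    rw [hmom]
    exact h5 h4.2
  · set I := interior (ReflectedHJ.reflectionTimes Ω t η l) with hI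
    have hsub : I ⊆ Ioo 0 t := ReflectedHJ.interior_reflectionTimes_subset
    have hfr : ∀ s ∈ I, η₀ s ∈ frontier Ω := fun s h => by
      have h1 := interior_subset h
      rw [hη s h1.1.1.1]
      exact hΩ.mem_frontier (hs.mem_closure s h1.1.1.1) h1.1.2
    obtain ⟨p, hpL, hp⟩ := ReflectedHJ.exists_locallyLipschitzOn_of_local (I := I)
      isOpen_interior (P := fun s => ReflectedHJ.dualMomentum H (η₀ s) (-v₀ s))
      (G := fun s => ReflectedHJ.reflectedForce Ω H g (η₀ s)) (by
        intro s₀ hs₀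
        obtain ⟨φ, Ψ, U, hr, hU⟩ := hΩ.exists_boundaryRetraction (hfr s₀ hs₀)
        -- A closed interval around s₀ inside this set is a boundary arc that stays in the domain of
        -- the retraction.
        have hnhds : I ∩ η₀ ⁻¹' U ∈ 𝓝 s₀ := inter_mem (isOpen_interior.mem_nhds hs₀)
          (hm.continuous.continuousAt (hr.isOpen.mem_nhds hU))
        obtain ⟨δ, hδ, hball⟩ := Metric.nhds_basis_closedBall.mem_iff.mp hnhds
        rw [Real.closedBall_eq_Icc] at hball
        have hδ' : s₀ - δ ≤ s₀ + δ := by linarith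
        refine hm.exists_local_momentum hΩ hH hg ht hr (a := s₀ - δ) (b := s₀ + δ)
          ⟨by linarith, by linarith⟩ (hsub (hball (left_mem_Icc.mpr hδ')).1).1
          (hsub (hball (right_mem_Icc.mpr hδ')).1).2 (fun s h => hfr s (hball h).1)
          (fun s h => (hball h).2) ?_
        filter_upwards [hvl] with s h1 h2
        have h3 := (hball (Ioo_subset_Icc_self h2)).1
        rw [(h1 (hsub h3).1).2]
        exact (interior_subset h3).2)
    refine ⟨p, hpL, ?_⟩
    filter_upwards [hp, hvl, hs.equation, hs.ae_tangential hΩ] with s h1 h2 h3 h4 h5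
    have hpos := (hsub h5).1
    obtain ⟨e1, e2⟩ := h1 h5
    rw [(h2 hpos).1, hη s hpos.le, ← hmom] at e1
    rw [hη s hpos.le] at e2
    refine ⟨e1, ?_, e2⟩
    -- Since D_pH = -v and v·ν = l, the claimed velocity is v - lν, which is the Skorokhod equation.
    rw [e1, hgp, neg_neg, inner_neg_left, neg_smul, ← sub_eq_add_neg,
      ← h4 hpos (interior_subset h5).1.2]
    exact h3 hpos
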